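/- **Setting.** Let $m\ge 2$, and let $n_s,d_s\in\mathbb N=\{0,1,2,\dots\}$ for $s\in\mathbb Z_m=\mathbb Z/m\mathbb Z$. A *spin index* is a pair $(s,\alpha)$ with $s\in\mathbb Z_m$ and $1\le\alpha\le d_s$. Put $\mathcal V_s=\mathbb C^{n_s}$ and $\mathcal V_{\rm cyc}=\bigoplus_{s}\mathcal V_s$. Let $\mathcal M^\bullet=\mathcal M^\bullet_{Q_{\mathbf d},\mathbf n}$ (with $\mathbf n=(1,n_0,\dots,n_{m-1})$) be the affine variety of all tuples of complex matrices $$X_s\in \mathrm{Mat}(n_s\times n_{s+1}),\quad Y_s\in\mathrm{Mat}(n_{s+1}\times n_s),\quad V_{s,\alpha}\in\mathrm{Mat}(1\times n_s),\quad W_{s,\alpha}\in\mathrm{Mat}(n_s\times 1)$$ ($s\in\mathbb Z_m$, $(s,\alpha)$ spin indices) such that all of $\mathrm{Id}+X_sY_s$, $\mathrm{Id}+Y_sX_s$, $\mathrm{Id}+W_{s,\alpha}V_{s,\alpha}$, $1+V_{s,\alpha}W_{s,\alpha}$ are invertible. View $X=\sum_sX_s$, $Y=\sum_sY_s$ as endomorphisms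 of $\mathcal V_{\rm cyc}$, with $X_s\in\mathrm{Hom}(\mathcal V_{s+1},\mathcal V_s)$ and $Y_s\in\mathrm{Hom}(\mathcal V_s,\mathcal V_{s+1})$, and likewise $V_{s,\alpha}\in \mathrm{Hom}(\mathcal V_{\rm cyc},\mathbb C)$, $W_{s,\alpha}\in\mathrm{Hom}(\mathbb C,\mathcal V_{\rm cyc})$, extended by zero. Let $\mathcal M^\circ\subset\mathcal M^\bullet$ be the open subvariety where $\det X\ne0$ (it is empty unless all $n_s$ are equal); on it put $Z=Y+X^{-1}$. **Bracket.** For $s,r\in\mathbb Z_m$ with representatives in $\{0,\dots,m-1\}$ let $o(s,r)=\mathrm{sgn}(r-s)$, and let $o(\alpha,\beta)=\mathrm{sgn}(\beta-\alpha)$. The algebras of regular functions on $\mathcal M^\bullet$ and $\mathcal M^\circ$ carry the antisymmetric $\mathbb C$-bilinear biderivation $\{-,-\}$ determined by $$\begin{aligned} \{(X_r)_{ij},(X_s)_{kl}\}&=\tfrac12\delta_{s,r-1}(X_{r-1}X_r)_{kj}\delta_{il}-\tfrac12\delta_{s,r+1}\delta_{kj}(X_rX_{r+1})_{il},\\ \{(Y_r)_{ij},(Y_s)_{kl}\}&=\tfrac12\delta_{s,r-1}\delta_{kj}(Y_rY_{r-1})_{il}-\tfrac12\delta_{s,r+1}(Y_{r+1}Y_r)_{kj}\delta_{il},\\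 \{(X_r)_{ij},(Y_s)_{kl}\}&=\delta_{sr}\big(\delta_{kj}\delta_{il}+\tfrac12(Y_rX_r)_{kj}\delta_{il}+\tfrac12\delta_{kj}(X_rY_r)_{il}\big)\\ &\quad-\tfrac12\delta_{s,r-1}(X_r)_{kj}(Y_{r-1})_{il}+\tfrac12\delta_{s,r+1}(Y_{r+1})_{kj}(X_r)_{il},\\ \{(X_r)_{ij},(W_{s,\alpha})_k\}&=\tfrac12\delta_{s,r+1}\delta_{kj}(X_rW_{r+1,\alpha})_i-\tfrac12\delta_{rs}(X_r)_{kj}(W_{r,\alpha})_i,\\ \{(X_r)_{ij},(V_{s,\alpha})_l\}&=\tfrac12\delta_{rs}(V_{r,\alpha}X_r)_j\delta_{il}-\tfrac12\delta_{s,r+1}(V_{r+1,\alpha})_j(X_r)_{il},\\ \{(Y_r)_{ij},(W_{s,\alpha})_k\}&=\tfrac12\delta_{rs}\delta_{kj}(Y_rW_{r,\alpha})_i-\tfrac12\delta_{s,r+1}(Y_r)_{kj}(W_{r+1,\alpha})_i,\\ \{(Y_r)_{ij},(V_{s,\alpha})_l\}&=\tfrac12\delta_{s,r+1}(V_{r+1,\alpha}Y_r)_j\delta_{il}-\tfrac12\delta_{rs}(V_{r,\alpha})_j(Y_r)_{il},\\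 \{(V_{s,\alpha})_j,(V_{r,\beta})_l\}&=-\tfrac12o(s,r)(V_{s,\alpha})_j(V_{r,\beta})_l-\tfrac12\delta_{sr}o(\alpha,\beta)\big((V_{r,\beta})_j(V_{s,\alpha})_l+(V_{s,\alpha})_j(V_{r,\beta})_l\big),\\ \{(W_{s,\alpha})_i,(W_{r,\beta})_k\}&=-\tfrac12o(s,r)(W_{r,\beta})_k(W_{s,\alpha})_i-\tfrac12\delta_{sr}o(\alpha,\beta)\big((W_{r,\beta})_k(W_{s,\alpha})_i+(W_{s,\alpha})_k(W_{r,\beta})_i\big),\\ \{(V_{s,\alpha})_j,(W_{r,\beta})_k\}&=\tfrac12o(s,r)(W_{r,\beta})_k(V_{s,\alpha})_j+\delta_{sr}\delta_{\alpha\beta}\big(\delta_{kj}+\tfrac12(W_{r,\beta})_k(V_{s,\alpha})_j+\tfrac12\delta_{kj}V_{s,\alpha}W_{r,\beta}\big)\\ &\quad+\tfrac12\delta_{sr}o(\alpha,\beta)\big(\delta_{kj}V_{s,\alpha}W_{r,\beta}+(W_{r,\beta})_k(V_{s,\alpha})_j\big). \end{aligned}$$ **Proposition 3.1.** Let $\mathtt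 L$ be $X$ or $Y$ on $\mathcal M^\bullet$, or $Z$ on $\mathcal M^\circ$, and consider the algebras of regular functions $$\mathcal H_{\mathtt L}=\mathbb C[\mathrm{tr}(\mathtt L^k)\mid k\in\mathbb N],\qquad \mathcal I_{\mathtt L}=\mathbb C[\mathrm{tr}(\mathtt L^k),\ \mathrm{tr}(W_{s,\alpha}V_{r,\beta}\mathtt L^k)\mid k\in\mathbb N,\ (s,\alpha),(r,\beta)\text{ spin indices}].$$ Then: 1. $\mathcal H_{\mathtt L}$ is an abelian Poisson algebra, i.e. $\{F,G\}=0$ for all $F,G\in\mathcal H_{\mathtt L}$; 2. $\{\mathrm{tr}(\mathtt L^k),\mathrm{tr}(W_{s,\alpha}V_{r,\beta}\mathtt L^l)\}=0$ for all $k,l\in\mathbb N$ and all spin indices $(s,\alpha),(r,\beta)$; 3. $\mathcal I_{\mathtt L}$ is a Poisson algebra: it is closed under $\{-,-\}$, and the restriction of $\{-,-\}$ to it is an antisymmetric biderivation satisfying the Jacobi identity; 4. $\mathcal H_{\mathtt L}$ lies in the Poisson centre of $\mathcal I_{\mathtt L}$, i.e. $\mathcal H_{\mathtt L}\subset\mathcal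 I_{\mathtt L}$ and $\{F,G\}=0$ for all $F\in\mathcal H_{\mathtt L}$, $G\in\mathcal I_{\mathtt L}$. -/

import Mathlib

/-! Regular functions and the quasi-Poisson bracket on the representation spaces of the extended
cyclic quiver: vertices `ZMod m` and `∞`, arrows `x_s : s ⟶ s + 1`, `v_{s,α} : ∞ ⟶ s`
(`1 ≤ α ≤ d_s`), together with the opposite arrows `y_s`, `w_{s,α}`; the dimension vector is `1` at
`∞` and `N s` at `s`. -/

noncomputable section

namespace CyclicQuiver

open Matrix

/-! ### Extending a derivation to a localization -/

section Localization

variable {R : Type*} [CommRing R] [Algebra ℂ R]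

theorem algebraMap_smul_away (g : R) (c : ℂ) (r : R) :
    algebraMap R (Localization.Away g) (c • r) = c • algebraMap R (Localization.Away g) r :=
  map_smul (IsScalarTower.toAlgHom ℂ R (Localization.Away g)) c r

/-- The algebra morphism `r ↦ r + ε D(r)` into the dual numbers over the localization. -/
def dualNumberHom (g : R) (D : Derivation ℂ R R) :
    R →ₐ[ℂ] TrivSqZeroExt (Localization.Away g) (Localization.Away g) :=
  AlgHom.ofLinearMap
    { toFun := fun r => TrivSqZeroExt.inl (algebraMap R (Localization.Away g) r) +
        TrivSqZeroExt.inr (algebraMap R (Localization.Away g) (D r))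
      map_add' := by
        intro a b
        simp only [map_add, TrivSqZeroExt.inl_add, TrivSqZeroExt.inr_add]
        abel
      map_smul' := by
        intro c a
        rw [Derivation.map_smul, RingHom.id_apply, smul_add, ← TrivSqZeroExt.inl_smul,
          ← TrivSqZeroExt.inr_smul, algebraMap_smul_away, algebraMap_smul_away] }
    (by ext <;> simp)
    (by
      intro a b
      ext
      · simp
      · simp only [LinearMap.coe_mk, AddHom.coe_mk, TrivSqZeroExt.snd_add, TrivSqZeroExt.snd_inl,
          TrivSqZeroExt.snd_inr, TrivSqZeroExt.snd_mul, TrivSqZeroExt.fst_add,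
          TrivSqZeroExt.fst_inl, TrivSqZeroExt.fst_inr, Derivation.leibniz, map_add, map_mul,
          smul_eq_mul, MulOpposite.smul_eq_mul_unop, MulOpposite.unop_op, zero_add, add_zero]
        ring)

theorem isUnit_dualNumberHom (g : R) (D : Derivation ℂ R R) (y : Submonoid.powers g) :
    IsUnit (dualNumberHom g D y) := by
  rw [TrivSqZeroExt.isUnit_iff_isUnit_fst]
  simpa [dualNumberHom] using IsLocalization.map_units (Localization.Away g) y

/-- The extension of `dualNumberHom` to the localization. -/
def dualNumberLift (g : R) (D : Derivation ℂ R R) :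
    Localization.Away g →ₐ[ℂ] TrivSqZeroExt (Localization.Away g) (Localization.Away g) :=
  IsLocalization.liftAlgHom (M := Submonoid.powers g) (f := dualNumberHom g D)
    (isUnit_dualNumberHom g D)

theorem fst_dualNumberLift (g : R) (D : Derivation ℂ R R) (F : Localization.Away g) :
    (dualNumberLift g D F).fst = F := by
  have h : (TrivSqZeroExt.fstHom ℂ (Localization.Away g) (Localization.Away g)).comp
      (dualNumberLift g D) = AlgHom.id ℂ (Localization.Away g) := by
    apply IsLocalization.algHom_ext (Submonoid.powers g)
    ext r
    change (dualNumberLift g D (algebraMap R (Localization.Away g) r)).fst =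
      algebraMap R (Localization.Away g) r
    rw [dualNumberLift, IsLocalization.liftAlgHom_apply, IsLocalization.lift_eq]
    change (TrivSqZeroExt.inl (algebraMap R (Localization.Away g) r) +
        TrivSqZeroExt.inr (algebraMap R (Localization.Away g) (D r))).fst = _
    rw [TrivSqZeroExt.fst_add, TrivSqZeroExt.fst_inl, TrivSqZeroExt.fst_inr, add_zero]
  exact DFunLike.congr_fun h F

/-- The extension of a derivation `D` of `R` to the localization `R[1/g]` (quotient rule). -/
def locDerivation (g : R) (D : Derivation ℂ R R) :
    Derivation ℂ (Localization.Away g) (Localization.Away g) :=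
  Derivation.mk'
    { toFun := fun F => (dualNumberLift g D F).snd
      map_add' := by intro a b; simp
      map_smul' := by intro c a; simp }
    (by
      intro a b
      simp [fst_dualNumberLift, mul_comm])

/-- `locDerivation` restricts to the given derivation (so it is its only extension). -/
theorem locDerivation_algebraMap (g : R) (D : Derivation ℂ R R) (r : R) :
    locDerivation g D (algebraMap R (Localization.Away g) r) =
      algebraMap R (Localization.Away g) (D r) := by
  change (dualNumberLift g D (algebraMap R (Localization.Away g) r)).snd = _
  rw [dualNumberLift, IsLocalization.liftAlgHom_apply, IsLocalization.lift_eq]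
  change (TrivSqZeroExt.inl (algebraMap R (Localization.Away g) r) +
        TrivSqZeroExt.inr (algebraMap R (Localization.Away g) (D r))).snd = _
  rw [TrivSqZeroExt.snd_add, TrivSqZeroExt.snd_inl, TrivSqZeroExt.snd_inr, zero_add]

end Localization

/-! ### Matrix entries -/

variable (m : ℕ) [NeZero m] (N d : ZMod m → ℕ)

/-- Basis vectors of `𝒱_cyc = ⨁_s 𝒱_s`, `𝒱_s = ℂ^{N s}`: pairs `(s, i)`. -/
abbrev Idx := Σ s : ZMod m, Fin (N s)

/-- The spin indices `(s, α)`. -/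
abbrev Spin := Σ s : ZMod m, Fin (d s)

/-- The matrix entries, i.e. the coordinate functions of the representation space. An entry is
labelled by its row and column in `𝒱_cyc`:
* `x ((r, i), (r + 1, j))` is `(X_r)_{ij}`;
* `y ((r + 1, i), (r, j))` is `(Y_r)_{ij}`;
* `v ((s, α), (s, j))` is `(V_{s,α})_j`;
* `w ((s, α), (s, i))` is `(W_{s,α})_i`. -/
inductive Entry where
  | x (e : {e : Idx m N × Idx m N // e.2.1 = e.1.1 + 1})
  | y (e : {e : Idx m N × Idx m N // e.1.1 = e.2.1 + 1})
  | v (e : {e : Spin m d × Idx m N // e.2.1 = e.1.1})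
  | w (e : {e : Spin m d × Idx m N // e.2.1 = e.1.1})

instance : Fintype (Entry m N d) :=
  Fintype.ofEquiv
    ({e : Idx m N × Idx m N // e.2.1 = e.1.1 + 1} ⊕ {e : Idx m N × Idx m N // e.1.1 = e.2.1 + 1} ⊕
      {e : Spin m d × Idx m N // e.2.1 = e.1.1} ⊕ {e : Spin m d × Idx m N // e.2.1 = e.1.1})
    { toFun := fun z => match z with
        | .inl e => .x e
        | .inr (.inl e) => .y e
        | .inr (.inr (.inl e)) => .v e
        | .inr (.inr (.inr e)) => .w e
      invFun := fun z => match z with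
        | .x e => .inl e
        | .y e => .inr (.inl e)
        | .v e => .inr (.inr (.inl e))
        | .w e => .inr (.inr (.inr e))
      left_inv := by rintro (e | e | e | e) <;> rfl
      right_inv := by rintro (e | e | e | e) <;> rfl }

/-- Polynomial functions in the matrix entries. -/
abbrev Poly := MvPolynomial (Entry m N d) ℂ

/-- Matrices of endomorphisms of `𝒱_cyc` whose entries are polynomial functions. -/
abbrev PolyMat := Matrix (Idx m N) (Idx m N) (Poly m N d)

variable {m N d}

/-- `X_s ∈ Hom(𝒱_{s+1}, 𝒱_s)`, seen as an endomorphism of `𝒱_cyc`. -/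
def Xs (s : ZMod m) : PolyMat m N d :=
  Matrix.of fun p q =>
    if h : q.1 = p.1 + 1 then (if p.1 = s then MvPolynomial.X (.x ⟨(p, q), h⟩) else 0) else 0

/-- `Y_s ∈ Hom(𝒱_s, 𝒱_{s+1})`, seen as an endomorphism of `𝒱_cyc`. -/
def Ys (s : ZMod m) : PolyMat m N d :=
  Matrix.of fun p q =>
    if h : p.1 = q.1 + 1 then (if q.1 = s then MvPolynomial.X (.y ⟨(p, q), h⟩) else 0) else 0

/-- The row vector `V_{s,α} ∈ Hom(𝒱_s, ℂ)`, extended by zero to `𝒱_cyc`. -/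
def V (a : Spin m d) : Idx m N → Poly m N d :=
  fun q => if h : q.1 = a.1 then MvPolynomial.X (.v ⟨(a, q), h⟩) else 0

/-- The column vector `W_{s,α} ∈ Hom(ℂ, 𝒱_s) ⊂ Hom(ℂ, 𝒱_cyc)`. -/
def W (a : Spin m d) : Idx m N → Poly m N d :=
  fun q => if h : q.1 = a.1 then MvPolynomial.X (.w ⟨(a, q), h⟩) else 0

/-- `X = ∑_s X_s`. -/
def X : PolyMat m N d := ∑ s, Xs s

/-- `Y = ∑_s Y_s`. -/
def Y : PolyMat m N d := ∑ s, Ys s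

/-! ### The spaces -/

/-- The determinant of the diagonal block `𝒱_s → 𝒱_s` of an endomorphism of `𝒱_cyc`. -/
def blockDet (s : ZMod m) (M : PolyMat m N d) : Poly m N d :=
  (M.submatrix (Sigma.mk s) (Sigma.mk s)).det

variable (m N d)

/-- The product of the functions `det(Id + X_s Y_s)`, `det(Id + Y_s X_s)`,
`det(Id + W_{s,α} V_{s,α})`, `1 + V_{s,α} W_{s,α}`, whose non-vanishing defines `ℳ^•`. -/
def bulletPoly : Poly m N d :=
  (∏ s : ZMod m, blockDet s (1 + Xs s * Ys s) * blockDet (s + 1) (1 + Ys s * Xs s)) *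
    ∏ a : Spin m d, blockDet a.1 (1 + vecMulVec (W a) (V a)) * (1 + V a ⬝ᵥ W a)

/-- The function whose non-vanishing defines `ℳ^∘`, the part of `ℳ^•` where `X` is invertible. -/
def circPoly : Poly m N d := bulletPoly m N d * (X : PolyMat m N d).det

variable {m N d}

/-- The algebra of regular functions on the principal open subset `g ≠ 0` of the affine space of
all matrix entries. -/
abbrev Reg (g : Poly m N d) := Localization.Away g

/-! ### The quasi-Poisson bracket -/

/-- Kronecker delta. -/
def δ {ι : Type*} [DecidableEq ι] (a b : ι) : Poly m N d := if a = b then 1 else 0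

/-- `o(s, r)`: the sign of `r - s` for representatives in `{0, …, m - 1}`. -/
def o (s r : ZMod m) : ℂ := (Int.sign ((r.val : ℤ) - (s.val : ℤ)) : ℂ)

/-- `δ_{sr} o(α, β)` for the spin indices `a = (s, α)`, `b = (r, β)`. -/
def oSpin (a b : Spin m d) : ℂ :=
  if a.1 = b.1 then (Int.sign (((b.2 : ℕ) : ℤ) - ((a.2 : ℕ) : ℤ)) : ℂ) else 0

/-- `{(X_r)_{ij}, (X_s)_{kl}}` -/
def brXX (r : ZMod m) (i j : Idx m N) (s : ZMod m) (k l : Idx m N) : Poly m N d :=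
  (1 / 2 : ℂ) • (δ s (r - 1) * (Xs (r - 1) * Xs r : PolyMat m N d) k j * δ i l)
    - (1 / 2 : ℂ) • (δ s (r + 1) * δ k j * (Xs r * Xs (r + 1) : PolyMat m N d) i l)

/-- `{(Y_r)_{ij}, (Y_s)_{kl}}` -/
def brYY (r : ZMod m) (i j : Idx m N) (s : ZMod m) (k l : Idx m N) : Poly m N d :=
  (1 / 2 : ℂ) • (δ s (r - 1) * δ k j * (Ys r * Ys (r - 1) : PolyMat m N d) i l)
    - (1 / 2 : ℂ) • (δ s (r + 1) * (Ys (r + 1) * Ys r : PolyMat m N d) k j * δ i l)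

/-- `{(X_r)_{ij}, (Y_s)_{kl}}` -/
def brXY (r : ZMod m) (i j : Idx m N) (s : ZMod m) (k l : Idx m N) : Poly m N d :=
  δ s r * (δ k j * δ i l + (1 / 2 : ℂ) • ((Ys r * Xs r : PolyMat m N d) k j * δ i l)
      + (1 / 2 : ℂ) • (δ k j * (Xs r * Ys r : PolyMat m N d) i l))
    - (1 / 2 : ℂ) • (δ s (r - 1) * Xs r k j * Ys (r - 1) i l)
    + (1 / 2 : ℂ) • (δ s (r + 1) * Ys (r + 1) k j * Xs r i l)

/-- `{(X_r)_{ij}, (W_a)_k}`, `a = (s, α)` -/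
def brXW (r : ZMod m) (i j : Idx m N) (a : Spin m d) (k : Idx m N) : Poly m N d :=
  (1 / 2 : ℂ) • (δ a.1 (r + 1) * δ k j * (Xs r *ᵥ W a) i)
    - (1 / 2 : ℂ) • (δ r a.1 * Xs r k j * W a i)

/-- `{(X_r)_{ij}, (V_a)_l}`, `a = (s, α)` -/
def brXV (r : ZMod m) (i j : Idx m N) (a : Spin m d) (l : Idx m N) : Poly m N d :=
  (1 / 2 : ℂ) • (δ r a.1 * (V a ᵥ* Xs r) j * δ i l)
    - (1 / 2 : ℂ) • (δ a.1 (r + 1) * V a j * Xs r i l)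

/-- `{(Y_r)_{ij}, (W_a)_k}`, `a = (s, α)` -/
def brYW (r : ZMod m) (i j : Idx m N) (a : Spin m d) (k : Idx m N) : Poly m N d :=
  (1 / 2 : ℂ) • (δ r a.1 * δ k j * (Ys r *ᵥ W a) i)
    - (1 / 2 : ℂ) • (δ a.1 (r + 1) * Ys r k j * W a i)

/-- `{(Y_r)_{ij}, (V_a)_l}`, `a = (s, α)` -/
def brYV (r : ZMod m) (i j : Idx m N) (a : Spin m d) (l : Idx m N) : Poly m N d :=
  (1 / 2 : ℂ) • (δ a.1 (r + 1) * (V a ᵥ* Ys r) j * δ i l)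
    - (1 / 2 : ℂ) • (δ r a.1 * V a j * Ys r i l)

/-- `{(V_a)_j, (V_b)_l}` -/
def brVV (a : Spin m d) (j : Idx m N) (b : Spin m d) (l : Idx m N) : Poly m N d :=
  -((1 / 2 * o a.1 b.1) • (V a j * V b l))
    - (1 / 2 * oSpin a b) • (V b j * V a l + V a j * V b l)

/-- `{(W_a)_i, (W_b)_k}` -/
def brWW (a : Spin m d) (i : Idx m N) (b : Spin m d) (k : Idx m N) : Poly m N d :=
  -((1 / 2 * o a.1 b.1) • (W b k * W a i))
    - (1 / 2 * oSpin a b) • (W b k * W a i + W a k * W b i)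

/-- `{(V_a)_j, (W_b)_k}` -/
def brVW (a : Spin m d) (j : Idx m N) (b : Spin m d) (k : Idx m N) : Poly m N d :=
  (1 / 2 * o a.1 b.1) • (W b k * V a j)
    + δ a b * (δ k j + (1 / 2 : ℂ) • (W b k * V a j) + (1 / 2 : ℂ) • (δ k j * (V a ⬝ᵥ W b)))
    + (1 / 2 * oSpin a b) • (δ k j * (V a ⬝ᵥ W b) + W b k * V a j)

/-- The bracket of two matrix entries; the cases not listed above are fixed by antisymmetry. -/
def entryBracket : Entry m N d → Entry m N d → Poly m N d
  | .x e, .x f => brXX e.1.1.1 e.1.1 e.1.2 f.1.1.1 f.1.1 f.1.2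
  | .x e, .y f => brXY e.1.1.1 e.1.1 e.1.2 f.1.2.1 f.1.1 f.1.2
  | .x e, .v f => brXV e.1.1.1 e.1.1 e.1.2 f.1.1 f.1.2
  | .x e, .w f => brXW e.1.1.1 e.1.1 e.1.2 f.1.1 f.1.2
  | .y e, .x f => -brXY f.1.1.1 f.1.1 f.1.2 e.1.2.1 e.1.1 e.1.2
  | .y e, .y f => brYY e.1.2.1 e.1.1 e.1.2 f.1.2.1 f.1.1 f.1.2
  | .y e, .v f => brYV e.1.2.1 e.1.1 e.1.2 f.1.1 f.1.2
  | .y e, .w f => brYW e.1.2.1 e.1.1 e.1.2 f.1.1 f.1.2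
  | .v e, .x f => -brXV f.1.1.1 f.1.1 f.1.2 e.1.1 e.1.2
  | .v e, .y f => -brYV f.1.2.1 f.1.1 f.1.2 e.1.1 e.1.2
  | .v e, .v f => brVV e.1.1 e.1.2 f.1.1 f.1.2
  | .v e, .w f => brVW e.1.1 e.1.2 f.1.1 f.1.2
  | .w e, .x f => -brXW f.1.1.1 f.1.1 f.1.2 e.1.1 e.1.2
  | .w e, .y f => -brYW f.1.2.1 f.1.1 f.1.2 e.1.1 e.1.2
  | .w e, .v f => -brVW f.1.1 f.1.2 e.1.1 e.1.2
  | .w e, .w f => brWW e.1.1 e.1.2 f.1.1 f.1.2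

/-- The biderivation `{F, G} = ∑_{a,b} (∂F/∂a) (∂G/∂b) {a, b}` of the algebra of regular functions
on `g ≠ 0`, the sum being over all matrix entries `a`, `b`. -/
def bracket (g : Poly m N d) (F G : Reg g) : Reg g :=
  ∑ a : Entry m N d, ∑ b : Entry m N d,
    locDerivation g (MvPolynomial.pderiv a) F * locDerivation g (MvPolynomial.pderiv b) G *
      algebraMap (Poly m N d) (Reg g) (entryBracket a b)

/-- On matrix entries, `bracket` takes the prescribed values. -/
theorem bracket_entry (g : Poly m N d) (a b : Entry m N d) :
    bracket g (algebraMap (Poly m N d) (Reg g) (MvPolynomial.X a))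
        (algebraMap (Poly m N d) (Reg g) (MvPolynomial.X b)) =
      algebraMap (Poly m N d) (Reg g) (entryBracket a b) := by
  classical
  unfold bracket
  simp only [locDerivation_algebraMap, MvPolynomial.pderiv_X, ← map_mul, ← map_sum]
  congr 1
  rw [Finset.sum_eq_single a, Finset.sum_eq_single b]
  · simp
  · intro c _ hc
    simp [hc.symm]
  · simp
  · intro c _ hc
    simp [Pi.single_apply, hc.symm]
  · simp

/-! ### Poisson algebras -/

/-- The subalgebra `S` is a Poisson algebra for (the restriction of) the bracket `br`. -/
structure IsPoissonSubalgebra {A : Type*} [CommRing A] [Algebra ℂ A] (br : A → A → A)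
    (S : Subalgebra ℂ A) : Prop where
  closed : ∀ F ∈ S, ∀ G ∈ S, br F G ∈ S
  add_right : ∀ F ∈ S, ∀ G ∈ S, ∀ H ∈ S, br F (G + H) = br F G + br F H
  smul_right : ∀ (c : ℂ), ∀ F ∈ S, ∀ G ∈ S, br F (c • G) = c • br F G
  skew : ∀ F ∈ S, ∀ G ∈ S, br F G = -br G F
  leibniz : ∀ F ∈ S, ∀ G ∈ S, ∀ H ∈ S, br F (G * H) = br F G * H + G * br F H
  jacobi : ∀ F ∈ S, ∀ G ∈ S, ∀ H ∈ S, br F (br G H) + br G (br H F) + br H (br F G) = 0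

/-- The Poisson centre of `S`: the elements of `S` that commute with all of `S`. -/
def poissonCentre {A : Type*} [CommRing A] [Algebra ℂ A] (br : A → A → A)
    (S : Subalgebra ℂ A) : Set A :=
  {F | F ∈ S ∧ ∀ G ∈ S, br F G = 0}

/-! ### The matrices `L` and the algebras they generate -/

/-- The three choices of the matrix `L`. -/
inductive Choice where
  | X
  | Y
  | Z

/-- The function defining the open subset on which `L` is considered: `ℳ^•` for `L = X, Y` and
`ℳ^∘` for `L = Z`. -/
def domainPoly : Choice → Poly m N d
  | .X => bulletPoly m N d
  | .Y => bulletPoly m N d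
  | .Z => circPoly m N d

/-- The matrix `L`; `Z = Y + X⁻¹`, i.e. `Z = ∑_s Z_s` with `Z_s = Y_s + X_s⁻¹`. -/
def lax : (c : Choice) → Matrix (Idx m N) (Idx m N) (Reg (domainPoly c : Poly m N d))
  | .X => (X : PolyMat m N d).map (algebraMap _ _)
  | .Y => (Y : PolyMat m N d).map (algebraMap _ _)
  | .Z => (Y : PolyMat m N d).map (algebraMap _ _) + ((X : PolyMat m N d).map (algebraMap _ _))⁻¹

/-- On `ℳ^∘` the matrix `X` is invertible, so that `Z` is defined. -/
theorem isUnit_det_X :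
    IsUnit ((X : PolyMat m N d).map
      (algebraMap (Poly m N d) (Reg (circPoly m N d)))).det := by
  have h := IsLocalization.Away.algebraMap_isUnit (S := Reg (circPoly m N d)) (circPoly m N d)
  rw [circPoly, map_mul] at h
  have h2 := isUnit_of_mul_isUnit_right h
  rw [RingHom.map_det] at h2
  exact h2

/-- The function `tr(L^k)`. -/
def trPow (c : Choice) (k : ℕ) : Reg (domainPoly c : Poly m N d) := (lax c ^ k).trace

/-- The function `tr(W_a V_b L^k)` for spin indices `a = (s, α)`, `b = (r, β)`. -/
def trSpin (c : Choice) (a b : Spin m d) (k : ℕ) : Reg (domainPoly c : Poly m N d) :=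
  ((vecMulVec (W a) (V b) : PolyMat m N d).map
    (algebraMap (Poly m N d) (Reg (domainPoly c))) * lax c ^ k).trace

variable (m N d)

/-- `ℋ_L = ℂ[tr(L^k) | k ∈ ℕ]`. -/
def HAlg (c : Choice) : Subalgebra ℂ (Reg (domainPoly c : Poly m N d)) :=
  Algebra.adjoin ℂ {F | ∃ k, F = trPow c k}

/-- `ℐ_L = ℂ[tr(L^k), tr(W_a V_b L^k) | k ∈ ℕ, a, b spin indices]`. -/
def IAlg (c : Choice) : Subalgebra ℂ (Reg (domainPoly c : Poly m N d)) :=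
  Algebra.adjoin ℂ ({F | ∃ k, F = trPow c k} ∪ {F | ∃ a b k, F = trSpin c a b k})

end CyclicQuiver

end

/-! The three choices of L are treated at once through `IsLaxSystem`: a matrix L, homogeneous for
the grading by vertices, whose brackets with itself and with the spin vectors have one common
quadratic form up to a sign ε, equal to 1 for X and to -1 for Y and Z. For X and Y this is the given
table rewritten with full matrices. For Z = Y + X⁻¹ the constant terms of {X, Y} cancel and the
other terms recombine (`contract_add_inverse`). By cyclicity of the trace, tr(W_a V_b L^k) is the
moment V_b L^k W_a.

Centrality. Contracting {L, -} with a power of L gives two equal terms of opposite sign, so tr(L^n)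
commutes with all entries of L, V and W (`bracket_trace_pow_L`, `bracket_trace_pow_V`,
`bracket_trace_pow_W`). The Leibniz rule does the rest.

Closure. Expanding {V_a L^n W_b, V_c L^l W_d} by the Leibniz rule produces telescoping sums, and a
quadratic expression in the moments remains (`bracket_moment_moment`).

Jacobi identity. The bracket is only quasi-Poisson on all regular functions, so the identity has to
come from the relations between moments. Write the matrix of zeroth moments as T^0 - εU with T^0 and
U triangular of opposite type. Then T(x) = T^0 + ∑_{k ≥ 1} x^k V L^k W, together with U, which plays
the role of a value at infinity, satisfies a Sklyanin relation with trigonometric spectral function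
θ = (x + y) / (x - y). Both θ and the signs of differences of indices obey the addition formula of
the hyperbolic cotangent, θ₁₂θ₂₃ + θ₂₃θ₃₁ + θ₃₁θ₁₂ = -1, and this is what the Jacobi identity
requires (`SklyaninRel.jacobi`).

This argument divides by x - y and needs the relation for all indices, whereas the brackets of
moments have the stated form only for indices of matching degree. It is therefore carried out in a
free commutative algebra on symbols for T^k and U (`genDer_jacobi`) and transported by `freeMap`:
symbols of the wrong degree go to zero, and for the others the map intertwines the brackets
(`bracket_genImage`). Since the Jacobiator is a derivation in each argument, the identity extends
from the generators to the algebra they generate. -/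

noncomputable section

namespace CyclicQuiver

/-! ### Sklyanin brackets -/

section Sklyanin

variable {B : Type*} [CommRing B] [Algebra ℂ B] {S : Type*}

/-- The relation `{t_{ab}, t'_{cd}} = ½(εθ - ω_{ac}) t_{cb} t'_{ad} - ½(εθ + ω_{bd}) t_{ad} t'_{cb}
+ ½ κ t_{ab} t'_{cd}` with `θ = h / w`, multiplied by `2 w`. -/
def SklyaninRel (ω : S → S → ℂ) (κ : S → S → S → S → ℂ) (ε : ℂ) (w h : B)
    (Δ : S → S → Derivation ℂ B B) (t t' : S → S → B) : Prop :=
  ∀ a b c d, 2 * w * Δ a b (t' c d) =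
    (algebraMap ℂ B ε * h - algebraMap ℂ B (ω a c) * w) * (t c b * t' a d)
    - (algebraMap ℂ B ε * h + algebraMap ℂ B (ω b d) * w) * (t a d * t' c b)
    + w * algebraMap ℂ B (κ a b c d) * (t a b * t' c d)

-- With θ = h / w, `hwh` is the addition formula of the hyperbolic cotangent with denominators
-- cleared, and `hωω` is the same formula for the signs. After expansion, the only cubic monomials
-- that do not cancel outright pair the rows with the columns by a 3-cycle, and their coefficients
-- are these addition formulas. The twist given by α and γ drops out, α being antisymmetric.
set_option maxHeartbeats 4000000 in
theorem SklyaninRel.jacobi {ω : S → S → ℂ} {α γ : S → S → ℂ} {ε : ℂ} (hε : ε * ε = 1)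
    (hω : ∀ a b, ω a b = -ω b a)
    (hωω : ∀ a b c, (a = b ∧ b = c) ∨ ω a b * ω b c + ω b c * ω c a + ω c a * ω a b = -1)
    (hα : ∀ a b, α a b = -α b a)
    {w12 w23 w31 h12 h23 h31 : B} {Δ1 Δ2 Δ3 : S → S → Derivation ℂ B B} {t1 t2 t3 : S → S → B}
    (hwh : h12 * h23 * w31 + h23 * h31 * w12 + h31 * h12 * w23 + w12 * w23 * w31 = 0)
    (H12 : SklyaninRel ω (fun a b c d => α a c + α b d + γ a d - γ c b) ε w12 h12 Δ1 t1 t2)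
    (H21 : SklyaninRel ω (fun a b c d => α a c + α b d + γ a d - γ c b) ε (-w12) h12 Δ2 t2 t1)
    (H23 : SklyaninRel ω (fun a b c d => α a c + α b d + γ a d - γ c b) ε w23 h23 Δ2 t2 t3)
    (H32 : SklyaninRel ω (fun a b c d => α a c + α b d + γ a d - γ c b) ε (-w23) h23 Δ3 t3 t2)
    (H31 : SklyaninRel ω (fun a b c d => α a c + α b d + γ a d - γ c b) ε w31 h31 Δ3 t3 t1)
    (H13 : SklyaninRel ω (fun a b c d => α a c + α b d + γ a d - γ c b) ε (-w31) h31 Δ1 t1 t3)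
    (hw1 : ∀ a b, Δ1 a b w23 = 0) (hw2 : ∀ a b, Δ2 a b w31 = 0) (hw3 : ∀ a b, Δ3 a b w12 = 0)
    (hh1 : ∀ a b, Δ1 a b h23 = 0) (hh2 : ∀ a b, Δ2 a b h31 = 0) (hh3 : ∀ a b, Δ3 a b h12 = 0)
    (a b c d e f : S) :
    8 * (w12 * w23 * w31) * (Δ1 a b (Δ2 c d (t3 e f)) + Δ2 c d (Δ3 e f (t1 a b))
      + Δ3 e f (Δ1 a b (t2 c d))) = 0 := by
  have two (D : Derivation ℂ B B) : D 2 = 0 := by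
    simpa using D.map_natCast 2
  have e1 := congrArg (Δ1 a b) (H23 c d e f)
  have e2 := congrArg (Δ2 c d) (H31 e f a b)
  have e3 := congrArg (Δ3 e f) (H12 a b c d)
  simp only [Derivation.leibniz, map_add, map_sub, Derivation.map_algebraMap, smul_eq_mul, two,
    hw1, hw2, hw3, hh1, hh2, hh3, mul_zero, add_zero, sub_zero] at e1 e2 e3
  have row : ∀ x y z : S, (∃ u, x = u ∧ y = u ∧ z = u) ∨ algebraMap ℂ B (ω x y) * algebraMap ℂ B (ω y z)
      + algebraMap ℂ B (ω y z) * algebraMap ℂ B (ω z x)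
      + algebraMap ℂ B (ω z x) * algebraMap ℂ B (ω x y) + 1 = 0 := by
    intro x y z
    rcases hωω x y z with ⟨rfl, rfl⟩ | h
    · exact Or.inl ⟨x, rfl, rfl, rfl⟩
    · right
      rw [← map_mul, ← map_mul, ← map_mul, ← map_add, ← map_add, h]
      simp
  -- When a = c = e the first factor need not vanish, but then the two monomials coincide.
  have hrow : (algebraMap ℂ B (ω a c) * algebraMap ℂ B (ω c e)
      + algebraMap ℂ B (ω c e) * algebraMap ℂ B (ω e a)
      + algebraMap ℂ B (ω e a) * algebraMap ℂ B (ω a c) + 1) *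
      (t1 e b * t2 a d * t3 c f - t1 c b * t2 e d * t3 a f) = 0 := by
    rcases row a c e with ⟨u, rfl, rfl, rfl⟩ | h
    · ring
    · rw [h, zero_mul]
  have hcol : (algebraMap ℂ B (ω b d) * algebraMap ℂ B (ω d f)
      + algebraMap ℂ B (ω d f) * algebraMap ℂ B (ω f b)
      + algebraMap ℂ B (ω f b) * algebraMap ℂ B (ω b d) + 1) *
      (t1 a f * t2 c b * t3 e d - t1 a d * t2 c f * t3 e b) = 0 := by
    rcases row b d f with ⟨u, rfl, rfl, rfl⟩ | h
    · ring
    · rw [h, zero_mul]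
  have hε' : algebraMap ℂ B ε * algebraMap ℂ B ε = 1 := by rw [← map_mul, hε, map_one]
  have H1 := H12 a b e d
  have H2 := H12 a b c f
  have H3 := H12 a b c d
  have H4 := H13 a b c f
  have H5 := H13 a b e d
  have H6 := H13 a b e f
  have G1 := H23 c d a f
  have G2 := H23 c d e b
  have G3 := H23 c d e f
  have G4 := H21 c d e b
  have G5 := H21 c d a f
  have G6 := H21 c d a b
  have F1 := H31 e f c b
  have F2 := H31 e f a d
  have F3 := H31 e f a b
  have F4 := H32 e f a d
  have F5 := H32 e f c b
  have F6 := H32 e f c d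
  simp only [hω c a, hω a e, hω e c, hω d b, hω b f, hω f d, hα c a, hα a e, hα e c, hα d b,
    hα b f, hα f d, map_neg, map_add, map_sub] at *
  generalize algebraMap ℂ B ε = E at *
  generalize algebraMap ℂ B (ω a c) = o1 at *
  generalize algebraMap ℂ B (ω c e) = o2 at *
  generalize algebraMap ℂ B (ω e a) = o3 at *
  generalize algebraMap ℂ B (ω b d) = p1 at *
  generalize algebraMap ℂ B (ω d f) = p2 at *
  generalize algebraMap ℂ B (ω f b) = p3 at *
  -- Each of the eighteen undifferentiated relations enters with the factor that multiplies its
  -- bracket in `e1`, `e2`, `e3`.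
  linear_combination
    4 * w12 * w31 * e1 + 4 * w12 * w23 * e2 + 4 * w31 * w23 * e3
    + 2 * (E * h23 - o2 * w23) * (w31 * t3 c f * H1 - w12 * t2 e d * H4)
    - 2 * (E * h23 + p2 * w23) * (w31 * t3 e d * H2 - w12 * t2 c f * H5)
    + 2 * w23 * (algebraMap ℂ B (α c e) + algebraMap ℂ B (α d f) + algebraMap ℂ B (γ c f)
      - algebraMap ℂ B (γ e d)) * (w31 * t3 e f * H3 - w12 * t2 c d * H6)
    + 2 * (E * h31 - o3 * w31) * (w12 * t1 e b * G1 - w23 * t3 a f * G4)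
    - 2 * (E * h31 + p3 * w31) * (w12 * t1 a f * G2 - w23 * t3 e b * G5)
    + 2 * w31 * (algebraMap ℂ B (α e a) + algebraMap ℂ B (α f b) + algebraMap ℂ B (γ e b)
      - algebraMap ℂ B (γ a f)) * (w12 * t1 a b * G3 - w23 * t3 e f * G6)
    + 2 * (E * h12 - o1 * w12) * (w23 * t2 a d * F1 - w31 * t1 c b * F4)
    - 2 * (E * h12 + p1 * w12) * (w23 * t2 c b * F2 - w31 * t1 a d * F5)
    + 2 * w12 * (algebraMap ℂ B (α a c) + algebraMap ℂ B (α b d) + algebraMap ℂ B (γ a d)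
      - algebraMap ℂ B (γ c b)) * (w23 * t2 c d * F3 - w31 * t1 a b * F6)
    + 2 * (t1 e b * t2 a d * t3 c f - t1 c b * t2 e d * t3 a f
        + t1 a f * t2 c b * t3 e d - t1 a d * t2 c f * t3 e b) *
      (hwh + (h12 * h23 * w31 + h23 * h31 * w12 + h31 * h12 * w23) * hε')
    - 2 * (w12 * w23 * w31) * (hrow + hcol)

end Sklyanin

end CyclicQuiver

end

noncomputable section

namespace CyclicQuiver

/-! ### Derivations of rings of formal power series -/

section Series

open Finset

variable {R : Type*} [CommRing R] [Algebra ℂ R] {σ : Type*} [DecidableEq σ]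

/-- A monomial in the variables of I ∪ J factors in exactly one way into a monomial in I and a
monomial in J, so the convolution has at most one nonzero term. -/
theorem sum_antidiagonal_disjoint {I J : Finset σ} (hIJ : Disjoint I J)
    (φ : (σ →₀ ℕ) → (σ →₀ ℕ) → R)
    (h : ∀ p q, φ p q ≠ 0 → p.support ⊆ I ∧ q.support ⊆ J) (n : σ →₀ ℕ) :
    ∑ p ∈ antidiagonal n, φ p.1 p.2 =
      if n.support ⊆ I ∪ J then φ (n.filter (· ∈ I)) (n.filter (· ∈ J)) else 0 := by
  have key : ∀ p ∈ antidiagonal n, φ p.1 p.2 ≠ 0 →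
      n.support ⊆ I ∪ J ∧ p = (n.filter (· ∈ I), n.filter (· ∈ J)) := by
    intro p hp hφ
    obtain ⟨h1, h2⟩ := h _ _ hφ
    rw [HasAntidiagonal.mem_antidiagonal] at hp
    refine ⟨?_, ?_⟩
    · rw [← hp]
      exact Finsupp.support_add.trans (union_subset_union h1 h2)
    · ext l
      · rw [Finsupp.filter_apply, ← hp]
        split_ifs with hl
        · have : p.2 l = 0 := by
            by_contra hne
            exact disjoint_left.1 hIJ hl (h2 (Finsupp.mem_support_iff.2 hne))
          simp [this]
        · by_contra hne
          exact hl (h1 (Finsupp.mem_support_iff.2 hne))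
      · rw [Finsupp.filter_apply, ← hp]
        split_ifs with hl
        · have : p.1 l = 0 := by
            by_contra hne
            exact disjoint_left.1 hIJ (h1 (Finsupp.mem_support_iff.2 hne)) hl
          simp [this]
        · by_contra hne
          exact hl (h2 (Finsupp.mem_support_iff.2 hne))
  split_ifs with hn
  · rw [sum_eq_single (n.filter (· ∈ I), n.filter (· ∈ J))]
    · intro p hp hne
      by_contra hφ
      exact hne (key p hp hφ).2
    · intro hnot
      exfalso
      apply hnot
      rw [HasAntidiagonal.mem_antidiagonal]
      ext l
      simp only [Finsupp.add_apply, Finsupp.filter_apply]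
      by_cases hl : n l = 0
      · simp [hl]
      · have := hn (Finsupp.mem_support_iff.2 hl)
        rw [mem_union] at this
        rcases this with h1 | h2
        · simp [h1, disjoint_left.1 hIJ h1]
        · simp [h2, disjoint_right.1 hIJ h2]
  · apply sum_eq_zero
    intro p hp
    by_contra hφ
    exact hn (key p hp hφ).1

/-- The derivation `F ↦ ∑_{p, q} D_p(F_q) x^{p + q}` of a ring of formal power series. -/
def seriesDer (D : (σ →₀ ℕ) → Derivation ℂ R R) :
    Derivation ℂ (MvPowerSeries σ R) (MvPowerSeries σ R) :=
  Derivation.mk'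
    { toFun := fun F n => ∑ p ∈ antidiagonal n, D p.1 (MvPowerSeries.coeff p.2 F)
      map_add' := by
        intro F G
        funext n
        simp only [map_add, sum_add_distrib]
        rfl
      map_smul' := by
        intro c F
        funext n
        change _ = c • ∑ p ∈ antidiagonal n, D p.1 (MvPowerSeries.coeff p.2 F)
        rw [smul_sum]
        exact sum_congr rfl fun p _ => (D p.1).map_smul c _ }
    (by
      intro F G
      ext n
      simp only [smul_eq_mul, map_add]
      rw [MvPowerSeries.coeff_mul, MvPowerSeries.coeff_mul]
      change ∑ p ∈ antidiagonal n, D p.1 (MvPowerSeries.coeff p.2 (F * G)) =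
        ∑ p ∈ antidiagonal n, MvPowerSeries.coeff p.1 F *
          ∑ q ∈ antidiagonal p.2, D q.1 (MvPowerSeries.coeff q.2 G) +
        ∑ p ∈ antidiagonal n, MvPowerSeries.coeff p.1 G *
          ∑ q ∈ antidiagonal p.2, D q.1 (MvPowerSeries.coeff q.2 F)
      -- Both sides sum over the triples of exponents with total n; the first two are exchanged.
      have swap : ∀ f : (σ →₀ ℕ) → (σ →₀ ℕ) → (σ →₀ ℕ) → R,
          ∑ p ∈ antidiagonal n, ∑ q ∈ antidiagonal p.2, f p.1 q.1 q.2 =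
          ∑ p ∈ antidiagonal n, ∑ q ∈ antidiagonal p.2, f q.1 p.1 q.2 := by
        intro f
        rw [sum_sigma', sum_sigma']
        refine sum_nbij' (fun x => ⟨(x.2.1, x.1.1 + x.2.2), (x.1.1, x.2.2)⟩)
          (fun x => ⟨(x.2.1, x.1.1 + x.2.2), (x.1.1, x.2.2)⟩) ?_ ?_ ?_ ?_ ?_
        · rintro ⟨⟨a, b⟩, ⟨c, d⟩⟩ h
          simp only [mem_sigma, HasAntidiagonal.mem_antidiagonal, and_true] at h ⊢
          rw [← h.1, ← h.2]
          abel
        · rintro ⟨⟨a, b⟩, ⟨c, d⟩⟩ h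
          simp only [mem_sigma, HasAntidiagonal.mem_antidiagonal, and_true] at h ⊢
          rw [← h.1, ← h.2]
          abel
        · rintro ⟨⟨a, b⟩, ⟨c, d⟩⟩ h
          simp only [mem_sigma, HasAntidiagonal.mem_antidiagonal] at h
          simp [h.2]
        · rintro ⟨⟨a, b⟩, ⟨c, d⟩⟩ h
          simp only [mem_sigma, HasAntidiagonal.mem_antidiagonal] at h
          simp [h.2]
        · rintro ⟨⟨a, b⟩, ⟨c, d⟩⟩ h
          rfl
      have flip : ∀ (k : σ →₀ ℕ) (f : (σ →₀ ℕ) → (σ →₀ ℕ) → R),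
          ∑ q ∈ antidiagonal k, f q.1 q.2 = ∑ q ∈ antidiagonal k, f q.2 q.1 := by
        intro k f
        refine sum_nbij' Prod.swap Prod.swap ?_ ?_ ?_ ?_ ?_ <;> simp [add_comm]
      simp only [MvPowerSeries.coeff_mul, map_sum, Derivation.leibniz, smul_eq_mul, mul_sum,
        sum_add_distrib]
      congr 1
      · exact swap fun p q r => MvPowerSeries.coeff q F * D p (MvPowerSeries.coeff r G)
      · rw [← swap fun p q r => MvPowerSeries.coeff q G * D p (MvPowerSeries.coeff r F)]
        exact sum_congr rfl fun p _ => flip p.2 fun q r =>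
          MvPowerSeries.coeff r G * D p.1 (MvPowerSeries.coeff q F))

theorem coeff_seriesDer (D : (σ →₀ ℕ) → Derivation ℂ R R) (F : MvPowerSeries σ R) (n : σ →₀ ℕ) :
    MvPowerSeries.coeff n (seriesDer D F) =
      ∑ p ∈ antidiagonal n, D p.1 (MvPowerSeries.coeff p.2 F) :=
  rfl

theorem seriesDer_X (D : (σ →₀ ℕ) → Derivation ℂ R R) (j : σ) :
    seriesDer D (MvPowerSeries.X j) = 0 := by
  ext n
  rw [coeff_seriesDer, map_zero]
  refine sum_eq_zero fun p _ => ?_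
  rw [MvPowerSeries.coeff_X]
  split_ifs <;> simp

/-- The series `∑_k f_k x_i^k`. -/
def line {M : Type*} [Zero M] (i : σ) (f : ℕ → M) (n : σ →₀ ℕ) : M :=
  if n.support ⊆ {i} then f (n i) else 0

/-- The series `∑_{k, l} g_{k, l} x_i^k x_j^l`. -/
def biline (i j : σ) (g : ℕ → ℕ → R) : MvPowerSeries σ R := fun n =>
  if n.support ⊆ {i, j} then g (n i) (n j) else 0

/-- The series `∑_k f_k x_i^k`. -/
def lineSeries (i : σ) (f : ℕ → R) : MvPowerSeries σ R := line i f

theorem coeff_lineSeries (i : σ) (f : ℕ → R) (n : σ →₀ ℕ) :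
    MvPowerSeries.coeff n (lineSeries i f) = line i f n := rfl

theorem coeff_biline (i j : σ) (g : ℕ → ℕ → R) (n : σ →₀ ℕ) :
    MvPowerSeries.coeff n (biline i j g) =
      if n.support ⊆ {i, j} then g (n i) (n j) else 0 := rfl

theorem support_filter_mem (I : Finset σ) (n : σ →₀ ℕ) : (n.filter (· ∈ I)).support ⊆ I := by
  intro l hl
  rw [Finsupp.support_filter, mem_filter] at hl
  exact hl.2

theorem lineSeries_mul_lineSeries {i j : σ} (hij : i ≠ j) (f g : ℕ → R) :
    lineSeries i f * lineSeries j g = biline i j fun k l => f k * g l := by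
  ext n
  rw [MvPowerSeries.coeff_mul, coeff_biline]
  rw [sum_antidiagonal_disjoint (I := {i}) (J := {j}) (by simpa using hij)
    (fun p q => MvPowerSeries.coeff p (lineSeries i f) * MvPowerSeries.coeff q (lineSeries j g))]
  · rw [coeff_lineSeries, coeff_lineSeries, line, line, if_pos (support_filter_mem _ _),
      if_pos (support_filter_mem _ _), Finsupp.filter_apply_pos _ _ (by simp),
      Finsupp.filter_apply_pos _ _ (by simp)]
    rfl
  · intro p q h
    rw [coeff_lineSeries, coeff_lineSeries, line, line] at h
    constructor
    · by_contra hp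
      simp [hp] at h
    · by_contra hp
      simp [hp] at h

/-- Distinct variables for the two arguments make every coefficient a single bracket instead of a
convolution of brackets. -/
theorem seriesDer_lineSeries {i j : σ} (hij : i ≠ j) (d : ℕ → Derivation ℂ R R) (f : ℕ → R) :
    seriesDer (line i d) (lineSeries j f) = biline i j fun k l => d k (f l) := by
  ext n
  rw [coeff_seriesDer, coeff_biline]
  rw [sum_antidiagonal_disjoint (I := {i}) (J := {j}) (by simpa using hij)
    (fun p q => line i d p (MvPowerSeries.coeff q (lineSeries j f)))]
  · rw [coeff_lineSeries, line, line, if_pos (support_filter_mem _ _),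
      if_pos (support_filter_mem _ _), Finsupp.filter_apply_pos _ _ (by simp),
      Finsupp.filter_apply_pos _ _ (by simp)]
    rfl
  · intro p q h
    rw [coeff_lineSeries, line, line] at h
    constructor
    · by_contra hp
      simp [hp] at h
    · by_contra hp
      simp [hp] at h

/-- A double bracket of three generators is read off as one coefficient of a series in three
variables. -/
theorem coeff_seriesDer_biline {i j l : σ} (hij : i ≠ j) (hil : i ≠ l)
    (d : ℕ → Derivation ℂ R R) (g : ℕ → ℕ → R) (n : σ →₀ ℕ) (hn : n.support ⊆ {i, j, l}) :
    MvPowerSeries.coeff n (seriesDer (line i d) (biline j l g)) = d (n i) (g (n j) (n l)) := by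
  rw [coeff_seriesDer]
  rw [sum_antidiagonal_disjoint (I := {i}) (J := {j, l}) (by simp [hij, hil])
    (fun p q => line i d p (MvPowerSeries.coeff q (biline j l g)))]
  · rw [if_pos (hn.trans (by intro x; simp only [mem_union, mem_insert, mem_singleton]; tauto)), coeff_biline, line, if_pos (support_filter_mem _ _),
      if_pos (support_filter_mem _ _), Finsupp.filter_apply_pos _ _ (by simp),
      Finsupp.filter_apply_pos _ _ (by simp), Finsupp.filter_apply_pos _ _ (by simp)]
  · intro p q h
    rw [coeff_biline, line] at h
    constructor
    · by_contra hp
      simp [hp] at h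
    · by_contra hp
      simp [hp] at h

theorem biline_swap (i j : σ) (g : ℕ → ℕ → R) : biline j i g = biline i j fun k l => g l k := by
  ext n
  rw [coeff_biline, coeff_biline, pair_comm]

theorem biline_add (i j : σ) (g g' : ℕ → ℕ → R) :
    biline i j g + biline i j g' = biline i j fun k l => g k l + g' k l := by
  ext n
  simp only [map_add, coeff_biline]
  split_ifs <;> simp

theorem biline_sub (i j : σ) (g g' : ℕ → ℕ → R) :
    biline i j g - biline i j g' = biline i j fun k l => g k l - g' k l := by
  ext n
  simp only [map_sub, coeff_biline]
  split_ifs <;> simp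

theorem algebraMap_mul_biline (i j : σ) (z : ℂ) (g : ℕ → ℕ → R) :
    algebraMap ℂ (MvPowerSeries σ R) z * biline i j g =
      biline i j fun k l => algebraMap ℂ R z * g k l := by
  ext n
  rw [MvPowerSeries.algebraMap_apply, MvPowerSeries.coeff_C_mul, coeff_biline, coeff_biline]
  split_ifs <;> simp

theorem X_mul_biline (i j : σ) (hij : i ≠ j) (g : ℕ → ℕ → R) :
    MvPowerSeries.X i * biline i j g =
      biline i j fun k l => match k with
        | 0 => 0
        | k + 1 => g k l := by
  ext n
  rw [MvPowerSeries.X, MvPowerSeries.coeff_monomial_mul, one_mul, coeff_biline, coeff_biline]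
  by_cases hn : n i = 0
  · rw [if_neg]
    · simp [hn]
    · rw [Finsupp.single_le_iff]
      omega
  · rw [if_pos (by rw [Finsupp.single_le_iff]; omega)]
    obtain ⟨k, hk⟩ := Nat.exists_eq_succ_of_ne_zero hn
    have h1 : (n - Finsupp.single i 1 : σ →₀ ℕ) i = k := by simp [hk]
    have h2 : (n - Finsupp.single i 1 : σ →₀ ℕ) j = n j := by simp [hij]
    have h3 : (n - Finsupp.single i 1).support ⊆ {i, j} ↔ n.support ⊆ {i, j} := by
      constructor
      · intro h l hl
        by_cases hli : l = i
        · simp [hli]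
        · apply h
          rw [Finsupp.mem_support_iff] at hl ⊢
          simpa [Finsupp.single_apply, Ne.symm hli] using hl
      · intro h l hl
        apply h
        rw [Finsupp.mem_support_iff] at hl ⊢
        intro h0
        simp [h0] at hl
    rw [h1, h2]
    simp only [h3, hk]

theorem X_mul_biline_right (i j : σ) (hij : i ≠ j) (g : ℕ → ℕ → R) :
    MvPowerSeries.X j * biline i j g =
      biline i j fun k l => match l with
        | 0 => 0
        | l + 1 => g k l := by
  rw [biline_swap, X_mul_biline _ _ hij.symm, biline_swap]

end Series

end CyclicQuiver

end

noncomputable section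

namespace CyclicQuiver

/-! ### A free algebra with a Sklyanin bracket -/

section Free

/-- The sign function of a linear order. -/
def osgn {S : Type*} [LinearOrder S] (a b : S) : ℂ := if a < b then 1 else if a = b then 0 else -1

/-- The Kronecker delta, as a complex number. -/
def kd {S : Type*} [LinearOrder S] (a b : S) : ℂ := if a = b then 1 else 0

theorem osgn_self {S : Type*} [LinearOrder S] (a : S) : osgn a a = 0 := by simp [osgn]

theorem osgn_of_lt {S : Type*} [LinearOrder S] {a b : S} (h : a < b) : osgn a b = 1 := by
  simp [osgn, h]

theorem osgn_of_gt {S : Type*} [LinearOrder S] {a b : S} (h : b < a) : osgn a b = -1 := by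
  simp [osgn, not_lt.2 h.le, h.ne']

theorem kd_self {S : Type*} [LinearOrder S] (a : S) : kd a a = 1 := by simp [kd]

theorem kd_of_ne {S : Type*} [LinearOrder S] {a b : S} (h : a ≠ b) : kd a b = 0 := by simp [kd, h]

theorem osgn_antisymm {S : Type*} [LinearOrder S] (a b : S) : osgn a b = -osgn b a := by
  rcases lt_trichotomy a b with h | rfl | h
  · rw [osgn_of_lt h, osgn_of_gt h, neg_neg]
  · rw [osgn_self, neg_zero]
  · rw [osgn_of_lt h, osgn_of_gt h]

/-- The sign function is a limit of the hyperbolic cotangent and inherits its addition formula.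
Three equal arguments are the only exception, since all signs are then zero. -/
theorem osgn_cyclic {S : Type*} [LinearOrder S] (a b c : S) : (a = b ∧ b = c) ∨
    osgn a b * osgn b c + osgn b c * osgn c a + osgn c a * osgn a b = -1 := by
  by_cases hab : a = b
  · by_cases hbc : b = c
    · exact Or.inl ⟨hab, hbc⟩
    · right
      subst hab
      rcases lt_or_gt_of_ne hbc with h | h <;> simp [osgn_self, osgn_of_lt h, osgn_of_gt h]
  · right
    rcases lt_or_gt_of_ne hab with h1 | h1 <;> rcases lt_trichotomy b c with h2 | h2 | h2 <;>
      rcases lt_trichotomy c a with h3 | h3 | h3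
    all_goals first
      | (exfalso; order)
      | (subst h2; simp only [osgn_self, osgn_of_lt, osgn_of_gt, *]; norm_num)
      | (subst h3; simp only [osgn_self, osgn_of_lt, osgn_of_gt, *]; norm_num)
      | (simp only [osgn_of_lt, osgn_of_gt, *]; norm_num)

variable {S : Type*} [LinearOrder S] (ε : ℂ)

/-- The Cartan part of the bracket. -/
def cartan (a b c d : S) : ℂ :=
  -osgn a c + -osgn b d + (osgn a d + kd a d) - (osgn c b + kd c b)

variable (S) in
/-- The free algebra on the symbols `T_{ab}^k` (labelled by `(a, b, k)`) and `U_{ab}` (labelled by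
`(a, b, none)`). -/
abbrev Free := MvPolynomial (S × S × Option ℕ) ℂ

/-- The generator `T_{ab}^k`. -/
def genT (a b : S) (k : ℕ) : Free S := MvPolynomial.X (a, b, some k)

/-- The generator `U_{ab}`. -/
def genU (a b : S) : Free S := MvPolynomial.X (a, b, none)

local notation "𝐜" => algebraMap ℂ (Free _)

/-- The bracket of two generators. -/
def genBracket : S × S × Option ℕ → S × S × Option ℕ → Free S
  | (a, b, some k), (c, d, some l) =>
    𝐜 ((ε - osgn a c) / 2) * (genT c b k * genT a d l)
      - 𝐜 ((ε + osgn b d) / 2) * (genT a d k * genT c b l)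
      + 𝐜 ε * ∑ j ∈ Finset.range l, (genT c b (k + 1 + j) * genT a d (l - 1 - j)
        - genT c b j * genT a d (k + l - j))
      + 𝐜 (cartan a b c d / 2) * (genT a b k * genT c d l)
  | (a, b, none), (c, d, some l) =>
    𝐜 ((ε - osgn a c) / 2) * (genU c b * genT a d l)
      - 𝐜 ((ε + osgn b d) / 2) * (genU a d * genT c b l)
      + 𝐜 (cartan a b c d / 2) * (genU a b * genT c d l)
  | (a, b, some k), (c, d, none) =>
    𝐜 ((-ε - osgn a c) / 2) * (genT c b k * genU a d)
      - 𝐜 ((-ε + osgn b d) / 2) * (genT a d k * genU c b)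
      + 𝐜 (cartan a b c d / 2) * (genT a b k * genU c d)
  | (a, b, none), (c, d, none) =>
    𝐜 (-osgn a c / 2) * (genU c b * genU a d) - 𝐜 (osgn b d / 2) * (genU a d * genU c b)
      + 𝐜 (cartan a b c d / 2) * (genU a b * genU c d)

/-- The derivation `{u, -}` of the free algebra, `u` a generator. -/
def genDer (u : S × S × Option ℕ) : Derivation ℂ (Free S) (Free S) :=
  MvPolynomial.mkDerivation ℂ (genBracket ε u)

theorem genDer_X (u v : S × S × Option ℕ) :
    genDer ε u (MvPolynomial.X v) = genBracket ε u v :=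
  MvPolynomial.mkDerivation_X _ _ _

/-- `T_{ab}(x) = ∑_k T_{ab}^k x^k` for `z = true`, `U_{ab}` for `z = false`. -/
def family (z : Bool) (a b : S) (k : ℕ) : Free S :=
  if z then genT a b k else if k = 0 then genU a b else 0

/-- The derivations `{f_k, -}`, `f` as in `family`. -/
def familyDer (z : Bool) (a b : S) (k : ℕ) : Derivation ℂ (Free S) (Free S) :=
  if z then genDer ε (a, b, some k) else if k = 0 then genDer ε (a, b, none) else 0

/-- The denominator of the spectral function of the Sklyanin bracket, for two formal points; the
points labelled `false` lie at infinity. -/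
def specDen (z : Fin 3 → Bool) (i j : Fin 3) : MvPowerSeries (Fin 3) (Free S) :=
  match z i, z j with
  | true, true => MvPowerSeries.X i - MvPowerSeries.X j
  | false, true => 1
  | true, false => -1
  | false, false => if i < j then 1 else -1

/-- The numerator of the spectral function of the Sklyanin bracket. -/
def specNum (z : Fin 3 → Bool) (i j : Fin 3) : MvPowerSeries (Fin 3) (Free S) :=
  match z i, z j with
  | true, true => MvPowerSeries.X i + MvPowerSeries.X j
  | _, _ => 1

theorem genDer_genT (u : S × S × Option ℕ) (c d : S) (l : ℕ) :
    genDer ε u (genT c d l) = genBracket ε u (c, d, some l) :=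
  genDer_X _ _ _

theorem genDer_genU (u : S × S × Option ℕ) (c d : S) :
    genDer ε u (genU c d) = genBracket ε u (c, d, none) :=
  genDer_X _ _ _

/-- The two products are consecutive values of f j * g (l - j), so the sum telescopes. This is the
boundary case of the recursion in `sum_shift_succ`. -/
theorem sum_shift_zero (f g : ℕ → Free S) (l : ℕ) :
    ∑ j ∈ Finset.range l, (f (0 + 1 + j) * g (l - 1 - j) - f j * g (0 + l - j)) =
      f l * g 0 - f 0 * g l := by
  have : ∀ j ∈ Finset.range l, f (0 + 1 + j) * g (l - 1 - j) - f j * g (0 + l - j) =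
      f (j + 1) * g (l - (j + 1)) - f j * g (l - j) := by
    intro j _
    rw [show 0 + 1 + j = j + 1 by ring, show l - 1 - j = l - (j + 1) by omega,
      show 0 + l - j = l - j by omega]
  rw [Finset.sum_congr rfl this, Finset.sum_range_sub (fun j => f j * g (l - j))]
  simp

/-- Division by x - y on the level of coefficients: moving one unit of degree from y to x changes
the sum only at its two ends. -/
theorem sum_shift_succ (f g : ℕ → Free S) (k l : ℕ) :
    ∑ j ∈ Finset.range (l + 1), (f (k + 1 + j) * g (l + 1 - 1 - j) - f j * g (k + (l + 1) - j)) =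
    ∑ j ∈ Finset.range l, (f (k + 1 + 1 + j) * g (l - 1 - j) - f j * g (k + 1 + l - j))
      + f (k + 1) * g l - f l * g (k + 1) := by
  have h1 : ∀ j ∈ Finset.range l, f (k + 1 + 1 + j) * g (l - 1 - j) =
      f (k + 1 + (j + 1)) * g (l + 1 - 1 - (j + 1)) := by
    intro j _
    rw [show k + 1 + 1 + j = k + 1 + (j + 1) by ring,
      show l - 1 - j = l + 1 - 1 - (j + 1) by omega]
  have h2 : ∀ j ∈ Finset.range l, f j * g (k + 1 + l - j) = f j * g (k + (l + 1) - j) := by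
    intro j _
    rw [show k + 1 + l - j = k + (l + 1) - j by omega]
  rw [Finset.sum_sub_distrib, Finset.sum_sub_distrib, Finset.sum_congr rfl h1,
    Finset.sum_congr rfl h2,
    Finset.sum_range_succ' (fun j => f (k + 1 + j) * g (l + 1 - 1 - j)),
    Finset.sum_range_succ (fun j => f j * g (k + (l + 1) - j))]
  rw [show l + 1 - 1 - 0 = l by omega, show k + (l + 1) - l = k + 1 by omega, add_zero]
  ring

theorem algebraMap_eq_two_mul (x : ℂ) : 𝐜 x = 2 * (𝐜 (x / 2) : Free S) := by
  rw [← map_ofNat (algebraMap ℂ (Free S)) 2, ← map_mul]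
  congr 1
  ring

theorem two_mul_biline (i j : Fin 3) (g : ℕ → ℕ → Free S) :
    2 * biline i j g = biline i j fun k l => 2 * g k l := by
  have := algebraMap_mul_biline i j 2 g
  simpa only [map_ofNat] using this

/-- `genBracket` is made for this relation. Between two T's the spectral part is ½ε (x + y) / (x -
y) times T_cb(x) T_ad(y) - T_ad(x) T_cb(y). The latter vanishes for x = y, so the quotient is a
power series, with the finite sums of `genBracket` among its coefficients. When one point goes to
infinity, (x + y) / (x - y) becomes ±1. When both do, the terms with ε cancel by commutativity and
either sign is allowed. -/
theorem sklyaninRel_family (z : Fin 3 → Bool) (i j : Fin 3) (hij : i ≠ j) :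
    SklyaninRel osgn (cartan (S := S)) ε (specDen z i j) (specNum z i j)
      (fun a b => seriesDer (line i (familyDer ε (z i) a b)))
      (fun a b => lineSeries i (family (z i) a b)) (fun a b => lineSeries j (family (z j) a b)) := by
  intro a b c d
  simp only [seriesDer_lineSeries hij, lineSeries_mul_lineSeries hij]
  have e1 : 𝐜 ε - 𝐜 (osgn a c) = 2 * (𝐜 ((ε - osgn a c) / 2) : Free S) := by
    rw [← map_sub, algebraMap_eq_two_mul]
  have e2 : 𝐜 ε + 𝐜 (osgn b d) = 2 * (𝐜 ((ε + osgn b d) / 2) : Free S) := by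
    rw [← map_add, algebraMap_eq_two_mul]
  have e3 : 𝐜 ε + 𝐜 (osgn a c) = -2 * (𝐜 ((-ε - osgn a c) / 2) : Free S) := by
    rw [← map_add, algebraMap_eq_two_mul, show (-ε - osgn a c) / 2 = -((ε + osgn a c) / 2) by ring,
      map_neg]
    ring
  have e4 : 𝐜 ε - 𝐜 (osgn b d) = -2 * (𝐜 ((-ε + osgn b d) / 2) : Free S) := by
    rw [← map_sub, algebraMap_eq_two_mul, show (-ε + osgn b d) / 2 = -((ε - osgn b d) / 2) by ring,
      map_neg]
    ring
  have e5 := algebraMap_eq_two_mul (S := S) (osgn a c)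
  have e6 := algebraMap_eq_two_mul (S := S) (osgn b d)
  have e7 := algebraMap_eq_two_mul (S := S) (cartan a b c d)
  -- With a point at infinity the denominator is a scalar, so the relation is compared coefficient
  -- by coefficient, without shifts.
  have constant : ∀ s : ℂ, specDen z i j = algebraMap ℂ (MvPowerSeries (Fin 3) (Free S)) s →
      specNum z i j = (1 : MvPowerSeries (Fin 3) (Free S)) →
      (∀ k l, 2 * (𝐜 s * familyDer ε (z i) a b k (family (z j) c d l)) =
        𝐜 ε * (family (z i) c b k * family (z j) a d l)
          - 𝐜 (osgn a c) * (𝐜 s * (family (z i) c b k * family (z j) a d l))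
          - (𝐜 ε * (family (z i) a d k * family (z j) c b l)
          + 𝐜 (osgn b d) * (𝐜 s * (family (z i) a d k * family (z j) c b l)))
          + 𝐜 s * (𝐜 (cartan a b c d) * (family (z i) a b k * family (z j) c d l))) →
      (2 * specDen z i j * biline i j fun k l => (familyDer ε (z i) a b k) (family (z j) c d l)) =
        ((((algebraMap ℂ (MvPowerSeries (Fin 3) (Free S))) ε * specNum z i j -
            (algebraMap ℂ (MvPowerSeries (Fin 3) (Free S))) (osgn a c) * specDen z i j) *
          biline i j fun k l => family (z i) c b k * family (z j) a d l) -
        ((algebraMap ℂ (MvPowerSeries (Fin 3) (Free S))) ε * specNum z i j +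
            (algebraMap ℂ (MvPowerSeries (Fin 3) (Free S))) (osgn b d) * specDen z i j) *
          biline i j fun k l => family (z i) a d k * family (z j) c b l) +
      specDen z i j * (algebraMap ℂ (MvPowerSeries (Fin 3) (Free S))) (cartan a b c d) *
        biline i j fun k l => family (z i) a b k * family (z j) c d l := by
    intro s h1 h2 h
    rw [h1, h2]
    simp only [sub_mul, add_mul, mul_one, mul_assoc, algebraMap_mul_biline, biline_add,
      biline_sub, two_mul_biline, h]
  rcases hi : z i with _ | _ <;> rcases hj : z j with _ | _
  · have hw : specDen z i j = algebraMap ℂ (MvPowerSeries (Fin 3) (Free S)) 1 ∨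
        specDen z i j = algebraMap ℂ (MvPowerSeries (Fin 3) (Free S)) (-1) := by
      simp only [specDen, hi, hj]
      split_ifs <;> simp
    simp only [hi, hj] at constant
    rcases hw with hw | hw
    all_goals
      refine constant _ hw (by simp only [specNum, hi, hj]) fun k l => ?_
      simp only [family, familyDer, Bool.false_eq_true, if_false]
      rcases k with _ | k <;> rcases l with _ | l
      · simp only [if_true, genDer_genU, genBracket, map_one, map_neg, neg_div]
        first
          | linear_combination -(genU c b * genU a d) * e5 - (genU a d * genU c b) * e6
              + (genU a b * genU c d) * e7
          | linear_combination (genU c b * genU a d) * e5 + (genU a d * genU c b) * e6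
              - (genU a b * genU c d) * e7
      all_goals simp
  · simp only [hi, hj] at constant
    refine constant 1 (by simp [specDen, hi, hj]) (by simp only [specNum, hi, hj]) fun k l => ?_
    simp only [family, familyDer, Bool.false_eq_true, if_false, if_true, map_one]
    rcases k with _ | k
    · simp only [if_true, genDer_genT, genBracket]
      linear_combination -(genU c b * genT a d l) * e1 + (genU a d * genT c b l) * e2
        - (genU a b * genT c d l) * e7
    · simp
  · simp only [hi, hj] at constant
    refine constant (-1) (by simp [specDen, hi, hj]) (by simp only [specNum, hi, hj]) fun k l => ?_
    simp only [family, familyDer, Bool.false_eq_true, if_false, if_true, map_one, map_neg]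
    rcases l with _ | l
    · simp only [if_true, genDer_genU, genBracket]
      linear_combination -(genT c b k * genU a d) * e3 + (genT a d k * genU c b) * e4
        + (genT a b k * genU c d) * e7
    · simp
  · simp only [specDen, specNum, hi, hj, family, familyDer, if_true]
    simp only [mul_sub, sub_mul, mul_add, add_mul, mul_assoc, X_mul_biline i j hij,
      X_mul_biline_right i j hij, algebraMap_mul_biline, biline_add, biline_sub, two_mul_biline,
      genDer_genT]
    congr 1
    funext k l
    -- Multiplication by x_i - x_j compares the coefficient (k, l) with (k - 1, l) and (k, l - 1),
    -- so the coefficients with k = 0 or l = 0 are separate cases.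
    rcases k with _ | k <;> rcases l with _ | l
    · simp
    · simp only [genBracket, zero_add, zero_sub]
      have hs := sum_shift_zero (fun k => genT c b k) (fun k => genT a d k) l
      simp only [zero_add] at hs
      rw [hs]
      linear_combination (genT c b 0 * genT a d l) * e1 - (genT a d 0 * genT c b l) * e2
        + (genT a b 0 * genT c d l) * e7
    · simp only [genBracket, Finset.sum_range_zero]
      linear_combination -(genT c b k * genT a d 0) * e1 + (genT a d k * genT c b 0) * e2
        - (genT a b k * genT c d 0) * e7
    · simp only [genBracket]
      rw [sum_shift_succ (fun k => genT c b k) (fun k => genT a d k) k l]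
      linear_combination
        (genT c b (k + 1) * genT a d l - genT c b k * genT a d (l + 1)) * e1
        + (genT a d k * genT c b (l + 1) - genT a d (k + 1) * genT c b l) * e2
        + (genT a b (k + 1) * genT c d l - genT a b k * genT c d (l + 1)) * e7

theorem seriesDer_specDen (z : Fin 3 → Bool) (i j : Fin 3)
    (D : (Fin 3 →₀ ℕ) → Derivation ℂ (Free S) (Free S)) :
    seriesDer D (specDen z i j) = 0 := by
  unfold specDen
  split
  · rw [map_sub, seriesDer_X, seriesDer_X, sub_zero]
  · simp
  · simp
  · split_ifs <;> simp

theorem seriesDer_specNum (z : Fin 3 → Bool) (i j : Fin 3)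
    (D : (Fin 3 →₀ ℕ) → Derivation ℂ (Free S) (Free S)) :
    seriesDer D (specNum z i j) = 0 := by
  unfold specNum
  split <;> simp only [map_add, seriesDer_X, add_zero, Derivation.map_one_eq_zero]

theorem specDen_ne_zero (z : Fin 3 → Bool) (i j : Fin 3) (hij : i ≠ j) :
    (specDen z i j : MvPowerSeries (Fin 3) (Free S)) ≠ 0 := by
  unfold specDen
  split
  · intro h
    have h1 := congrArg (MvPowerSeries.coeff (Finsupp.single i 1)) h
    rw [map_sub, map_zero, MvPowerSeries.coeff_X, MvPowerSeries.coeff_X, if_pos rfl, if_neg,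
      sub_zero] at h1
    · exact one_ne_zero h1
    · intro h2
      exact hij (Finsupp.single_left_injective one_ne_zero h2)
  · exact one_ne_zero
  · exact neg_ne_zero.2 one_ne_zero
  · split_ifs
    · exact one_ne_zero
    · exact neg_ne_zero.2 one_ne_zero

theorem specDen_swap (z : Fin 3 → Bool) (i j : Fin 3) (hij : i < j) :
    (specDen z j i : MvPowerSeries (Fin 3) (Free S)) = -specDen z i j := by
  unfold specDen
  rcases z i <;> rcases z j <;> simp [hij, hij.not_gt]

theorem specNum_swap (z : Fin 3 → Bool) (i j : Fin 3) :
    (specNum z j i : MvPowerSeries (Fin 3) (Free S)) = specNum z i j := by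
  unfold specNum
  rcases z i <;> rcases z j <;> simp [add_comm]

/-- The addition formula for (x + y) / (x - y), cleared of denominators. It persists for points at
infinity if, among several of them, an earlier label counts as the farther point. -/
theorem spec_cyclic (z : Fin 3 → Bool) :
    (specNum z 0 1 * specNum z 1 2 * specDen z 2 0 + specNum z 1 2 * specNum z 2 0 * specDen z 0 1
      + specNum z 2 0 * specNum z 0 1 * specDen z 1 2
      + specDen z 0 1 * specDen z 1 2 * specDen z 2 0 : MvPowerSeries (Fin 3) (Free S)) = 0 := by
  have h : (2 : Fin 3) < 0 ↔ False := by decide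
  have h1 : (0 : Fin 3) < 1 ↔ True := by decide
  have h2 : (1 : Fin 3) < 2 ↔ True := by decide
  unfold specNum specDen
  rcases z 0 <;> rcases z 1 <;> rcases z 2 <;> simp only [h, h1, h2, if_true, if_false] <;> ring

-- Three separate variables keep the arguments apart. Power series over a polynomial ring form a
-- domain, so the nonzero factor 8 w₁₂w₂₃w₃₁ of `SklyaninRel.jacobi` can be cancelled before
-- coefficients are taken.
variable {ε} in
theorem family_jacobi (hε : ε * ε = 1) (z : Fin 3 → Bool) (a b : Fin 3 → S) (k : Fin 3 → ℕ) :
    familyDer ε (z 0) (a 0) (b 0) (k 0) (familyDer ε (z 1) (a 1) (b 1) (k 1)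
        (family (z 2) (a 2) (b 2) (k 2)))
      + familyDer ε (z 1) (a 1) (b 1) (k 1) (familyDer ε (z 2) (a 2) (b 2) (k 2)
        (family (z 0) (a 0) (b 0) (k 0)))
      + familyDer ε (z 2) (a 2) (b 2) (k 2) (familyDer ε (z 0) (a 0) (b 0) (k 0)
        (family (z 1) (a 1) (b 1) (k 1))) = 0 := by
  have rel := sklyaninRel_family (S := S) ε z
  have r10 := rel 1 0 (by decide)
  have r21 := rel 2 1 (by decide)
  have r02 := rel 0 2 (by decide)
  -- The denominators are taken in the cyclic order 01, 12, 20; exchanging the two points changes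
  -- their sign and keeps the numerators.
  rw [specDen_swap _ _ _ (by decide), specNum_swap] at r10 r21
  rw [← neg_neg (specDen z 0 2), ← specDen_swap _ _ _ (by decide), specNum_swap] at r02
  have J := SklyaninRel.jacobi hε osgn_antisymm osgn_cyclic
    (α := fun a b => -osgn a b) (γ := fun a b => osgn a b + kd a b)
    (fun a b => by rw [osgn_antisymm a b]) (spec_cyclic z)
    (rel 0 1 (by decide)) r10 (rel 1 2 (by decide)) r21 (rel 2 0 (by decide)) r02
    (fun _ _ => seriesDer_specDen _ _ _ _) (fun _ _ => seriesDer_specDen _ _ _ _)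
    (fun _ _ => seriesDer_specDen _ _ _ _) (fun _ _ => seriesDer_specNum _ _ _ _)
    (fun _ _ => seriesDer_specNum _ _ _ _) (fun _ _ => seriesDer_specNum _ _ _ _)
    (a 0) (b 0) (a 1) (b 1) (a 2) (b 2)
  have h8 : (8 : MvPowerSeries (Fin 3) (Free S)) ≠ 0 := by
    rw [← map_ofNat (algebraMap ℂ (MvPowerSeries (Fin 3) (Free S))) 8]
    exact (map_ne_zero_iff _ (algebraMap ℂ (MvPowerSeries (Fin 3) (Free S))).injective).2
      (by norm_num)
  have J2 := (mul_eq_zero.1 J).resolve_left (mul_ne_zero h8 (mul_ne_zero (mul_ne_zero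
    (specDen_ne_zero z 0 1 (by decide)) (specDen_ne_zero z 1 2 (by decide)))
    (specDen_ne_zero z 2 0 (by decide))))
  have J3 := congrArg (MvPowerSeries.coeff (Finsupp.equivFunOnFinite.symm k)) J2
  rw [seriesDer_lineSeries (by decide), seriesDer_lineSeries (by decide),
    seriesDer_lineSeries (by decide), map_add, map_add, coeff_seriesDer_biline (by decide)
    (by decide), coeff_seriesDer_biline (by decide) (by decide), coeff_seriesDer_biline (by decide)
    (by decide)] at J3
  · simpa using J3
  all_goals
    intro l _
    fin_cases l <;> simp

variable {ε} in
/-- The Jacobi identity for three generators of the free algebra. -/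
theorem genDer_jacobi (hε : ε * ε = 1) (u v w : S × S × Option ℕ) :
    genDer ε u (genBracket ε v w) + genDer ε v (genBracket ε w u)
      + genDer ε w (genBracket ε u v) = 0 := by
  -- Every generator is a coefficient of one of the two families, U being the constant term of a
  -- constant series.
  have h1 : ∀ u : S × S × Option ℕ, familyDer ε u.2.2.isSome u.1 u.2.1 (u.2.2.getD 0) =
      genDer ε u := by
    rintro ⟨a, b, _ | k⟩ <;> simp [familyDer]
  have h2 : ∀ u : S × S × Option ℕ, family u.2.2.isSome u.1 u.2.1 (u.2.2.getD 0) =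
      MvPolynomial.X u := by
    rintro ⟨a, b, _ | k⟩ <;> simp [family, genT, genU]
  have := family_jacobi hε ![u.2.2.isSome, v.2.2.isSome, w.2.2.isSome] ![u.1, v.1, w.1]
    ![u.2.1, v.2.1, w.2.1] ![u.2.2.getD 0, v.2.2.getD 0, w.2.2.getD 0]
  simpa [h1, h2, genDer_X] using this

end Free

end CyclicQuiver

end

noncomputable section

namespace CyclicQuiver

open Matrix

/-! ### Graded matrices -/

section Graded

variable {A : Type*} [CommRing A] {G I J K : Type*} [AddCommGroup G]

/-- A matrix is graded of degree `τ` if its `(i, j)` entries vanish unless `g j = f i + τ`. -/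
def IsGraded (f : I → G) (g : J → G) (τ : G) (M : Matrix I J A) : Prop :=
  ∀ i j, g j ≠ f i + τ → M i j = 0

theorem IsGraded.mul [Fintype J] {f : I → G} {g : J → G} {h : K → G} {τ τ' : G} {M : Matrix I J A}
    {N : Matrix J K A} (hM : IsGraded f g τ M) (hN : IsGraded g h τ' N) :
    IsGraded f h (τ + τ') (M * N) := by
  intro i k hik
  rw [mul_apply]
  refine Finset.sum_eq_zero fun j _ => ?_
  by_cases hj : g j = f i + τ
  · rw [hN j k (by rw [hj, add_assoc]; exact hik), mul_zero]
  · rw [hM i j hj, zero_mul]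

theorem IsGraded.pow [Fintype I] [DecidableEq I] {f : I → G} {τ : G} {M : Matrix I I A}
    (hM : IsGraded f f τ M) (n : ℕ) : IsGraded f f (n • τ) (M ^ n) := by
  induction n with
  | zero =>
    intro i j hij
    rw [pow_zero, one_apply_ne]
    rintro rfl
    simp at hij
  | succ n ih =>
    rw [pow_succ, succ_nsmul]
    exact ih.mul hM

variable [DecidableEq I] [DecidableEq G]

variable (A) in
/-- The projection onto the component `f i = r`. -/
def proj (f : I → G) (r : G) : Matrix I I A := diagonal fun i => if f i = r then 1 else 0

theorem proj_mul_apply [Fintype I] (f : I → G) (r : G) (M : Matrix I J A) (i : I) (j : J) :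
    (proj A f r * M) i j = if f i = r then M i j else 0 := by
  rw [proj, diagonal_mul]
  split_ifs <;> simp

theorem mul_proj_apply [Fintype I] (f : I → G) (r : G) (M : Matrix J I A) (j : J) (i : I) :
    (M * proj A f r) j i = if f i = r then M j i else 0 := by
  rw [proj, mul_diagonal]
  split_ifs <;> simp

theorem proj_apply (f : I → G) (r : G) (i j : I) :
    proj A f r i j = if i = j ∧ f i = r then 1 else 0 := by
  rw [proj, diagonal_apply]
  by_cases h : i = j <;> simp [h]

theorem sum_proj_mul_mul_proj [Fintype I] [Fintype G] {f : I → G} {M : Matrix I I A}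
    (hM : IsGraded f f 0 M) : ∑ r, proj A f r * M * proj A f r = M := by
  ext i j
  rw [Matrix.sum_apply]
  simp only [mul_proj_apply, proj_mul_apply]
  rw [Finset.sum_eq_single (f j)]
  · rw [if_pos rfl]
    split_ifs with h
    · rfl
    · rw [hM i j (by rw [add_zero]; exact fun h' => h h'.symm)]
  · intro r _ hr
    rw [if_neg hr.symm]
  · simp

theorem IsGraded.proj_mul [Fintype I] {f : I → G} {τ : G} {M : Matrix I I A}
    (hM : IsGraded f f τ M) (r : G) : proj A f r * M = M * proj A f (r + τ) := by
  ext i j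
  rw [proj_mul_apply, mul_proj_apply]
  by_cases h : f j = f i + τ
  · rw [h]
    simp
  · rw [hM i j h]
    simp

end Graded

/-! ### Derivations applied entrywise to matrix products. -/

section MatrixDerivation

variable {A : Type*} [CommRing A] [Algebra ℂ A] {I J K : Type*}

theorem map_derivation_mul [Fintype J] (D : Derivation ℂ A A) (M : Matrix I J A)
    (N : Matrix J K A) : (M * N).map D = M.map D * N + M * N.map D := by
  ext i k
  simp only [map_apply, mul_apply, Matrix.add_apply, map_sum, Derivation.leibniz, smul_eq_mul,
    Finset.sum_add_distrib]
  rw [add_comm]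
  congr 1
  exact Finset.sum_congr rfl fun j _ => mul_comm _ _

theorem map_derivation_pow [Fintype I] [DecidableEq I] (D : Derivation ℂ A A) (M : Matrix I I A)
    (n : ℕ) : (M ^ n).map D = ∑ p ∈ Finset.range n, M ^ p * M.map D * M ^ (n - 1 - p) := by
  induction n with
  | zero =>
    ext i j
    simp [one_apply, apply_ite D]
  | succ n ih =>
    rw [pow_succ, map_derivation_mul, ih, Finset.sum_range_succ, Finset.sum_mul]
    congr 1
    · refine Finset.sum_congr rfl fun p hp => ?_
      rw [Finset.mem_range] at hp
      rw [mul_assoc, ← pow_succ, show n - 1 - p + 1 = n + 1 - 1 - p by omega]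
    · simp

theorem map_derivation_mul_pow_mul [Fintype I] [DecidableEq I] {S T : Type*}
    (D : Derivation ℂ A A) (V : Matrix S I A) (M : Matrix I I A) (W : Matrix I T A) (n : ℕ) :
    (V * M ^ n * W).map D = V.map D * (M ^ n * W) +
      ∑ p ∈ Finset.range n, V * M ^ p * M.map D * (M ^ (n - 1 - p) * W) +
      V * M ^ n * W.map D := by
  rw [map_derivation_mul, map_derivation_mul, map_derivation_pow, Matrix.add_mul, Matrix.mul_assoc,
    Matrix.mul_sum, Matrix.sum_mul]
  simp only [Matrix.mul_assoc]

theorem mul_rank_one_mul [Fintype I] [Fintype J] {S T : Type*} (M : Matrix S I A)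
    (N : Matrix J T A) (f : I → A) (g : J → A) (s : S) (t : T) :
    (M * Matrix.of (fun i j => f i * g j) * N) s t = (∑ i, M s i * f i) * (∑ j, g j * N j t) := by
  rw [Matrix.mul_assoc, mul_apply, Finset.sum_mul]
  refine Finset.sum_congr rfl fun i _ => ?_
  rw [mul_apply, Finset.mul_sum, Finset.mul_sum]
  refine Finset.sum_congr rfl fun j _ => ?_
  rw [of_apply]
  ring

theorem mul_single_mul_apply {S : Type*} [Fintype S] [DecidableEq S] (M : Matrix I S A)
    (N : Matrix S J A) (b a : S) (i : I) (j : J) :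
    (M * single b a (1 : A) * N) i j = M i b * N a j := by
  rw [mul_apply, Finset.sum_eq_single a]
  · rw [mul_single_apply_same, mul_one]
  · intro c _ hc
    rw [mul_single_apply_of_ne _ _ _ _ _ hc, zero_mul]
  · simp

end MatrixDerivation

end CyclicQuiver

end

noncomputable section

namespace CyclicQuiver

open Matrix

/-! ### Brackets of a Lax matrix and spin vectors -/

section Lax

variable {A : Type*} [CommRing A] [Algebra ℂ A] {G I S : Type*} [AddCommGroup G] [Fintype G]
  [DecidableEq G] [Fintype I] [DecidableEq I] [Fintype S] [LinearOrder S]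

local notation "𝐜" => algebraMap ℂ A
local notation "𝐡" => algebraMap ℂ A (1 / 2)

/-- The sign `o(α, β)` for spin indices at the same vertex, `0` otherwise. -/
def vertexSign (t : S → G) (a b : S) : ℂ := if t a = t b then osgn a b else 0

/-- A graded matrix `L`, row vectors `V_a` and column vectors `W_a` with the brackets of the
cyclic quiver. -/
structure IsLaxSystem (f : I → G) (t : S → G) (β : A → Derivation ℂ A A) (L : Matrix I I A)
    (V : Matrix S I A) (W : Matrix I S A) (σ : G) (ε : ℂ) : Prop where
  skew : ∀ F G, β F G = -β G F
  gradedL : IsGraded f f σ L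
  gradedV : IsGraded t f 0 V
  gradedW : IsGraded f t 0 W
  -- Contractions with an arbitrary P carry the same information as the single brackets (take P
  -- elementary) and are what the Leibniz rule produces on powers of L. The projections keep only
  -- the diagonal blocks.
  LL : ∀ (P : Matrix I I A) (k l : I), ∑ i, ∑ j, P j i * β (L i j) (L k l) =
    𝐡 * 𝐜 ε * (∑ r, (L * (proj A f r * (L * P) * proj A f r)
      - (proj A f r * (P * L) * proj A f r) * L)) k l
  LV : ∀ i j a l, β (L i j) (V a l) =
    𝐡 * ((V * L) a j * proj A f (t a) i l - V a j * (L * proj A f (t a)) i l)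
  LW : ∀ i j k d, β (L i j) (W k d) =
    𝐡 * (proj A f (t d) k j * (L * W) i d - (proj A f (t d) * L) k j * W i d)
  VV : ∀ a j c l, β (V a j) (V c l) =
    -(𝐡 * 𝐜 (osgn a c) * (V a j * V c l)) - 𝐡 * 𝐜 (vertexSign t a c) * (V c j * V a l)
  WW : ∀ b i d k, β (W i b) (W k d) =
    -(𝐡 * 𝐜 (osgn b d) * (W k d * W i b)) - 𝐡 * 𝐜 (vertexSign t b d) * (W k b * W i d)
  VW : ∀ a j d k, β (V a j) (W k d) =
    𝐡 * 𝐜 (osgn a d) * (W k d * V a j)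
      + 𝐜 (kd a d) * (proj A f (t a) k j + 𝐡 * (W k d * V a j)
        + 𝐡 * (proj A f (t a) k j * (V * W) a d))
      + 𝐡 * 𝐜 (vertexSign t a d) * (proj A f (t a) k j * (V * W) a d)

/-- The matrix of the functions `V_a L^k W_b`. -/
def moment (L : Matrix I I A) (V : Matrix S I A) (W : Matrix I S A) (k : ℕ) : Matrix S S A :=
  V * L ^ k * W

namespace IsLaxSystem

variable {f : I → G} {t : S → G} {β : A → Derivation ℂ A A} {L : Matrix I I A} {V : Matrix S I A}
  {W : Matrix I S A} {σ : G} {ε : ℂ} (H : IsLaxSystem f t β L V W σ ε)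

include H

theorem graded_row (p : ℕ) : IsGraded t f (p • σ) (V * L ^ p) := by
  simpa using H.gradedV.mul (H.gradedL.pow p)

theorem graded_col (q : ℕ) : IsGraded f t (q • σ) (L ^ q * W) := by
  simpa using (H.gradedL.pow q).mul H.gradedW

theorem graded_moment (k : ℕ) : IsGraded t t (k • σ) (moment L V W k) := by
  simpa [moment] using (H.graded_row k).mul H.gradedW

/-- Under `h` the moment at (c, b) vanishes unless c and a lie at the same vertex, where the two
signs agree. In this way the restriction to equal vertices disappears from the formulas. -/
theorem vertexSign_mul_moment (a c b : S) {k : ℕ} (h : t b = t a + k • σ) :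
    𝐜 (vertexSign t a c) * moment L V W k c b = 𝐜 (osgn a c) * moment L V W k c b := by
  by_cases hac : t a = t c
  · rw [vertexSign, if_pos hac]
  · rw [H.graded_moment k c b (by rw [h]; simpa using hac), mul_zero, mul_zero]

theorem vertexSign_mul_moment_right (b d a : S) {k : ℕ} (h : t b = t a + k • σ) :
    𝐜 (vertexSign t b d) * moment L V W k a d = 𝐜 (osgn b d) * moment L V W k a d := by
  by_cases hac : t b = t d
  · rw [vertexSign, if_pos hac]
  · rw [H.graded_moment k a d (by rw [← h]; exact fun h' => hac h'.symm), mul_zero, mul_zero]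

theorem vertexSign_mul_moment_zero (a d : S) :
    𝐜 (vertexSign t a d) * moment L V W 0 a d = 𝐜 (osgn a d) * moment L V W 0 a d := by
  by_cases hac : t a = t d
  · rw [vertexSign, if_pos hac]
  · rw [H.graded_moment 0 a d (by simpa using fun h => hac h.symm), mul_zero, mul_zero]

/-- The contribution of the matrix `L` to the bracket with `V_a L^n W_b`. -/
theorem sum_sandwich (F : A) (X : Matrix S I A) (Y : Matrix I S A) (a b : S) :
    (X * L.map (β F) * Y) a b =
      -∑ i, ∑ j, (Y * single b a (1 : A) * X) j i * β (L i j) F := by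
  rw [Matrix.mul_assoc, mul_apply, ← Finset.sum_neg_distrib]
  refine Finset.sum_congr rfl fun i _ => ?_
  rw [mul_apply, Finset.mul_sum, ← Finset.sum_neg_distrib]
  refine Finset.sum_congr rfl fun j _ => ?_
  rw [mul_single_mul_apply, map_apply, H.skew F]
  ring

theorem bracket_moment (F : A) (n : ℕ) (a b : S) :
    β F (moment L V W n a b) = (V.map (β F) * (L ^ n * W)) a b +
      ∑ p ∈ Finset.range n, (V * L ^ p * L.map (β F) * (L ^ (n - 1 - p) * W)) a b +
      (V * L ^ n * W.map (β F)) a b := by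
  have := congrFun (congrFun (map_derivation_mul_pow_mul (β F) V L W n) a) b
  rw [Matrix.add_apply, Matrix.add_apply, Matrix.sum_apply] at this
  exact this

theorem col_proj {b : S} {q : ℕ} (r : G) (hr : t b = r + q • σ) (k : I) :
    (proj A f r * (L ^ q * W)) k b = (L ^ q * W) k b := by
  rw [proj_mul_apply]
  split_ifs with h
  · rfl
  · rw [H.graded_col q k b]
    rw [hr]
    exact fun h' => h (add_right_cancel h').symm

theorem row_proj {a : S} {p : ℕ} (r : G) (hr : r = t a + p • σ) (l : I) :
    (V * L ^ p * proj A f r) a l = (V * L ^ p) a l := by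
  rw [mul_proj_apply]
  split_ifs with h
  · rfl
  · rw [H.graded_row p a l]
    rw [← hr]
    exact h

omit H in
theorem mul_row_pow (n : ℕ) : V * L ^ n * L = V * L ^ (n + 1) := by
  rw [Matrix.mul_assoc, ← pow_succ]

omit H in
theorem mul_pow_col (n : ℕ) : L * (L ^ n * W) = L ^ (n + 1) * W := by
  rw [← Matrix.mul_assoc, ← pow_succ']

theorem mul_proj_col {b : S} {q : ℕ} (r : G) (hr : t b = r + q • σ) (k : I) :
    (L * proj A f r * (L ^ q * W)) k b = (L ^ (q + 1) * W) k b := by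
  rw [← mul_pow_col, Matrix.mul_assoc, mul_apply, mul_apply]
  exact Finset.sum_congr rfl fun j _ => by rw [H.col_proj r hr]

theorem row_proj_mul {a : S} {p : ℕ} (r : G) (hr : r = t a + p • σ) (l : I) :
    (V * L ^ p * (proj A f r * L)) a l = (V * L ^ (p + 1)) a l := by
  rw [← mul_row_pow, ← Matrix.mul_assoc, mul_apply, mul_apply]
  exact Finset.sum_congr rfl fun j _ => by rw [H.row_proj r hr]

/-- Differentiating the p-th factor of L^n gives a multiple of g p - g (p + 2), so the sum
telescopes in steps of two. The four remaining terms g 0, g 1, g n, g (n + 1) are also those coming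
from V and W, which explains the coefficients 1 ± ε. -/
theorem bracket_L_moment {a b : S} {n : ℕ} (h : t b = t a + n • σ) (k l : I) :
    β (L k l) (moment L V W n a b) =
      𝐡 * ((1 - 𝐜 ε) * ((L ^ n * W) k b * (V * L) a l)
        - (1 + 𝐜 ε) * ((L ^ (n + 1) * W) k b * V a l)
        + (1 + 𝐜 ε) * ((L * W) k b * (V * L ^ n) a l)
        - (1 - 𝐜 ε) * (W k b * (V * L ^ (n + 1)) a l)) := by
  set g : ℕ → A := fun p => (L ^ (n + 1 - p) * W) k b * (V * L ^ p) a l with hg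
  have hL : ∀ p ∈ Finset.range n, (V * L ^ p * L.map (β (L k l)) * (L ^ (n - 1 - p) * W)) a b =
      -(𝐡 * 𝐜 ε) * (g p - g (p + 2)) := by
    intro p hp
    rw [Finset.mem_range] at hp
    obtain ⟨q, rfl⟩ : ∃ q, n = p + q + 1 := ⟨n - 1 - p, by omega⟩
    rw [show p + q + 1 - 1 - p = q by omega, H.sum_sandwich, H.LL, Finset.sum_sub_distrib,
      ← Finset.mul_sum, ← Finset.sum_mul]
    -- The sandwiched matrix has degree 0, so it is the sum of its diagonal blocks and the
    -- projections of `LL` have no effect.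
    have hgr : IsGraded f f 0 (L ^ (q + 1) * W * single b a (1 : A) * (V * L ^ p)) := by
      intro i j hij
      rw [mul_single_mul_apply]
      by_cases h1 : f j = t a + p • σ
      · rw [H.graded_col, zero_mul]
        rw [h, show p + q + 1 = p + (q + 1) by ring, add_nsmul, ← add_assoc, ← h1]
        intro h2
        exact hij (by rw [add_zero]; exact add_right_cancel h2)
      · rw [H.graded_row p a j h1, mul_zero]
    have hgr' : IsGraded f f 0 (L ^ q * W * single b a (1 : A) * (V * L ^ (p + 1))) := by
      intro i j hij
      rw [mul_single_mul_apply]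
      by_cases h1 : f j = t a + (p + 1) • σ
      · rw [H.graded_col, zero_mul]
        rw [h, show p + q + 1 = (p + 1) + q by ring, add_nsmul, ← add_assoc, ← h1]
        intro h2
        exact hij (by rw [add_zero]; exact add_right_cancel h2)
      · rw [H.graded_row (p + 1) a j h1, mul_zero]
    have e1 : L * (L ^ q * W * single b a (1 : A) * (V * L ^ p)) =
        L ^ (q + 1) * W * single b a (1 : A) * (V * L ^ p) := by
      rw [pow_succ']
      simp only [Matrix.mul_assoc]
    have e2 : L ^ q * W * single b a (1 : A) * (V * L ^ p) * L =
        L ^ q * W * single b a (1 : A) * (V * L ^ (p + 1)) := by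
      rw [pow_succ]
      simp only [Matrix.mul_assoc]
    rw [e1, e2, sum_proj_mul_mul_proj hgr, sum_proj_mul_mul_proj hgr', Matrix.sub_apply]
    have e3 : L * (L ^ (q + 1) * W * single b a (1 : A) * (V * L ^ p)) =
        L ^ (q + 2) * W * single b a (1 : A) * (V * L ^ p) := by
      rw [pow_succ' L (q + 1)]
      simp only [Matrix.mul_assoc]
    have e4 : L ^ q * W * single b a (1 : A) * (V * L ^ (p + 1)) * L =
        L ^ q * W * single b a (1 : A) * (V * L ^ (p + 2)) := by
      rw [pow_succ L (p + 1)]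
      simp only [Matrix.mul_assoc]
    rw [e3, e4, mul_single_mul_apply, mul_single_mul_apply, hg]
    dsimp only
    rw [show p + q + 1 + 1 - p = q + 2 by omega, show p + q + 1 + 1 - (p + 2) = q by omega]
    ring
  have hV : (V.map (β (L k l)) * (L ^ n * W)) a b = 𝐡 * (g 1 - g 0) := by
    rw [mul_apply]
    have : ∀ j ∈ Finset.univ, V.map (β (L k l)) a j * (L ^ n * W) j b =
        𝐡 * ((V * L) a l * (proj A f (t a) k j * (L ^ n * W) j b)
          - V a l * ((L * proj A f (t a)) k j * (L ^ n * W) j b)) := by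
      intro j _
      rw [map_apply, H.LV]
      ring
    rw [Finset.sum_congr rfl this, ← Finset.mul_sum, Finset.sum_sub_distrib, ← Finset.mul_sum,
      ← Finset.mul_sum, ← mul_apply, ← mul_apply, H.col_proj _ h, H.mul_proj_col _ h, hg]
    dsimp only
    rw [show n + 1 - 1 = n by omega, show n + 1 - 0 = n + 1 by omega, pow_one, pow_zero,
      Matrix.mul_one]
    ring
  have hW : (V * L ^ n * W.map (β (L k l))) a b = 𝐡 * (g n - g (n + 1)) := by
    rw [mul_apply]
    have : ∀ j ∈ Finset.univ, (V * L ^ n) a j * W.map (β (L k l)) j b =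
        𝐡 * ((L * W) k b * ((V * L ^ n) a j * proj A f (t b) j l)
          - W k b * ((V * L ^ n) a j * (proj A f (t b) * L) j l)) := by
      intro j _
      rw [map_apply, H.LW]
      ring
    rw [Finset.sum_congr rfl this, ← Finset.mul_sum, Finset.sum_sub_distrib, ← Finset.mul_sum,
      ← Finset.mul_sum, ← mul_apply, ← mul_apply, H.row_proj _ h, H.row_proj_mul _ h, hg]
    dsimp only
    rw [show n + 1 - n = 1 by omega, show n + 1 - (n + 1) = 0 by omega, pow_one, pow_zero,
      Matrix.one_mul]
  have tele : ∑ p ∈ Finset.range n, (g p - g (p + 2)) = g 0 + g 1 - g n - g (n + 1) := by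
    have := Finset.sum_range_sub' (fun p => g p + g (p + 1)) n
    rw [show g 0 + g 1 - g n - g (n + 1) = g 0 + g (0 + 1) - (g n + g (n + 1)) by ring, ← this]
    refine Finset.sum_congr rfl fun p _ => ?_
    ring
  rw [H.bracket_moment, Finset.sum_congr rfl hL, ← Finset.mul_sum, tele, hV, hW]
  simp only [hg, show n + 1 - 1 = n by omega, show n + 1 - n = 1 by omega,
    show n + 1 - (n + 1) = 0 by omega, show n + 1 - 0 = n + 1 by omega, pow_one, pow_zero,
    Matrix.mul_one, Matrix.one_mul]
  ring

omit H in
theorem row_col (p q : ℕ) (c b : S) :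
    (V * L ^ p * (L ^ q * W)) c b = moment L V W (p + q) c b := by
  rw [moment, Matrix.mul_assoc, ← Matrix.mul_assoc (L ^ p), ← pow_add, ← Matrix.mul_assoc]

omit H in
theorem row_col_zero (q : ℕ) (c b : S) : (V * (L ^ q * W)) c b = moment L V W q c b := by
  rw [moment, Matrix.mul_assoc]

/-- The factors L contribute the differences of u p = (V L^p)_{al} (V L^{n-p} W)_{cb}. The sum
telescopes, and its last term u n brings in the zeroth moment. -/
theorem bracket_V_moment {a b : S} {n : ℕ} (h : t b = t a + n • σ) (c : S) (l : I) :
    β (V c l) (moment L V W n a b) =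
      𝐡 * (𝐜 (osgn a c) + 𝐜 (osgn c b) + 𝐜 (kd c b)) * (V c l * moment L V W n a b)
      + 𝐡 * (𝐜 (osgn a c) - 1) * (V a l * moment L V W n c b)
      + (V * L ^ n) a l * (𝐜 (kd c b)
        + 𝐡 * (1 + 𝐜 (kd c b) + 𝐜 (osgn c b)) * moment L V W 0 c b) := by
  have hV : (V.map (β (V c l)) * (L ^ n * W)) a b =
      𝐡 * 𝐜 (osgn a c) * (V c l * moment L V W n a b)
      + 𝐡 * (V a l * (𝐜 (osgn a c) * moment L V W n c b)) := by
    rw [← H.vertexSign_mul_moment a c b h, mul_apply]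
    have hs : vertexSign t c a = -vertexSign t a c := by
      simp only [vertexSign, eq_comm (a := t c), osgn_antisymm c a]
      split_ifs <;> simp
    have : ∀ j ∈ Finset.univ, V.map (β (V c l)) a j * (L ^ n * W) j b =
        𝐡 * 𝐜 (osgn a c) * V c l * (V a j * (L ^ n * W) j b) +
        𝐡 * 𝐜 (vertexSign t a c) * V a l * (V c j * (L ^ n * W) j b) := by
      intro j _
      rw [map_apply, H.VV, osgn_antisymm c a, hs, map_neg, map_neg]
      ring
    rw [Finset.sum_congr rfl this, Finset.sum_add_distrib, ← Finset.mul_sum, ← Finset.mul_sum,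
      ← mul_apply, ← mul_apply, row_col_zero, row_col_zero]
    ring
  have hW : (V * L ^ n * W.map (β (V c l))) a b =
      𝐡 * (𝐜 (osgn c b) + 𝐜 (kd c b)) * (V c l * moment L V W n a b)
      + (V * L ^ n) a l * 𝐜 (kd c b)
      + 𝐡 * (V * L ^ n) a l * 𝐜 (kd c b) * moment L V W 0 c b
      + 𝐡 * (V * L ^ n) a l * (𝐜 (osgn c b) * moment L V W 0 c b) := by
    rw [← H.vertexSign_mul_moment_zero c b, mul_apply]
    have : ∀ j ∈ Finset.univ, (V * L ^ n) a j * W.map (β (V c l)) j b =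
        𝐡 * (𝐜 (osgn c b) + 𝐜 (kd c b)) * V c l * ((V * L ^ n) a j * W j b)
        + (𝐜 (kd c b) * (1 + 𝐡 * moment L V W 0 c b)
          + 𝐡 * 𝐜 (vertexSign t c b) * moment L V W 0 c b) *
          ((V * L ^ n) a j * proj A f (t c) j l) := by
      intro j _
      rw [map_apply, H.VW, moment, pow_zero, Matrix.mul_one]
      ring
    rw [Finset.sum_congr rfl this, Finset.sum_add_distrib, ← Finset.mul_sum, ← Finset.mul_sum,
      ← mul_apply, ← mul_apply]
    change 𝐡 * (𝐜 (osgn c b) + 𝐜 (kd c b)) * V c l * moment L V W n a b + _ = _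
    -- The projection at the vertex of c is harmless when b lies at that vertex; otherwise its
    -- coefficient is zero.
    by_cases hcb : t c = t b
    · rw [H.row_proj (t c) (hcb.trans h)]
      ring
    · rw [vertexSign, if_neg hcb, kd_of_ne (fun h => hcb (congrArg t h)), map_zero]
      ring
  set u : ℕ → A := fun p => (V * L ^ p) a l * moment L V W (n - p) c b with hu
  -- Next to a moment the projection can be dropped: when the degrees do not match, the moment
  -- itself is zero.
  have keep : ∀ p q, n = p + q → (V * L ^ p * proj A f (t c)) a l * moment L V W q c b =
      (V * L ^ p) a l * moment L V W q c b := by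
    intro p q hn
    by_cases hb : t b = t c + q • σ
    · rw [H.row_proj]
      rw [h, hn, add_nsmul, ← add_assoc] at hb
      exact (add_right_cancel hb).symm
    · rw [H.graded_moment q c b hb, mul_zero, mul_zero]
  have hL : ∀ p ∈ Finset.range n, (V * L ^ p * L.map (β (V c l)) * (L ^ (n - 1 - p) * W)) a b =
      𝐡 * (u (p + 1) - u p) := by
    intro p hp
    rw [Finset.mem_range] at hp
    have hP : L.map (β (V c l)) =
        Matrix.of (fun i j => 𝐡 * (L * proj A f (t c)) i l * V c j)
          - Matrix.of (fun i j => 𝐡 * proj A f (t c) i l * (V * L) c j) := by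
      ext i j
      rw [map_apply, H.skew, H.LV, Matrix.sub_apply, of_apply, of_apply]
      ring
    have k1 := keep (p + 1) (n - 1 - p) (by omega)
    have k2 := keep p (n - p) (by omega)
    have e1 : (V * (L ^ (n - 1 - p) * W)) c b = moment L V W (n - 1 - p) c b := row_col_zero _ _ _
    have e2 : (V * L * (L ^ (n - 1 - p) * W)) c b = moment L V W (n - p) c b := by
      have := row_col (L := L) (V := V) (W := W) 1 (n - 1 - p) c b
      rwa [pow_one, show 1 + (n - 1 - p) = n - p by omega] at this
    rw [hP, Matrix.mul_sub, Matrix.sub_mul, Matrix.sub_apply,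
      mul_rank_one_mul, mul_rank_one_mul, ← mul_apply, ← mul_apply, e1, e2]
    simp only [mul_left_comm _ 𝐡, ← Finset.mul_sum]
    rw [← mul_apply, ← mul_apply, ← Matrix.mul_assoc, mul_row_pow, mul_assoc, mul_assoc, k1, k2, hu]
    dsimp only
    rw [show n - (p + 1) = n - 1 - p by omega]
    ring
  rw [H.bracket_moment, Finset.sum_congr rfl hL, ← Finset.mul_sum, Finset.sum_range_sub u, hV, hW,
    hu]
  dsimp only
  rw [Nat.sub_self, Nat.sub_zero, pow_zero, Matrix.mul_one]
  ring

/-- The mirror image of `bracket_V_moment`: powers of L now pass from the column L^n W to the moment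
at (a, d). -/
theorem bracket_W_moment {a b : S} {n : ℕ} (h : t b = t a + n • σ) (d : S) (k : I) :
    β (W k d) (moment L V W n a b) =
      -(𝐡 * (𝐜 (osgn a d) + 𝐜 (kd a d) - 𝐜 (osgn b d)) * (W k d * moment L V W n a b))
      - 𝐡 * (1 - 𝐜 (osgn b d)) * (W k b * moment L V W n a d)
      - (L ^ n * W) k b * (𝐜 (kd a d)
        + 𝐡 * (𝐜 (kd a d) + 𝐜 (osgn a d) - 1) * moment L V W 0 a d) := by
  have hW : (V * L ^ n * W.map (β (W k d))) a b =
      𝐡 * 𝐜 (osgn b d) * (W k d * moment L V W n a b)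
      + 𝐡 * (W k b * (𝐜 (osgn b d) * moment L V W n a d)) := by
    rw [← H.vertexSign_mul_moment_right b d a h, mul_apply]
    have hs : vertexSign t d b = -vertexSign t b d := by
      simp only [vertexSign, eq_comm (a := t d), osgn_antisymm d b]
      split_ifs <;> simp
    have : ∀ j ∈ Finset.univ, (V * L ^ n) a j * W.map (β (W k d)) j b =
        𝐡 * 𝐜 (osgn b d) * W k d * ((V * L ^ n) a j * W j b) +
        𝐡 * 𝐜 (vertexSign t b d) * W k b * ((V * L ^ n) a j * W j d) := by
      intro j _
      rw [map_apply, H.WW, osgn_antisymm d b, hs, map_neg, map_neg]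
      ring
    rw [Finset.sum_congr rfl this, Finset.sum_add_distrib, ← Finset.mul_sum, ← Finset.mul_sum,
      ← mul_apply, ← mul_apply]
    change 𝐡 * _ * _ * moment L V W n a b + 𝐡 * _ * _ * moment L V W n a d = _
    ring
  have hV : (V.map (β (W k d)) * (L ^ n * W)) a b =
      -(𝐡 * (𝐜 (osgn a d) + 𝐜 (kd a d)) * (W k d * moment L V W n a b))
      - (L ^ n * W) k b * 𝐜 (kd a d)
      - 𝐡 * (L ^ n * W) k b * 𝐜 (kd a d) * moment L V W 0 a d
      - 𝐡 * (L ^ n * W) k b * (𝐜 (osgn a d) * moment L V W 0 a d) := by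
    rw [← H.vertexSign_mul_moment_zero a d, mul_apply]
    have : ∀ j ∈ Finset.univ, V.map (β (W k d)) a j * (L ^ n * W) j b =
        -(𝐡 * (𝐜 (osgn a d) + 𝐜 (kd a d)) * W k d) * (V a j * (L ^ n * W) j b)
        - (𝐜 (kd a d) * (1 + 𝐡 * moment L V W 0 a d)
          + 𝐡 * 𝐜 (vertexSign t a d) * moment L V W 0 a d) *
          (proj A f (t a) k j * (L ^ n * W) j b) := by
      intro j _
      rw [map_apply, H.skew, H.VW, moment, pow_zero, Matrix.mul_one]
      ring
    rw [Finset.sum_congr rfl this, Finset.sum_sub_distrib, ← Finset.mul_sum, ← Finset.mul_sum,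
      ← mul_apply, ← mul_apply, row_col_zero, H.col_proj _ h]
    ring
  set u : ℕ → A := fun p => moment L V W p a d * (L ^ (n - p) * W) k b with hu
  have keep : ∀ p q, n = p + q → moment L V W p a d * (proj A f (t d) * (L ^ q * W)) k b =
      moment L V W p a d * (L ^ q * W) k b := by
    intro p q hn
    by_cases hb : t d = t a + p • σ
    · rw [H.col_proj]
      rw [h, hn, add_nsmul, ← add_assoc, hb]
    · rw [H.graded_moment p a d hb, zero_mul, zero_mul]
  have hL : ∀ p ∈ Finset.range n, (V * L ^ p * L.map (β (W k d)) * (L ^ (n - 1 - p) * W)) a b =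
      -𝐡 * (u (p + 1) - u p) := by
    intro p hp
    rw [Finset.mem_range] at hp
    have hP : L.map (β (W k d)) =
        Matrix.of (fun i j => W i d * (𝐡 * (proj A f (t d) * L) k j))
          - Matrix.of (fun i j => (L * W) i d * (𝐡 * proj A f (t d) k j)) := by
      ext i j
      rw [map_apply, H.skew, H.LW, Matrix.sub_apply, of_apply, of_apply]
      ring
    have k1 := keep (p + 1) (n - 1 - p) (by omega)
    have k2 := keep p (n - p) (by omega)
    have e1 : (V * L ^ p * (L * W)) a d = moment L V W (p + 1) a d := by
      simpa only [pow_one] using row_col (L := L) (V := V) (W := W) p 1 a d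
    have e2 : (V * L ^ p * W) a d = moment L V W p a d := rfl
    have e3 : (proj A f (t d) * L * (L ^ (n - 1 - p) * W)) k b =
        (proj A f (t d) * (L ^ (n - p) * W)) k b := by
      rw [Matrix.mul_assoc, mul_pow_col, show n - 1 - p + 1 = n - p by omega]
    rw [hP, Matrix.mul_sub, Matrix.sub_mul, Matrix.sub_apply,
      mul_rank_one_mul, mul_rank_one_mul, ← mul_apply, ← mul_apply, e1, e2]
    simp only [mul_assoc 𝐡, ← Finset.mul_sum]
    rw [← mul_apply, ← mul_apply, e3, mul_left_comm (moment L V W p a d),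
      mul_left_comm (moment L V W (p + 1) a d), k2, k1, hu]
    dsimp only
    rw [show n - (p + 1) = n - 1 - p by omega]
    ring
  rw [H.bracket_moment, Finset.sum_congr rfl hL, ← Finset.mul_sum, Finset.sum_range_sub u, hV, hW,
    hu]
  dsimp only
  rw [Nat.sub_self, Nat.sub_zero, pow_zero, Matrix.one_mul]
  ring

omit H in
theorem two_mul_half : (2 : A) * 𝐡 = 1 := by
  rw [← map_ofNat (algebraMap ℂ A) 2, ← map_mul]
  norm_num

theorem bracket_moment_moment_aux {a b : S} {n : ℕ} (h : t b = t a + n • σ) (l : ℕ) (c d : S) :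
    β (moment L V W n a b) (moment L V W l c d) =
      -(𝐡 * (𝐜 (osgn a c) + 𝐜 (kd c b) + 𝐜 (osgn c b)) *
          (moment L V W l c d * moment L V W n a b)
        + 𝐡 * (𝐜 (osgn a c) - 1) * (moment L V W l a d * moment L V W n c b)
        + moment L V W (n + l) a d * (𝐜 (kd c b)
        + 𝐡 * (1 + 𝐜 (kd c b) + 𝐜 (osgn c b)) * moment L V W 0 c b))
      + ∑ p ∈ Finset.range l, (-𝐡 *
        ((1 - 𝐜 ε) * (moment L V W (p + n) c b * moment L V W (l - p) a d)
        - (1 + 𝐜 ε) * (moment L V W (n + 1 + p) c b * moment L V W (l - 1 - p) a d)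
        + (1 + 𝐜 ε) * (moment L V W (p + 1) c b * moment L V W (n + (l - 1 - p)) a d)
        - (1 - 𝐜 ε) * (moment L V W p c b * moment L V W (n + l - p) a d)))
      + (𝐡 * (𝐜 (osgn a d) + 𝐜 (kd a d) - 𝐜 (osgn b d)) *
          (moment L V W l c d * moment L V W n a b)
        + 𝐡 * (1 - 𝐜 (osgn b d)) * (moment L V W l c b * moment L V W n a d)
        + moment L V W (n + l) c b * (𝐜 (kd a d)
        + 𝐡 * (𝐜 (kd a d) + 𝐜 (osgn a d) - 1) * moment L V W 0 a d)) := by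
  rw [H.bracket_moment]
  congr 1
  · congr 1
    · rw [mul_apply]
      have : ∀ j ∈ Finset.univ, V.map (β (moment L V W n a b)) c j * (L ^ l * W) j d =
          -(𝐡 * (𝐜 (osgn a c) + 𝐜 (kd c b) + 𝐜 (osgn c b)) * moment L V W n a b) *
            (V c j * (L ^ l * W) j d)
          + -(𝐡 * (𝐜 (osgn a c) - 1) * moment L V W n c b) * (V a j * (L ^ l * W) j d)
          + -(𝐜 (kd c b) + 𝐡 * (1 + 𝐜 (kd c b) + 𝐜 (osgn c b)) * moment L V W 0 c b) *
            ((V * L ^ n) a j * (L ^ l * W) j d) := by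
        intro j _
        rw [map_apply, H.skew, H.bracket_V_moment h]
        ring
      rw [Finset.sum_congr rfl this, Finset.sum_add_distrib, Finset.sum_add_distrib,
        ← Finset.mul_sum, ← Finset.mul_sum, ← Finset.mul_sum, ← mul_apply, ← mul_apply,
        ← mul_apply, row_col_zero, row_col_zero, row_col]
      ring
    · refine Finset.sum_congr rfl fun p hp => ?_
      rw [Finset.mem_range] at hp
      have hP : L.map (β (moment L V W n a b)) =
          Matrix.of (fun i j => (L ^ n * W) i b * (-𝐡 * (1 - 𝐜 ε) * (V * L) a j))
          + Matrix.of (fun i j => (L ^ (n + 1) * W) i b * (𝐡 * (1 + 𝐜 ε) * V a j))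
          + Matrix.of (fun i j => (L * W) i b * (-𝐡 * (1 + 𝐜 ε) * (V * L ^ n) a j))
          + Matrix.of (fun i j => W i b * (𝐡 * (1 - 𝐜 ε) * (V * L ^ (n + 1)) a j)) := by
        ext i j
        rw [map_apply, H.skew, H.bracket_L_moment h]
        simp only [Matrix.add_apply, of_apply]
        ring
      have e1 : (V * L ^ p * (L * W)) c b = moment L V W (p + 1) c b := by
        simpa only [pow_one] using row_col (L := L) (V := V) (W := W) p 1 c b
      have e2 : (V * L ^ p * W) c b = moment L V W p c b := rfl
      have e3 : (V * L * (L ^ (l - 1 - p) * W)) a d = moment L V W (l - p) a d := by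
        have := row_col (L := L) (V := V) (W := W) 1 (l - 1 - p) a d
        rwa [pow_one, show 1 + (l - 1 - p) = l - p by omega] at this
      rw [hP]
      simp only [Matrix.mul_add, Matrix.add_mul]
      simp only [Matrix.add_apply]
      rw [mul_rank_one_mul, mul_rank_one_mul, mul_rank_one_mul, mul_rank_one_mul]
      simp only [mul_assoc (_ * _), ← Finset.mul_sum]
      simp only [← mul_apply]
      have e4 : (V * (L ^ (l - 1 - p) * W)) a d = moment L V W (l - 1 - p) a d :=
        row_col_zero _ _ _
      rw [e1, e2, e3, e4, row_col, row_col, row_col, row_col,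
        show p + (n + 1) = n + 1 + p by omega, show n + 1 + (l - 1 - p) = n + l - p by omega]
      ring
  · rw [mul_apply]
    have : ∀ j ∈ Finset.univ, (V * L ^ l) c j * W.map (β (moment L V W n a b)) j d =
        (𝐡 * (𝐜 (osgn a d) + 𝐜 (kd a d) - 𝐜 (osgn b d)) * moment L V W n a b) *
          ((V * L ^ l) c j * W j d)
        + 𝐡 * (1 - 𝐜 (osgn b d)) * moment L V W n a d * ((V * L ^ l) c j * W j b)
        + (𝐜 (kd a d) + 𝐡 * (𝐜 (kd a d) + 𝐜 (osgn a d) - 1) * moment L V W 0 a d) *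
          ((V * L ^ l) c j * (L ^ n * W) j b) := by
      intro j _
      rw [map_apply, H.skew, H.bracket_W_moment h]
      ring
    rw [Finset.sum_congr rfl this, Finset.sum_add_distrib, Finset.sum_add_distrib,
      ← Finset.mul_sum, ← Finset.mul_sum, ← Finset.mul_sum, ← mul_apply, ← mul_apply,
      ← mul_apply, row_col, add_comm l n]
    change _ * moment L V W l c d + _ * moment L V W l c b + _ = _
    ring

variable (L V W ε) in
/-- The function `U_{ab}`: up to sign and constants, the entries of `(V_a W_b)` on one side of the
diagonal. -/
def cornerU (a b : S) : A :=
  𝐜 (kd a b) + 𝐡 * (𝐜 (kd a b) + 𝐜 (osgn a b) - 𝐜 ε) * moment L V W 0 a b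

/-- For ε = ±1 one of the factors 1 ± ε kills half of the sums in `bracket_moment_moment_aux`.
Shifting the index in one of the two surviving sums (`s1` for ε = 1, `s2` for ε = -1) gives a common
shape. The terms with zeroth moments and the boundary terms of the shift assemble into `cornerU`. -/
theorem bracket_moment_moment (hε : ε = 1 ∨ ε = -1) {a b : S} {n : ℕ} (h : t b = t a + n • σ)
    (l : ℕ) (c d : S) :
    β (moment L V W n a b) (moment L V W l c d) =
      𝐡 * (𝐜 ε - 𝐜 (osgn a c)) * (moment L V W n c b * moment L V W l a d)
      - 𝐡 * (𝐜 ε + 𝐜 (osgn b d)) * (moment L V W n a d * moment L V W l c b)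
      + 𝐜 ε * ∑ j ∈ Finset.range l, (moment L V W (n + 1 + j) c b * moment L V W (l - 1 - j) a d
        - moment L V W j c b * moment L V W (n + l - j) a d)
      + moment L V W (n + l) c b * cornerU L V W ε a d
      - cornerU L V W ε c b * moment L V W (n + l) a d
      + 𝐡 * 𝐜 (cartan a b c d) * (moment L V W n a b * moment L V W l c d) := by
  have h2 := two_mul_half (A := A)
  have s1 := Finset.sum_range_succ (fun u => moment L V W u c b * moment L V W (n + l - u) a d) l
  rw [Finset.sum_range_succ'] at s1
  have s2 := Finset.sum_range_succ
    (fun p => moment L V W (n + p) c b * moment L V W (l - p) a d) l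
  rw [Finset.sum_range_succ'] at s2
  have e1 : ∀ p ∈ Finset.range l, moment L V W (n + (p + 1)) c b * moment L V W (l - (p + 1)) a d =
      moment L V W (n + 1 + p) c b * moment L V W (l - 1 - p) a d := by
    intro p _
    rw [show n + (p + 1) = n + 1 + p by omega, show l - (p + 1) = l - 1 - p by omega]
  have e2 : ∀ p ∈ Finset.range l, moment L V W (p + 1) c b * moment L V W (n + l - (p + 1)) a d =
      moment L V W (p + 1) c b * moment L V W (n + (l - 1 - p)) a d := by
    intro p hp
    rw [Finset.mem_range] at hp
    rw [show n + l - (p + 1) = n + (l - 1 - p) by omega]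
  rw [Finset.sum_congr rfl e1] at s2
  rw [Finset.sum_congr rfl e2] at s1
  have e3 : ∀ p ∈ Finset.range l, -𝐡 *
        ((1 - 𝐜 ε) * (moment L V W (p + n) c b * moment L V W (l - p) a d)
        - (1 + 𝐜 ε) * (moment L V W (n + 1 + p) c b * moment L V W (l - 1 - p) a d)
        + (1 + 𝐜 ε) * (moment L V W (p + 1) c b * moment L V W (n + (l - 1 - p)) a d)
        - (1 - 𝐜 ε) * (moment L V W p c b * moment L V W (n + l - p) a d)) =
      -𝐡 * (1 - 𝐜 ε) * (moment L V W (n + p) c b * moment L V W (l - p) a d)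
      + 𝐡 * (1 + 𝐜 ε) * (moment L V W (n + 1 + p) c b * moment L V W (l - 1 - p) a d)
      - 𝐡 * (1 + 𝐜 ε) * (moment L V W (p + 1) c b * moment L V W (n + (l - 1 - p)) a d)
      + 𝐡 * (1 - 𝐜 ε) * (moment L V W p c b * moment L V W (n + l - p) a d) := by
    intro p _
    rw [add_comm p n]
    ring
  rw [H.bracket_moment_moment_aux h, Finset.sum_congr rfl e3, Finset.sum_add_distrib,
    Finset.sum_sub_distrib, Finset.sum_add_distrib, Finset.sum_sub_distrib, ← Finset.mul_sum,
    ← Finset.mul_sum, ← Finset.mul_sum, ← Finset.mul_sum]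
  generalize (∑ p ∈ Finset.range l, moment L V W (n + p) c b * moment L V W (l - p) a d) = R0 at *
  generalize (∑ p ∈ Finset.range l,
    moment L V W (n + 1 + p) c b * moment L V W (l - 1 - p) a d) = R1 at *
  generalize (∑ p ∈ Finset.range l,
    moment L V W (p + 1) c b * moment L V W (n + (l - 1 - p)) a d) = S1 at *
  generalize (∑ p ∈ Finset.range l, moment L V W p c b * moment L V W (n + l - p) a d) = S0 at *
  simp only [Nat.sub_zero, add_zero, Nat.sub_self, Nat.add_sub_cancel] at s1 s2
  simp only [cartan, cornerU, map_add, map_sub, map_neg]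
  rcases hε with rfl | rfl
  · simp only [map_one, map_neg]
    linear_combination (-2 * 𝐡) * s1 + (R1 - S0) * h2
  · simp only [map_one, map_neg]
    linear_combination (2 * 𝐡) * s2 + (S0 - R1) * h2

end IsLaxSystem

end Lax

end CyclicQuiver

end

noncomputable section

namespace CyclicQuiver

open Matrix

/-! ### Traces of powers of the Lax matrix -/

section LaxTrace

variable {A : Type*} [CommRing A] [Algebra ℂ A] {G I S : Type*} [AddCommGroup G] [Fintype G]
  [DecidableEq G] [Fintype I] [DecidableEq I] [Fintype S] [LinearOrder S]

local notation "𝐜" => algebraMap ℂ A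
local notation "𝐡" => algebraMap ℂ A (1 / 2)

theorem derivation_trace_pow (D : Derivation ℂ A A) (M : Matrix I I A) (n : ℕ) :
    D (M ^ n).trace = n * ∑ i, ∑ j, (M ^ (n - 1)) j i * D (M i j) := by
  have h1 : D (M ^ n).trace = ((M ^ n).map D).trace := by
    simp [trace, map_sum]
  rw [h1, map_derivation_pow, trace_sum]
  have h2 : ∀ p ∈ Finset.range n, (M ^ p * M.map D * M ^ (n - 1 - p)).trace =
      ∑ i, ∑ j, (M ^ (n - 1)) j i * D (M i j) := by
    intro p hp
    rw [Finset.mem_range] at hp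
    rw [trace_mul_cycle, ← pow_add, show n - 1 - p + p = n - 1 by omega, trace_mul_comm, trace]
    refine Finset.sum_congr rfl fun i _ => ?_
    rw [diag_apply, mul_apply]
    exact Finset.sum_congr rfl fun j _ => by rw [map_apply, mul_comm]
  rw [Finset.sum_congr rfl h2, Finset.sum_const, Finset.card_range, nsmul_eq_mul]

namespace IsLaxSystem

variable {f : I → G} {t : S → G} {β : A → Derivation ℂ A A} {L : Matrix I I A} {V : Matrix S I A}
  {W : Matrix I S A} {σ : G} {ε : ℂ} (H : IsLaxSystem f t β L V W σ ε)

include H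

theorem bracket_trace_pow (n : ℕ) (F : A) :
    β (L ^ n).trace F = n * ∑ i, ∑ j, (L ^ (n - 1)) j i * β (L i j) F := by
  rw [H.skew, derivation_trace_pow, ← mul_neg, ← Finset.sum_neg_distrib]
  congr 1
  refine Finset.sum_congr rfl fun i _ => ?_
  rw [← Finset.sum_neg_distrib]
  refine Finset.sum_congr rfl fun j _ => ?_
  rw [H.skew F, mul_neg, neg_neg]

/-- For P = L^n both L P and P L equal L^{n+1}. If this power has degree 0, its diagonal blocks sum
to it and it commutes with L; otherwise its diagonal blocks are zero. -/
theorem bracket_trace_pow_L (n : ℕ) (k l : I) : β (L ^ n).trace (L k l) = 0 := by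
  rw [H.bracket_trace_pow]
  rcases n with _ | n
  · simp
  rw [Nat.add_sub_cancel, H.LL, ← pow_succ, ← pow_succ']
  have : ∑ r, (L * (proj A f r * L ^ (n + 1) * proj A f r) -
      proj A f r * L ^ (n + 1) * proj A f r * L) = 0 := by
    by_cases hσ : (n + 1) • σ = 0
    · rw [Finset.sum_sub_distrib, ← Finset.mul_sum, ← Finset.sum_mul,
        sum_proj_mul_mul_proj (hσ ▸ H.gradedL.pow (n + 1)), ← pow_succ, ← pow_succ', sub_self]
    · refine Finset.sum_eq_zero fun r _ => ?_
      have : proj A f r * L ^ (n + 1) * proj A f r = 0 := by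
        ext i j
        rw [mul_proj_apply, proj_mul_apply, Matrix.zero_apply]
        split_ifs with h1 h2
        · rw [H.gradedL.pow (n + 1) i j]
          rw [h1, h2]
          simpa using hσ
        · rfl
        · rfl
      rw [this, Matrix.mul_zero, Matrix.zero_mul, sub_zero]
  rw [this, Matrix.zero_apply, mul_zero, mul_zero]

/-- Contracted with a power of L, both terms of `LV` become the same projected row V_a L^{n+1}. -/
theorem bracket_trace_pow_V (n : ℕ) (a : S) (l : I) : β (L ^ n).trace (V a l) = 0 := by
  rw [H.bracket_trace_pow]
  rcases n with _ | n
  · simp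
  have h1 : (V * L ^ (n + 1) * proj A f (t a)) a l =
      ∑ i, ∑ j, (L ^ n) j i * ((V * L) a j * proj A f (t a) i l) := by
    rw [pow_succ', ← Matrix.mul_assoc, mul_apply]
    refine Finset.sum_congr rfl fun i _ => ?_
    rw [mul_apply, Finset.sum_mul]
    exact Finset.sum_congr rfl fun j _ => by ring
  have h2 : (V * L ^ (n + 1) * proj A f (t a)) a l =
      ∑ i, ∑ j, (L ^ n) j i * (V a j * (L * proj A f (t a)) i l) := by
    rw [pow_succ, ← Matrix.mul_assoc, Matrix.mul_assoc (V * L ^ n), mul_apply]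
    refine Finset.sum_congr rfl fun i _ => ?_
    rw [mul_apply, Finset.sum_mul]
    exact Finset.sum_congr rfl fun j _ => by ring
  have h3 : ∑ i, ∑ j, (L ^ n) j i * β (L i j) (V a l) = 0 := by
    simp only [H.LV, mul_left_comm _ 𝐡, mul_sub, Finset.sum_sub_distrib, ← Finset.mul_sum]
    rw [← h1, ← h2, sub_self]
  rw [Nat.add_sub_cancel, h3, mul_zero]

theorem bracket_trace_pow_W (n : ℕ) (k : I) (d : S) : β (L ^ n).trace (W k d) = 0 := by
  rw [H.bracket_trace_pow]
  rcases n with _ | n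
  · simp
  have h1 : (proj A f (t d) * L ^ (n + 1) * W) k d =
      ∑ i, ∑ j, (L ^ n) j i * (proj A f (t d) k j * (L * W) i d) := by
    rw [pow_succ, ← Matrix.mul_assoc, Matrix.mul_assoc _ L W, mul_apply]
    refine Finset.sum_congr rfl fun i _ => ?_
    rw [mul_apply, Finset.sum_mul]
    exact Finset.sum_congr rfl fun j _ => by ring
  have h2 : (proj A f (t d) * L ^ (n + 1) * W) k d =
      ∑ i, ∑ j, (L ^ n) j i * ((proj A f (t d) * L) k j * W i d) := by
    rw [pow_succ', ← Matrix.mul_assoc, mul_apply]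
    refine Finset.sum_congr rfl fun i _ => ?_
    rw [mul_apply, Finset.sum_mul]
    exact Finset.sum_congr rfl fun j _ => by ring
  have h3 : ∑ i, ∑ j, (L ^ n) j i * β (L i j) (W k d) = 0 := by
    simp only [H.LW, mul_left_comm _ 𝐡, mul_sub, Finset.sum_sub_distrib, ← Finset.mul_sum]
    rw [← h1, ← h2, sub_self]
  rw [Nat.add_sub_cancel, h3, mul_zero]

theorem bracket_trace_pow_moment (n k : ℕ) (a b : S) :
    β (L ^ n).trace (moment L V W k a b) = 0 := by
  have hL : L.map (β (L ^ n).trace) = 0 := by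
    ext i j
    exact H.bracket_trace_pow_L n i j
  have hV : V.map (β (L ^ n).trace) = 0 := by
    ext i j
    exact H.bracket_trace_pow_V n i j
  have hW : W.map (β (L ^ n).trace) = 0 := by
    ext i j
    exact H.bracket_trace_pow_W n i j
  rw [H.bracket_moment, hL, hV, hW]
  simp

theorem bracket_trace_pow_trace_pow (n k : ℕ) : β (L ^ n).trace (L ^ k).trace = 0 := by
  rw [derivation_trace_pow]
  simp only [H.bracket_trace_pow_L, mul_zero, Finset.sum_const_zero]

end IsLaxSystem

end LaxTrace

end CyclicQuiver

end

noncomputable section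

namespace CyclicQuiver

open Matrix

/-! ### The zeroth moments -/

section Corner

theorem kd_of_lt {S : Type*} [LinearOrder S] {a b : S} (h : a < b) : kd a b = 0 :=
  kd_of_ne h.ne

theorem kd_of_gt {S : Type*} [LinearOrder S] {a b : S} (h : b < a) : kd a b = 0 :=
  kd_of_ne h.ne'

variable {A : Type*} [CommRing A] [Algebra ℂ A] {S : Type*} [LinearOrder S]

local notation "𝐜" => algebraMap ℂ A
local notation "𝐡" => algebraMap ℂ A (1 / 2)

/-- The linear coefficient of `corner`. -/
def cornerCoeff (ε : ℂ) (a b : S) : ℂ := (kd a b + osgn a b - ε) / 2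

/-- A triangular part of a matrix `x`, up to signs and constants. -/
def corner (ε : ℂ) (x : S → S → A) (a b : S) : A :=
  𝐜 (kd a b) + 𝐜 (cornerCoeff ε a b) * x a b

-- The left side is the bracket of a moment with `corner`, taken from `bracket_moment_moment` at l =
-- 0; the right side is the Sklyanin relation with the second point at infinity. The coefficients
-- depend only on the relative order of the indices, so finitely many polynomial identities are to
-- be checked.
set_option maxHeartbeats 4000000 in
theorem corner_bracket_right {ε : ℂ} (hε : ε = 1 ∨ ε = -1) (x y : S → S → A) (a b c d : S) :
    𝐜 (cornerCoeff ε c d) * (𝐡 * (𝐜 ε - 𝐜 (osgn a c)) * (y c b * x a d)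
      - 𝐡 * (𝐜 ε + 𝐜 (osgn b d)) * (y a d * x c b)
      + y c b * corner ε x a d - corner ε x c b * y a d
      + 𝐡 * 𝐜 (cartan a b c d) * (y a b * x c d)) =
    𝐜 ((-ε - osgn a c) / 2) * (y c b * corner ε x a d)
      - 𝐜 ((-ε + osgn b d) / 2) * (y a d * corner ε x c b)
      + 𝐜 (cartan a b c d / 2) * (y a b * corner ε x c d) := by
  simp only [corner, cornerCoeff, cartan]
  rcases lt_trichotomy a c with h1 | h1 | h1 <;> rcases lt_trichotomy a d with h2 | h2 | h2 <;>
    rcases lt_trichotomy c d with h3 | h3 | h3 <;> (try (exfalso; order)) <;>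
    rcases lt_trichotomy b d with h4 | h4 | h4 <;> rcases lt_trichotomy c b with h5 | h5 | h5 <;>
    (try (exfalso; order)) <;> subst_vars <;>
    simp only [osgn_self, osgn_of_lt, osgn_of_gt, kd_self, kd_of_lt, kd_of_gt, *] <;>
    rcases hε with rfl | rfl <;> algebra

-- The same verification with both points at infinity. The spectral terms with ε have no counterpart
-- on the right because they cancel there.
set_option maxHeartbeats 4000000 in
theorem corner_bracket_corner {ε : ℂ} (hε : ε = 1 ∨ ε = -1) (x : S → S → A) (a b c d : S) :
    𝐜 (cornerCoeff ε a b) * (𝐜 ((-ε - osgn a c) / 2) * (x c b * corner ε x a d)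
      - 𝐜 ((-ε + osgn b d) / 2) * (x a d * corner ε x c b)
      + 𝐜 (cartan a b c d / 2) * (x a b * corner ε x c d)) =
    𝐜 (-osgn a c / 2) * (corner ε x c b * corner ε x a d)
      - 𝐜 (osgn b d / 2) * (corner ε x a d * corner ε x c b)
      + 𝐜 (cartan a b c d / 2) * (corner ε x a b * corner ε x c d) := by
  simp only [corner, cornerCoeff, cartan]
  rcases lt_trichotomy a c with h1 | h1 | h1 <;> rcases lt_trichotomy a d with h2 | h2 | h2 <;>
    rcases lt_trichotomy c d with h3 | h3 | h3 <;> (try (exfalso; order)) <;>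
    rcases lt_trichotomy b d with h4 | h4 | h4 <;> rcases lt_trichotomy c b with h5 | h5 | h5 <;>
    (try (exfalso; order)) <;> rcases lt_trichotomy a b with h6 | h6 | h6 <;>
    (try (exfalso; order)) <;> subst_vars <;>
    simp only [osgn_self, osgn_of_lt, osgn_of_gt, kd_self, kd_of_lt, kd_of_gt, *] <;>
    rcases hε with rfl | rfl <;> algebra

end Corner

end CyclicQuiver

end

noncomputable section

namespace CyclicQuiver

open Matrix

/-! ### The Poisson algebra of moments -/

section LaxJacobi

variable {A : Type*} [CommRing A] [Algebra ℂ A] {G I S : Type*} [AddCommGroup G] [Fintype G]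
  [DecidableEq G] [Fintype I] [DecidableEq I] [Fintype S] [LinearOrder S]

local notation "𝐜" => algebraMap ℂ A
local notation "𝐡" => algebraMap ℂ A (1 / 2)

theorem cartan_swap (a b c d : S) : cartan c d a b = -cartan a b c d := by
  rw [cartan, cartan, osgn_antisymm c a, osgn_antisymm d b]
  ring

/-- Degrees add up: if both factors were nonzero, the degree of (a, b) would force degree l on (c,
d). Hence the exchange terms of a bracket vanish together with a generator of the wrong degree. -/
theorem IsGraded.cross_mul {t : S → G} {σ : G} {P Q : Matrix S S A} {n l i j : ℕ}
    (hP : IsGraded t t (i • σ) P) (hQ : IsGraded t t (j • σ) Q) {a b c d : S}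
    (hab : t b = t a + n • σ) (hcd : t d ≠ t c + l • σ) (hij : i + j = n + l) :
    P c b * Q a d = 0 := by
  by_cases h1 : t b = t c + i • σ
  · by_cases h2 : t d = t a + j • σ
    · exfalso
      apply hcd
      have : t c + (i + j) • σ = t d + n • σ := by
        rw [add_nsmul, ← add_assoc, ← h1, hab, h2]
        abel
      rw [hij, add_nsmul, add_comm (n • σ), ← add_assoc] at this
      exact (add_right_cancel this).symm
    · rw [hQ a d h2, mul_zero]
  · rw [hP c b h1, zero_mul]

/-- The degree condition for the function of a generator not to vanish trivially. -/
def Admissible (t : S → G) (σ : G) (u : S × S × Option ℕ) : Prop :=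
  t u.2.1 = t u.1 + (u.2.2.getD 0) • σ

namespace IsLaxSystem

theorem cornerU_eq (ε : ℂ) (L : Matrix I I A) (V : Matrix S I A) (W : Matrix I S A) (a b : S) :
    cornerU L V W ε a b = corner ε (fun i j => moment L V W 0 i j) a b := by
  simp only [cornerU, corner, cornerCoeff]
  algebra

/-- The function `T_{ab}^0`: the triangular part of the zeroth moments opposite to `cornerU`. -/
def cornerT (L : Matrix I I A) (V : Matrix S I A) (W : Matrix I S A) (ε : ℂ) : Matrix S S A :=
  fun a b => moment L V W 0 a b + 𝐜 ε * cornerU L V W ε a b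

variable {f : I → G} {t : S → G} {β : A → Derivation ℂ A A} {L : Matrix I I A} {V : Matrix S I A}
  {W : Matrix I S A} {σ : G} {ε : ℂ} (H : IsLaxSystem f t β L V W σ ε)

include H

theorem graded_cornerU : IsGraded t t (0 • σ) (cornerU L V W ε) := by
  intro a b hab
  have : a ≠ b := by
    rintro rfl
    simp at hab
  rw [cornerU, kd_of_ne this, H.graded_moment 0 a b hab]
  simp

theorem graded_cornerT : IsGraded t t (0 • σ) (cornerT L V W ε) := by
  intro a b hab
  rw [cornerT, H.graded_cornerU a b hab, H.graded_moment 0 a b hab]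
  simp

theorem bracket_add_left (F F' G : A) : β (F + F') G = β F G + β F' G := by
  rw [H.skew, map_add, H.skew G F, H.skew G F', neg_add, neg_neg, neg_neg]

theorem bracket_const_mul_left (r : ℂ) (F G : A) : β (𝐜 r * F) G = 𝐜 r * β F G := by
  rw [H.skew, Derivation.leibniz, Derivation.map_algebraMap, smul_zero, add_zero, smul_eq_mul,
    H.skew F, mul_neg]

omit H in
theorem bracket_const_mul_right (r : ℂ) (F G : A) : β F (𝐜 r * G) = 𝐜 r * β F G := by
  rw [Derivation.leibniz, Derivation.map_algebraMap, smul_zero, add_zero, smul_eq_mul]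

theorem bracket_cornerU_left (a b : S) (F : A) :
    β (cornerU L V W ε a b) F = 𝐜 (cornerCoeff ε a b) * β (moment L V W 0 a b) F := by
  rw [cornerU_eq]
  simp only [corner]
  rw [H.bracket_add_left, H.bracket_const_mul_left, H.skew (𝐜 _),
    Derivation.map_algebraMap, neg_zero, zero_add]

omit H in
theorem bracket_cornerU_right (a b : S) (F : A) :
    β F (cornerU L V W ε a b) = 𝐜 (cornerCoeff ε a b) * β F (moment L V W 0 a b) := by
  rw [cornerU_eq]
  simp only [corner]
  rw [map_add, bracket_const_mul_right, Derivation.map_algebraMap, zero_add]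

/-- Exchanging the arguments replaces θ by -θ. The known formula applies only if (c, d) has the
right degree; if not, P c d is zero and the exchange terms vanish by `cross_mul`. -/
theorem bracket_swap {P Q : Matrix S S A} {n l : ℕ} (hP : IsGraded t t (n • σ) P)
    (hQ : IsGraded t t (l • σ) Q) {θ : ℂ}
    (hPQ : ∀ c d a b : S, t d = t c + n • σ → β (P c d) (Q a b) =
      𝐜 ((θ - osgn c a) / 2) * (P a d * Q c b) - 𝐜 ((θ + osgn d b) / 2) * (P c b * Q a d)
        + 𝐜 (cartan c d a b / 2) * (P c d * Q a b)) {a b : S} (h : t b = t a + l • σ) (c d : S) :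
    β (Q a b) (P c d) =
      𝐜 ((-θ - osgn a c) / 2) * (Q c b * P a d) - 𝐜 ((-θ + osgn b d) / 2) * (Q a d * P c b)
        + 𝐜 (cartan a b c d / 2) * (Q a b * P c d) := by
  by_cases hcd : t d = t c + n • σ
  · rw [H.skew, hPQ c d a b hcd, cartan_swap a b c d, osgn_antisymm c a, osgn_antisymm d b]
    algebra
  · rw [hP c d hcd, mul_comm (Q a d), hQ.cross_mul hP h hcd rfl, hP.cross_mul hQ h hcd (add_comm _ _)]
    simp

theorem bracket_moment_cornerU (hε : ε = 1 ∨ ε = -1) {a b : S} {n : ℕ} (h : t b = t a + n • σ)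
    (c d : S) : β (moment L V W n a b) (cornerU L V W ε c d) =
      𝐜 ((-ε - osgn a c) / 2) * (moment L V W n c b * cornerU L V W ε a d)
        - 𝐜 ((-ε + osgn b d) / 2) * (moment L V W n a d * cornerU L V W ε c b)
        + 𝐜 (cartan a b c d / 2) * (moment L V W n a b * cornerU L V W ε c d) := by
  rw [bracket_cornerU_right, H.bracket_moment_moment hε h]
  rw [Finset.range_zero, Finset.sum_empty, mul_zero, add_zero, add_zero]
  simp only [cornerU_eq]
  exact corner_bracket_right hε (fun i j => moment L V W 0 i j) (fun i j => moment L V W n i j)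
    a b c d

/-- Adding ε times the relation with U to the bracket with the zeroth moment turns the coefficient
-ε into ε: `cornerT` behaves like the value of T(x) at x = 0, where θ = 1. -/
theorem bracket_moment_cornerT (hε : ε = 1 ∨ ε = -1) {a b : S} {n : ℕ} (h : t b = t a + n • σ)
    (c d : S) : β (moment L V W n a b) (cornerT L V W ε c d) =
      𝐜 ((ε - osgn a c) / 2) * (moment L V W n c b * cornerT L V W ε a d)
        - 𝐜 ((ε + osgn b d) / 2) * (moment L V W n a d * cornerT L V W ε c b)
        + 𝐜 (cartan a b c d / 2) * (moment L V W n a b * cornerT L V W ε c d) := by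
  rw [cornerT, map_add, bracket_const_mul_right, H.bracket_moment_cornerU hε h,
    H.bracket_moment_moment hε h, Finset.range_zero, Finset.sum_empty]
  simp only [add_zero, cornerT]
  rcases hε with rfl | rfl <;> algebra

theorem bracket_cornerU_cornerU (hε : ε = 1 ∨ ε = -1) {a b : S} (h : t b = t a) (c d : S) :
    β (cornerU L V W ε a b) (cornerU L V W ε c d) =
      𝐜 (-osgn a c / 2) * (cornerU L V W ε c b * cornerU L V W ε a d)
        - 𝐜 (osgn b d / 2) * (cornerU L V W ε a d * cornerU L V W ε c b)
        + 𝐜 (cartan a b c d / 2) * (cornerU L V W ε a b * cornerU L V W ε c d) := by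
  rw [bracket_cornerU_left H, H.bracket_moment_cornerU hε (n := 0) (by simpa using h)]
  simp only [cornerU_eq]
  exact corner_bracket_corner hε (fun i j => moment L V W 0 i j) a b c d

theorem bracket_cornerT_cornerU (hε : ε = 1 ∨ ε = -1) {a b : S} (h : t b = t a) (c d : S) :
    β (cornerT L V W ε a b) (cornerU L V W ε c d) =
      𝐜 ((-ε - osgn a c) / 2) * (cornerT L V W ε c b * cornerU L V W ε a d)
        - 𝐜 ((-ε + osgn b d) / 2) * (cornerT L V W ε a d * cornerU L V W ε c b)
        + 𝐜 (cartan a b c d / 2) * (cornerT L V W ε a b * cornerU L V W ε c d) := by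
  rw [cornerT, H.bracket_add_left, H.bracket_const_mul_left, H.bracket_cornerU_cornerU hε h,
    H.bracket_moment_cornerU hε (n := 0) (by simpa using h)]
  simp only [cornerT]
  rcases hε with rfl | rfl <;> algebra

theorem bracket_cornerT_cornerT (hε : ε = 1 ∨ ε = -1) {a b : S} (h : t b = t a) (c d : S) :
    β (cornerT L V W ε a b) (cornerT L V W ε c d) =
      𝐜 ((ε - osgn a c) / 2) * (cornerT L V W ε c b * cornerT L V W ε a d)
        - 𝐜 ((ε + osgn b d) / 2) * (cornerT L V W ε a d * cornerT L V W ε c b)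
        + 𝐜 (cartan a b c d / 2) * (cornerT L V W ε a b * cornerT L V W ε c d) := by
  -- The second argument is split as zeroth moment plus ε `cornerU`; the bracket with each summand
  -- is already known.
  have h1 := H.bracket_swap (H.graded_moment 0) H.graded_cornerT
    (fun c d a b h => H.bracket_moment_cornerT hε h a b) (by simpa using h) c d
  have h2 := H.bracket_cornerT_cornerU hε h c d
  have h3 : cornerT L V W ε c d = moment L V W 0 c d + 𝐜 ε * cornerU L V W ε c d := rfl
  rw [h3, map_add, bracket_const_mul_right, h1, h2]
  simp only [cornerT]
  rcases hε with rfl | rfl <;> algebra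

theorem bracket_cornerU_cornerT (hε : ε = 1 ∨ ε = -1) {a b : S} (h : t b = t a) (c d : S) :
    β (cornerU L V W ε a b) (cornerT L V W ε c d) =
      𝐜 ((ε - osgn a c) / 2) * (cornerU L V W ε c b * cornerT L V W ε a d)
        - 𝐜 ((ε + osgn b d) / 2) * (cornerU L V W ε a d * cornerT L V W ε c b)
        + 𝐜 (cartan a b c d / 2) * (cornerU L V W ε a b * cornerT L V W ε c d) := by
  simpa using H.bracket_swap H.graded_cornerT H.graded_cornerU
    (fun c d a b h => H.bracket_cornerT_cornerU hε (by simpa using h) a b)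
    (by simpa using h) c d

theorem bracket_cornerU_moment (hε : ε = 1 ∨ ε = -1) {a b : S} (h : t b = t a) (l : ℕ) (c d : S) :
    β (cornerU L V W ε a b) (moment L V W l c d) =
      𝐜 ((ε - osgn a c) / 2) * (cornerU L V W ε c b * moment L V W l a d)
        - 𝐜 ((ε + osgn b d) / 2) * (cornerU L V W ε a d * moment L V W l c b)
        + 𝐜 (cartan a b c d / 2) * (cornerU L V W ε a b * moment L V W l c d) := by
  simpa using H.bracket_swap (H.graded_moment l) H.graded_cornerU
    (fun c d a b h => H.bracket_moment_cornerU hε h a b)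
    (by simpa using h) c d

theorem bracket_cornerT_moment (hε : ε = 1 ∨ ε = -1) {a b : S} (h : t b = t a) (l : ℕ) (c d : S) :
    β (cornerT L V W ε a b) (moment L V W l c d) =
      𝐜 ((-ε - osgn a c) / 2) * (cornerT L V W ε c b * moment L V W l a d)
        - 𝐜 ((-ε + osgn b d) / 2) * (cornerT L V W ε a d * moment L V W l c b)
        + 𝐜 (cartan a b c d / 2) * (cornerT L V W ε a b * moment L V W l c d) :=
  H.bracket_swap (H.graded_moment l) H.graded_cornerT
    (fun c d a b h => H.bracket_moment_cornerT hε h a b) (by simpa using h) c d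

variable (L V W ε) in
omit H in
/-- The images of the generators of the free algebra. -/
def genImage : S × S × Option ℕ → A
  | (a, b, some 0) => cornerT L V W ε a b
  | (a, b, some (k + 1)) => moment L V W (k + 1) a b
  | (a, b, none) => cornerU L V W ε a b

variable (L V W ε) in
omit H in
/-- The morphism from the free algebra to functions. -/
def freeMap : Free S →ₐ[ℂ] A := MvPolynomial.aeval (genImage L V W ε)

omit H in
theorem freeMap_X (u : S × S × Option ℕ) :
    freeMap L V W ε (MvPolynomial.X u) = genImage L V W ε u :=
  MvPolynomial.aeval_X _ _

omit H in
theorem freeMap_genU (a b : S) : freeMap L V W ε (genU a b) = cornerU L V W ε a b :=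
  freeMap_X _

omit H in
theorem freeMap_genT_zero (a b : S) : freeMap L V W ε (genT a b 0) = cornerT L V W ε a b :=
  freeMap_X _

omit H in
theorem freeMap_genT_succ (a b : S) (k : ℕ) :
    freeMap L V W ε (genT a b (k + 1)) = moment L V W (k + 1) a b :=
  freeMap_X _

omit H in
theorem freeMap_genT (a b : S) (k : ℕ) : freeMap L V W ε (genT a b k) =
    moment L V W k a b + if k = 0 then 𝐜 ε * cornerU L V W ε a b else 0 := by
  rcases k with _ | k
  · rw [freeMap_genT_zero, if_pos rfl, cornerT]
  · rw [freeMap_genT_succ, if_neg (Nat.succ_ne_zero k), add_zero]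

omit H in
theorem freeMap_sum_zero (a b c d : S) (l : ℕ) :
    freeMap L V W ε (∑ j ∈ Finset.range (l + 1),
      (genT c b (1 + j) * genT a d (l + 1 - 1 - j) - genT c b j * genT a d (l + 1 - j))) =
    moment L V W (l + 1) c b * cornerT L V W ε a d -
      cornerT L V W ε c b * moment L V W (l + 1) a d := by
  have h := Finset.sum_range_sub (fun j => (genT c b j : Free S) * genT a d (l + 1 - j)) (l + 1)
  have e : ∀ j ∈ Finset.range (l + 1),
      (genT c b (1 + j) * genT a d (l + 1 - 1 - j) - genT c b j * genT a d (l + 1 - j)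
        : Free S) = genT c b (j + 1) * genT a d (l + 1 - (j + 1)) -
          genT c b j * genT a d (l + 1 - j) := by
    intro j _
    rw [add_comm 1 j, show l + 1 - 1 - j = l + 1 - (j + 1) by omega]
  rw [Finset.sum_congr rfl e, h, Nat.sub_self, Nat.sub_zero, map_sub, map_mul, map_mul,
    freeMap_genT_zero, freeMap_genT_zero, freeMap_genT_succ, freeMap_genT_succ]

-- T^0 enters only for j = l in the first product and for j = 0 in the second. Replacing it there by
-- the zeroth moment plus εU produces the extra terms which, as ε² = 1, are the terms with `cornerU`
-- in `bracket_moment_moment`.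
omit H in
theorem freeMap_sum_succ (a b c d : S) (k l : ℕ) :
    freeMap L V W ε (∑ j ∈ Finset.range (l + 1), (genT c b (k + 1 + 1 + j) *
      genT a d (l + 1 - 1 - j) - genT c b j * genT a d (k + 1 + (l + 1) - j))) =
    ∑ j ∈ Finset.range (l + 1), (moment L V W (k + 1 + 1 + j) c b * moment L V W (l + 1 - 1 - j) a d
        - moment L V W j c b * moment L V W (k + 1 + (l + 1) - j) a d)
      + 𝐜 ε * (moment L V W (k + 1 + (l + 1)) c b * cornerU L V W ε a d
        - cornerU L V W ε c b * moment L V W (k + 1 + (l + 1)) a d) := by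
  have e : ∀ j ∈ Finset.range (l + 1), freeMap L V W ε (genT c b (k + 1 + 1 + j) *
      genT a d (l + 1 - 1 - j) - genT c b j * genT a d (k + 1 + (l + 1) - j)) =
      (moment L V W (k + 1 + 1 + j) c b * moment L V W (l + 1 - 1 - j) a d
        - moment L V W j c b * moment L V W (k + 1 + (l + 1) - j) a d)
      + ((if j = l then moment L V W (k + 1 + 1 + j) c b * (𝐜 ε * cornerU L V W ε a d) else 0)
        - (if j = 0 then 𝐜 ε * cornerU L V W ε c b * moment L V W (k + 1 + (l + 1) - j) a d
          else 0)) := by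
    intro j hj
    rw [Finset.mem_range] at hj
    rw [map_sub, map_mul, map_mul, freeMap_genT, freeMap_genT, freeMap_genT, freeMap_genT,
      if_neg (show k + 1 + 1 + j ≠ 0 by omega), if_neg (show k + 1 + (l + 1) - j ≠ 0 by omega)]
    simp only [show l + 1 - 1 - j = 0 ↔ j = l by omega]
    split_ifs <;> ring
  rw [map_sum, Finset.sum_congr rfl e, Finset.sum_add_distrib]
  congr 1
  rw [Finset.sum_sub_distrib, Finset.sum_ite_eq', Finset.sum_ite_eq', if_pos (by simp), if_pos (by simp),
    show k + 1 + 1 + l = k + 1 + (l + 1) by omega, Nat.sub_zero]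
  ring

/-- The nine cases are the pairs among U, T^0 and higher moments. The degree condition is needed for
the first argument only, which lets the statement be iterated in `bracket_freeMap`. -/
theorem bracket_genImage (hε : ε = 1 ∨ ε = -1) {u : S × S × Option ℕ} (hu : Admissible t σ u)
    (v : S × S × Option ℕ) :
    β (genImage L V W ε u) (genImage L V W ε v) = freeMap L V W ε (genBracket ε u v) := by
  obtain ⟨a, b, k⟩ := u
  obtain ⟨c, d, l⟩ := v
  have alg : ∀ r : ℂ, freeMap L V W ε (algebraMap ℂ (Free S) r) = 𝐜 r :=
    fun r => AlgHom.commutes _ r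
  rcases k with _ | _ | k <;> rcases l with _ | _ | l <;>
    simp only [Admissible, Option.getD_none, Option.getD_some, zero_smul, add_zero] at hu <;>
    simp only [genBracket, genImage, map_add, map_sub, map_mul, alg, freeMap_genU,
      freeMap_genT_zero, freeMap_genT_succ, Finset.range_zero, Finset.sum_empty, map_zero, mul_zero,
      zero_add, add_zero]
  · exact H.bracket_cornerU_cornerU hε hu c d
  · exact H.bracket_cornerU_cornerT hε hu c d
  · exact H.bracket_cornerU_moment hε hu _ c d
  · exact H.bracket_cornerT_cornerU hε hu c d
  · exact H.bracket_cornerT_cornerT hε hu c d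
  · rw [H.bracket_cornerT_moment hε hu, freeMap_sum_zero]
    algebra
  · exact H.bracket_moment_cornerU hε hu c d
  · exact H.bracket_moment_cornerT hε hu c d
  · rw [H.bracket_moment_moment hε hu, freeMap_sum_succ]
    rcases hε with rfl | rfl <;> algebra

theorem bracket_freeMap (hε : ε = 1 ∨ ε = -1) {u : S × S × Option ℕ} (hu : Admissible t σ u)
    (F : Free S) :
    β (genImage L V W ε u) (freeMap L V W ε F) = freeMap L V W ε (genDer ε u F) := by
  induction F using MvPolynomial.induction_on with
  | C r =>
    rw [← MvPolynomial.algebraMap_eq, AlgHom.commutes, Derivation.map_algebraMap,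
      Derivation.map_algebraMap, map_zero]
  | add p q hp hq => rw [map_add, map_add, hp, hq, map_add, map_add]
  | mul_X p v hp =>
    rw [map_mul, Derivation.leibniz, Derivation.leibniz, smul_eq_mul, smul_eq_mul, smul_eq_mul,
      smul_eq_mul, map_add, map_mul, map_mul, hp, freeMap_X, genDer_X, H.bracket_genImage hε hu]

/-- A generator of the wrong degree has image zero. For three admissible ones the identity is the
image of `genDer_jacobi`. -/
theorem jacobi_genImage (hε : ε = 1 ∨ ε = -1) (u v w : S × S × Option ℕ) :
    β (genImage L V W ε u) (β (genImage L V W ε v) (genImage L V W ε w))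
      + β (genImage L V W ε v) (β (genImage L V W ε w) (genImage L V W ε u))
      + β (genImage L V W ε w) (β (genImage L V W ε u) (genImage L V W ε v)) = 0 := by
  have hz : ∀ F, β F 0 = 0 := fun F => map_zero _
  have hz' : ∀ F, β 0 F = 0 := fun F => by rw [H.skew, hz, neg_zero]
  have vanish : ∀ u, ¬ Admissible t σ u → genImage L V W ε u = 0 := by
    rintro ⟨a, b, _ | _ | k⟩ hu
    · exact H.graded_cornerU a b hu
    · exact H.graded_cornerT a b hu
    · exact H.graded_moment (k + 1) a b hu
  by_cases hu : Admissible t σ u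
  · by_cases hv : Admissible t σ v
    · by_cases hw : Admissible t σ w
      · rw [H.bracket_genImage hε hv, H.bracket_genImage hε hw, H.bracket_genImage hε hu,
          H.bracket_freeMap hε hu, H.bracket_freeMap hε hv, H.bracket_freeMap hε hw, ← map_add,
          ← map_add, genDer_jacobi, map_zero]
        rcases hε with rfl | rfl <;> norm_num
      · rw [vanish w hw]
        simp only [hz, hz', add_zero]
    · rw [vanish v hv]
      simp only [hz, hz', add_zero]
  · rw [vanish u hu]
    simp only [hz, hz', add_zero]

/-- Every moment is an affine function of one of the functions `genImage`. -/
theorem exists_genImage (hε : ε = 1 ∨ ε = -1) (k : ℕ) (a b : S) :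
    ∃ u, ∃ r s : ℂ, moment L V W k a b = 𝐜 r + 𝐜 s * genImage L V W ε u := by
  rcases k with _ | k
  · by_cases h : a ≤ b
    · rcases hε with rfl | rfl
      · refine ⟨(a, b, some 0), -kd a b, 1, ?_⟩
        simp only [genImage, cornerT, cornerU]
        rcases h.lt_or_eq with h | rfl
        · rw [osgn_of_lt h, kd_of_lt h]
          algebra
        · rw [osgn_self, kd_self]
          algebra
      · refine ⟨(a, b, none), -kd a b, 1, ?_⟩
        simp only [genImage, cornerU]
        rcases h.lt_or_eq with h | rfl
        · rw [osgn_of_lt h, kd_of_lt h]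
          algebra
        · rw [osgn_self, kd_self]
          algebra
    · have h := not_le.1 h
      rcases hε with rfl | rfl
      · refine ⟨(a, b, none), 0, -1, ?_⟩
        simp only [genImage, cornerU]
        rw [osgn_of_gt h, kd_of_gt h]
        algebra
      · refine ⟨(a, b, some 0), 0, 1, ?_⟩
        simp only [genImage, cornerT, cornerU]
        rw [osgn_of_gt h, kd_of_gt h]
        algebra
  · refine ⟨(a, b, some (k + 1)), 0, 1, ?_⟩
    simp [genImage]

theorem bracket_moment_moment_mem (hε : ε = 1 ∨ ε = -1) {B : Subalgebra ℂ A}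
    (hB : ∀ k a b, moment L V W k a b ∈ B) (k l : ℕ) (a b c d : S) :
    β (moment L V W k a b) (moment L V W l c d) ∈ B := by
  by_cases h : t b = t a + k • σ
  · have h1 : ∀ r, 𝐜 r ∈ B := B.algebraMap_mem
    have h2 : ∀ a b, cornerU L V W ε a b ∈ B := fun a b => B.add_mem (h1 _)
      (B.mul_mem (B.mul_mem (h1 _) (B.sub_mem (B.add_mem (h1 _) (h1 _)) (h1 _))) (hB _ _ _))
    have h3 : ∀ i j a b c d, moment L V W i a b * moment L V W j c d ∈ B :=
      fun _ _ _ _ _ _ => B.mul_mem (hB _ _ _) (hB _ _ _)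
    rw [H.bracket_moment_moment hε h]
    refine B.add_mem (B.sub_mem (B.add_mem (B.add_mem (B.sub_mem ?_ ?_) ?_) ?_) ?_) ?_
    · exact B.mul_mem (B.mul_mem (h1 _) (B.sub_mem (h1 _) (h1 _))) (h3 _ _ _ _ _ _)
    · exact B.mul_mem (B.mul_mem (h1 _) (B.add_mem (h1 _) (h1 _))) (h3 _ _ _ _ _ _)
    · exact B.mul_mem (h1 _) (B.sum_mem fun j _ => B.sub_mem (h3 _ _ _ _ _ _) (h3 _ _ _ _ _ _))
    · exact B.mul_mem (hB _ _ _) (h2 _ _)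
    · exact B.mul_mem (h2 _ _) (hB _ _ _)
    · exact B.mul_mem (B.mul_mem (h1 _) (h1 _)) (h3 _ _ _ _ _ _)
  · rw [H.graded_moment k a b h, H.skew, map_zero, neg_zero]
    exact B.zero_mem

/-- Constants have zero bracket with everything, so the Jacobiator of affine functions of the
`genImage` is a scalar multiple of the Jacobiator of these. -/
theorem jacobi_moment (hε : ε = 1 ∨ ε = -1) (k₁ k₂ k₃ : ℕ) (a₁ b₁ a₂ b₂ a₃ b₃ : S) :
    β (moment L V W k₁ a₁ b₁) (β (moment L V W k₂ a₂ b₂) (moment L V W k₃ a₃ b₃))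
      + β (moment L V W k₂ a₂ b₂) (β (moment L V W k₃ a₃ b₃) (moment L V W k₁ a₁ b₁))
      + β (moment L V W k₃ a₃ b₃) (β (moment L V W k₁ a₁ b₁) (moment L V W k₂ a₂ b₂)) = 0 := by
  obtain ⟨u₁, r₁, s₁, h₁⟩ := H.exists_genImage hε k₁ a₁ b₁
  obtain ⟨u₂, r₂, s₂, h₂⟩ := H.exists_genImage hε k₂ a₂ b₂
  obtain ⟨u₃, r₃, s₃, h₃⟩ := H.exists_genImage hε k₃ a₃ b₃
  have hc : ∀ r F, β (𝐜 r) F = 0 := fun r F => by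
    rw [H.skew, Derivation.map_algebraMap, neg_zero]
  have hc' : ∀ r F, β F (𝐜 r) = 0 := fun r F => Derivation.map_algebraMap _ _
  rw [h₁, h₂, h₃]
  simp only [H.bracket_add_left, map_add, hc, hc', zero_add, H.bracket_const_mul_left,
    bracket_const_mul_right]
  have := H.jacobi_genImage hε u₁ u₂ u₃
  linear_combination (𝐜 s₁ * 𝐜 s₂ * 𝐜 s₃) * this

end IsLaxSystem

end LaxJacobi

end CyclicQuiver

end

noncomputable section

namespace CyclicQuiver

open Matrix

/-! ### Poisson algebras generated by a set -/

section Adjoin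

variable {A : Type*} [CommRing A] [Algebra ℂ A] {β : A → Derivation ℂ A A}

/-- A derivation that sends generators into the subalgebra preserves it; this is used once in each
argument. -/
theorem bracket_mem_adjoin (skew : ∀ F G, β F G = -β G F) {s : Set A}
    (hs : ∀ F ∈ s, ∀ G ∈ s, β F G ∈ Algebra.adjoin ℂ s) {F G : A} (hF : F ∈ Algebra.adjoin ℂ s)
    (hG : G ∈ Algebra.adjoin ℂ s) : β F G ∈ Algebra.adjoin ℂ s := by
  have key : ∀ D : Derivation ℂ A A, (∀ G ∈ s, D G ∈ Algebra.adjoin ℂ s) →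
      ∀ G ∈ Algebra.adjoin ℂ s, D G ∈ Algebra.adjoin ℂ s := by
    intro D hD G hG
    induction hG using Algebra.adjoin_induction with
    | mem x hx => exact hD x hx
    | algebraMap r =>
      rw [Derivation.map_algebraMap]
      exact Subalgebra.zero_mem _
    | add x y _ _ hx hy =>
      rw [map_add]
      exact Subalgebra.add_mem _ hx hy
    | mul x y hx' hy' hx hy =>
      rw [Derivation.leibniz]
      exact Subalgebra.add_mem _ (Subalgebra.mul_mem _ hx' hy) (Subalgebra.mul_mem _ hy' hx)
  refine key _ (fun G hG => ?_) G hG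
  rw [skew]
  exact Subalgebra.neg_mem _ (key _ (fun F hF => hs G hG F hF) F hF)

theorem bracket_eq_zero_of_adjoin (skew : ∀ F G, β F G = -β G F) {s s' : Set A}
    (hs : ∀ F ∈ s, ∀ G ∈ s', β F G = 0) {F G : A} (hF : F ∈ Algebra.adjoin ℂ s)
    (hG : G ∈ Algebra.adjoin ℂ s') : β F G = 0 := by
  have key : ∀ (D : Derivation ℂ A A) (s : Set A), (∀ G ∈ s, D G = 0) →
      ∀ G ∈ Algebra.adjoin ℂ s, D G = 0 := by
    intro D s hD G hG
    induction hG using Algebra.adjoin_induction with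
    | mem x hx => exact hD x hx
    | algebraMap r => rw [Derivation.map_algebraMap]
    | add x y _ _ hx hy => rw [map_add, hx, hy, add_zero]
    | mul x y _ _ hx hy => rw [Derivation.leibniz, hx, hy, smul_zero, smul_zero, add_zero]
  refine key _ s' (fun G hG => ?_) G hG
  rw [skew, key _ s (fun F hF => by rw [skew, hs F hF G hG, neg_zero]) F hF, neg_zero]

/-- The Jacobiator of a bracket. -/
def jacobiator (β : A → Derivation ℂ A A) (F G K : A) : A :=
  β F (β G K) + β G (β K F) + β K (β F G)

theorem jacobiator_rotate (F G K : A) : jacobiator β F G K = jacobiator β G K F := by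
  rw [jacobiator, jacobiator]
  ring

theorem jacobiator_adjoin_right (skew : ∀ F G, β F G = -β G F) {s : Set A} {F G : A}
    (hs : ∀ K ∈ s, jacobiator β F G K = 0) {K : A} (hK : K ∈ Algebra.adjoin ℂ s) :
    jacobiator β F G K = 0 := by
  -- In this form the Jacobiator is the commutator of two derivations minus a derivation, hence
  -- itself a derivation in K.
  have e : ∀ K, jacobiator β F G K = β F (β G K) - β G (β F K) - β (β F G) K := fun K => by
    rw [jacobiator, skew K F, map_neg, skew K (β F G)]
    ring
  simp only [e] at hs ⊢
  induction hK using Algebra.adjoin_induction with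
  | mem x hx => exact hs x hx
  | algebraMap r => simp only [Derivation.map_algebraMap, map_zero, sub_zero]
  | add x y _ _ hx hy =>
    simp only [map_add]
    linear_combination hx + hy
  | mul x y _ _ hx hy =>
    simp only [Derivation.leibniz, smul_eq_mul, map_add]
    linear_combination y * hx + x * hy

theorem jacobiator_adjoin (skew : ∀ F G, β F G = -β G F) {s : Set A}
    (hs : ∀ F ∈ s, ∀ G ∈ s, ∀ K ∈ s, jacobiator β F G K = 0) {F G K : A}
    (hF : F ∈ Algebra.adjoin ℂ s) (hG : G ∈ Algebra.adjoin ℂ s) (hK : K ∈ Algebra.adjoin ℂ s) :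
    jacobiator β F G K = 0 := by
  refine jacobiator_adjoin_right skew (fun K hK => ?_) hK
  rw [jacobiator_rotate, jacobiator_rotate]
  refine jacobiator_adjoin_right skew (fun G hG => ?_) hG
  rw [jacobiator_rotate, jacobiator_rotate]
  refine jacobiator_adjoin_right skew (fun F hF => ?_) hF
  rw [jacobiator_rotate, jacobiator_rotate]
  exact hs F hF G hG K hK

theorem isPoissonSubalgebra_adjoin (skew : ∀ F G, β F G = -β G F) {s : Set A}
    (hs : ∀ F ∈ s, ∀ G ∈ s, β F G ∈ Algebra.adjoin ℂ s)
    (hj : ∀ F ∈ s, ∀ G ∈ s, ∀ K ∈ s, jacobiator β F G K = 0) :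
    IsPoissonSubalgebra (fun F G => β F G) (Algebra.adjoin ℂ s) where
  closed _ hF _ hG := bracket_mem_adjoin skew hs hF hG
  add_right _ _ _ _ _ _ := map_add _ _ _
  smul_right _ _ _ _ _ := Derivation.map_smul _ _ _
  skew _ _ _ _ := skew _ _
  leibniz F _ G _ K _ := by
    simp only [Derivation.leibniz, smul_eq_mul]
    ring
  jacobi _ hF _ hG _ hK := jacobiator_adjoin skew hj hF hG hK

end Adjoin

/-! ### The subalgebras generated by traces and moments. -/

section LaxAlgebra

variable {A : Type*} [CommRing A] [Algebra ℂ A] {G I S : Type*} [AddCommGroup G] [Fintype G]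
  [DecidableEq G] [Fintype I] [DecidableEq I] [Fintype S] [LinearOrder S]

namespace IsLaxSystem

variable {f : I → G} {t : S → G} {β : A → Derivation ℂ A A} {L : Matrix I I A} {V : Matrix S I A}
  {W : Matrix I S A} {σ : G} {ε : ℂ} (H : IsLaxSystem f t β L V W σ ε)

include H

theorem isPoissonSubalgebra_trace_pow :
    IsPoissonSubalgebra (fun F G => β F G) (Algebra.adjoin ℂ {F | ∃ k, F = (L ^ k).trace}) := by
  refine isPoissonSubalgebra_adjoin H.skew ?_ ?_
  · rintro _ ⟨k, rfl⟩ _ ⟨l, rfl⟩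
    rw [H.bracket_trace_pow_trace_pow]
    exact Subalgebra.zero_mem _
  · rintro _ ⟨k, rfl⟩ _ ⟨l, rfl⟩ _ ⟨n, rfl⟩
    simp only [jacobiator, H.bracket_trace_pow_trace_pow, map_zero, add_zero]

theorem isPoissonSubalgebra_moment (hε : ε = 1 ∨ ε = -1) :
    IsPoissonSubalgebra (fun F G => β F G) (Algebra.adjoin ℂ ({F | ∃ k, F = (L ^ k).trace} ∪
      {F | ∃ a b k, F = moment L V W k b a})) := by
  have hm : ∀ k a b, moment L V W k a b ∈ Algebra.adjoin ℂ ({F | ∃ k, F = (L ^ k).trace} ∪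
      {F | ∃ a b k, F = moment L V W k b a}) :=
    fun k a b => Algebra.subset_adjoin (Or.inr ⟨b, a, k, rfl⟩)
  have hz : ∀ k, ∀ G ∈ Algebra.adjoin ℂ ({F | ∃ k, F = (L ^ k).trace} ∪
      {F | ∃ a b k, F = moment L V W k b a}), β (L ^ k).trace G = 0 := by
    intro k G hG
    refine bracket_eq_zero_of_adjoin H.skew (s := {(L ^ k).trace}) ?_
      (Algebra.subset_adjoin rfl) hG
    rintro _ rfl _ (⟨l, rfl⟩ | ⟨a, b, l, rfl⟩)
    · exact H.bracket_trace_pow_trace_pow _ _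
    · exact H.bracket_trace_pow_moment _ _ _ _
  have hs : ∀ F ∈ ({F | ∃ k, F = (L ^ k).trace} ∪ {F | ∃ a b k, F = moment L V W k b a} : Set A),
      ∀ G ∈ ({F | ∃ k, F = (L ^ k).trace} ∪ {F | ∃ a b k, F = moment L V W k b a} : Set A),
      β F G ∈ Algebra.adjoin ℂ ({F | ∃ k, F = (L ^ k).trace} ∪
      {F | ∃ a b k, F = moment L V W k b a}) := by
    rintro _ (⟨k, rfl⟩ | ⟨a, b, k, rfl⟩) G hG
    · rw [hz k G (Algebra.subset_adjoin hG)]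
      exact Subalgebra.zero_mem _
    · rcases hG with ⟨l, rfl⟩ | ⟨c, d, l, rfl⟩
      · rw [H.skew, H.bracket_trace_pow_moment, neg_zero]
        exact Subalgebra.zero_mem _
      · exact H.bracket_moment_moment_mem hε hm _ _ _ _ _ _
  -- A trace of a power of L commutes with the whole algebra, which is closed under brackets, so
  -- each term of the Jacobiator vanishes separately.
  have hz' : ∀ k, ∀ G ∈ ({F | ∃ k, F = (L ^ k).trace} ∪ {F | ∃ a b k, F = moment L V W k b a} :
      Set A), ∀ K ∈ ({F | ∃ k, F = (L ^ k).trace} ∪ {F | ∃ a b k, F = moment L V W k b a} :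
      Set A), jacobiator β (L ^ k).trace G K = 0 := by
    intro k G hG K hK
    rw [jacobiator, hz k _ (hs G hG K hK), H.skew K, hz k K (Algebra.subset_adjoin hK),
      hz k G (Algebra.subset_adjoin hG)]
    simp
  refine isPoissonSubalgebra_adjoin H.skew hs ?_
  rintro F (⟨k, rfl⟩ | ⟨a, b, k, rfl⟩) G hG K hK
  · exact hz' k G hG K hK
  · have hF : moment L V W k b a ∈ ({F | ∃ k, F = (L ^ k).trace} ∪
      {F | ∃ a b k, F = moment L V W k b a} : Set A) := Or.inr ⟨a, b, k, rfl⟩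
    rcases hG with ⟨l, rfl⟩ | ⟨c, d, l, rfl⟩
    · rw [jacobiator_rotate]
      exact hz' l K hK _ hF
    · rcases hK with ⟨n, rfl⟩ | ⟨e, g, n, rfl⟩
      · rw [jacobiator_rotate, jacobiator_rotate]
        exact hz' n _ hF _ (Or.inr ⟨c, d, l, rfl⟩)
      · exact H.jacobi_moment hε _ _ _ _ _ _ _ _ _

theorem bracket_trace_pow_adjoin {F K : A}
    (hF : F ∈ Algebra.adjoin ℂ {F | ∃ k, F = (L ^ k).trace})
    (hK : K ∈ Algebra.adjoin ℂ ({F | ∃ k, F = (L ^ k).trace} ∪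
      {F | ∃ a b k, F = moment L V W k b a})) : β F K = 0 := by
  refine bracket_eq_zero_of_adjoin H.skew ?_ hF hK
  rintro _ ⟨k, rfl⟩ _ (⟨l, rfl⟩ | ⟨a, b, l, rfl⟩)
  · exact H.bracket_trace_pow_trace_pow _ _
  · exact H.bracket_trace_pow_moment _ _ _ _

end IsLaxSystem

end LaxAlgebra

end CyclicQuiver

end

noncomputable section

namespace CyclicQuiver

open Matrix

/-! ### The brackets of matrix entries in terms of the full matrices -/

section EntryBracket

variable {m : ℕ} [NeZero m] {N d : ZMod m → ℕ}

/-- The vertex of a basis vector. -/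
abbrev vertex : Idx m N → ZMod m := Sigma.fst

/-- The vertex of a spin index. -/
abbrev spinVertex : Spin m d → ZMod m := Sigma.fst

theorem X_apply (i j : Idx m N) : (X : PolyMat m N d) i j =
    if h : j.1 = i.1 + 1 then MvPolynomial.X (.x ⟨(i, j), h⟩) else 0 := by
  rw [X, Matrix.sum_apply, Finset.sum_eq_single i.1]
  · rw [Xs, of_apply]
    simp
  · intro s _ hs
    rw [Xs, of_apply]
    simp [hs.symm]
  · simp

theorem Y_apply (i j : Idx m N) : (Y : PolyMat m N d) i j =
    if h : i.1 = j.1 + 1 then MvPolynomial.X (.y ⟨(i, j), h⟩) else 0 := by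
  rw [Y, Matrix.sum_apply, Finset.sum_eq_single j.1]
  · rw [Ys, of_apply]
    simp
  · intro s _ hs
    rw [Ys, of_apply]
    simp [hs.symm]
  · simp

theorem graded_X : IsGraded vertex vertex 1 (X : PolyMat m N d) := by
  intro i j h
  rw [X_apply, dif_neg h]

theorem graded_Y : IsGraded vertex vertex (-1) (Y : PolyMat m N d) := by
  intro i j h
  rw [Y_apply, dif_neg]
  intro h'
  apply h
  change j.1 = i.1 + -1
  rw [h']
  abel

theorem Xs_eq (s : ZMod m) : (Xs s : PolyMat m N d) = proj _ vertex s * X := by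
  ext i j : 1
  rw [proj_mul_apply, X_apply, Xs, of_apply]
  by_cases h : i.1 = s <;> simp [h, vertex]

theorem Ys_eq (s : ZMod m) : (Ys s : PolyMat m N d) = Y * proj _ vertex s := by
  ext i j : 1
  rw [mul_proj_apply, Y_apply, Ys, of_apply]
  by_cases h : j.1 = s <;> simp [h, vertex]

theorem proj_mul_self {A I G : Type*} [CommRing A] [Fintype I] [DecidableEq I] [AddCommGroup G]
    [DecidableEq G] (f : I → G) (r : G) : proj A f r * proj A f r = proj A f r := by
  ext i j
  rw [proj_mul_apply, proj_apply]
  by_cases h : f i = r <;> simp [h]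

theorem X_mul_proj (s : ZMod m) :
    (X : PolyMat m N d) * proj _ vertex (s + 1) = proj _ vertex s * X :=
  (graded_X.proj_mul s).symm

theorem Y_mul_proj (s : ZMod m) :
    (Y : PolyMat m N d) * proj _ vertex s = proj _ vertex (s + 1) * Y := by
  rw [graded_Y.proj_mul (s + 1)]
  congr 2
  abel

/-- For entries at positions of degree 1, the deltas between vertices follow from those between
basis vectors, so the blocks X_r can be replaced by the full matrix X. -/
theorem brXX_eq {i j k l : Idx m N} (h : j.1 = i.1 + 1) (h' : l.1 = k.1 + 1) :
    (brXX i.1 i j k.1 k l : Poly m N d) =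
      (1 / 2 : ℂ) • (δ i l * (X * X : PolyMat m N d) k j) -
        (1 / 2 : ℂ) • (δ k j * (X * X : PolyMat m N d) i l) := by
  have e : ∀ s : ZMod m, (Xs s * Xs (s + 1) : PolyMat m N d) = proj _ vertex s * (X * X) := by
    intro s
    rw [Xs_eq, Xs_eq, Matrix.mul_assoc, ← Matrix.mul_assoc X, X_mul_proj, Matrix.mul_assoc,
      ← Matrix.mul_assoc, proj_mul_self]
  rw [brXX]
  congr 2
  · by_cases hil : i = l
    · subst hil
      rw [h', add_sub_cancel_right, e, proj_mul_apply]
      simp [δ, vertex]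
    · simp [δ, hil]
  · by_cases hkj : k = j
    · subst hkj
      rw [e, proj_mul_apply]
      simp [δ, vertex, h]
    · simp [δ, hkj]

theorem brYY_eq {i j k l : Idx m N} (h : i.1 = j.1 + 1) (h' : k.1 = l.1 + 1) :
    (brYY j.1 i j l.1 k l : Poly m N d) =
      (1 / 2 : ℂ) • (δ k j * (Y * Y : PolyMat m N d) i l) -
        (1 / 2 : ℂ) • (δ i l * (Y * Y : PolyMat m N d) k j) := by
  have e : ∀ s : ZMod m, (Ys (s + 1) * Ys s : PolyMat m N d) = (Y * Y) * proj _ vertex s := by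
    intro s
    rw [Ys_eq, Ys_eq, ← Matrix.mul_assoc, Matrix.mul_assoc Y _ Y, ← Y_mul_proj, Matrix.mul_assoc,
      Matrix.mul_assoc, proj_mul_self, Matrix.mul_assoc]
  rw [brYY]
  congr 2
  · by_cases hkj : k = j
    · subst hkj
      rw [h', add_sub_cancel_right, e, mul_proj_apply]
      simp [δ, vertex]
    · simp [δ, hkj]
  · by_cases hil : i = l
    · subst hil
      rw [e, mul_proj_apply]
      simp [δ, vertex, h]
    · simp [δ, hil]

theorem brXY_eq {i j k l : Idx m N} (h : j.1 = i.1 + 1) (h' : k.1 = l.1 + 1) :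
    (brXY i.1 i j l.1 k l : Poly m N d) =
      δ k j * δ i l + (1 / 2 : ℂ) • (δ i l * (Y * X : PolyMat m N d) k j)
        + (1 / 2 : ℂ) • (δ k j * (X * Y : PolyMat m N d) i l)
        - (1 / 2 : ℂ) • ((X : PolyMat m N d) k j * (Y : PolyMat m N d) i l)
        + (1 / 2 : ℂ) • ((Y : PolyMat m N d) k j * (X : PolyMat m N d) i l) := by
  have hX : ∀ (s : ZMod m) (p q : Idx m N), (Xs s : PolyMat m N d) p q =
      if p.1 = s then (X : PolyMat m N d) p q else 0 := by
    intro s p q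
    rw [Xs_eq, proj_mul_apply]
  have hY : ∀ (s : ZMod m) (p q : Idx m N), (Ys s : PolyMat m N d) p q =
      if q.1 = s then (Y : PolyMat m N d) p q else 0 := by
    intro s p q
    rw [Ys_eq, mul_proj_apply]
  have e1 : ∀ s : ZMod m, (Xs s * Ys s : PolyMat m N d) = proj _ vertex s * (X * Y) := by
    intro s
    rw [Xs_eq, Ys_eq, Y_mul_proj, ← X_mul_proj, Matrix.mul_assoc, ← Matrix.mul_assoc (proj _ _ _),
      proj_mul_self, ← Matrix.mul_assoc, X_mul_proj, Matrix.mul_assoc]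
  have e2 : ∀ s : ZMod m, (Ys s * Xs s : PolyMat m N d) = proj _ vertex (s + 1) * (Y * X) := by
    intro s
    rw [Xs_eq, Ys_eq, Matrix.mul_assoc, ← Matrix.mul_assoc (proj _ _ _), proj_mul_self,
      ← Matrix.mul_assoc, Y_mul_proj, Matrix.mul_assoc]
  have t1 : (δ l.1 i.1 : Poly m N d) * (δ k j * δ i l +
      (1 / 2 : ℂ) • ((Ys i.1 * Xs i.1 : PolyMat m N d) k j * δ i l)
      + (1 / 2 : ℂ) • (δ k j * (Xs i.1 * Ys i.1 : PolyMat m N d) i l)) =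
      δ k j * δ i l + (1 / 2 : ℂ) • (δ i l * (Y * X : PolyMat m N d) k j)
        + (1 / 2 : ℂ) • (δ k j * (X * Y : PolyMat m N d) i l) := by
    rw [e1, e2, proj_mul_apply, proj_mul_apply]
    by_cases hli : l.1 = i.1
    · simp only [δ, hli, if_true, h', one_mul]
      rw [mul_comm ((Y * X : PolyMat m N d) k j)]
    · have h1 : i ≠ l := fun h => hli (by rw [h])
      have h2 : k ≠ j := by
        rintro rfl
        exact hli (add_right_cancel (h'.symm.trans h))
      simp [δ, hli, h1, h2]
  -- When the delta between vertices fails, the entry of Y on the right is zero as well.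
  have t2 : (δ l.1 (i.1 - 1) : Poly m N d) * Xs i.1 k j * Ys (i.1 - 1) i l =
      (X : PolyMat m N d) k j * (Y : PolyMat m N d) i l := by
    rw [hX, hY]
    by_cases hil : i.1 = l.1 + 1
    · rw [hil, add_sub_cancel_right, if_pos h']
      simp [δ]
    · rw [Y_apply i l, dif_neg hil]
      simp
  have t3 : (δ l.1 (i.1 + 1) : Poly m N d) * Ys (i.1 + 1) k j * Xs i.1 i l =
      (Y : PolyMat m N d) k j * (X : PolyMat m N d) i l := by
    rw [hX, hY]
    by_cases hil : l.1 = i.1 + 1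
    · rw [hil, if_pos h, if_pos rfl]
      simp [δ]
    · rw [X_apply i l, dif_neg hil]
      simp
  rw [brXY, t1, t2, t3]

/-- The matrix with rows `V_a`. -/
def rowV : Matrix (Spin m d) (Idx m N) (Poly m N d) := of V

/-- The matrix with columns `W_a`. -/
def colW : Matrix (Idx m N) (Spin m d) (Poly m N d) := of fun i a => W a i

theorem rowV_apply (a : Spin m d) (j : Idx m N) : (rowV a j : Poly m N d) =
    if h : j.1 = a.1 then MvPolynomial.X (.v ⟨(a, j), h⟩) else 0 := rfl

theorem colW_apply (i : Idx m N) (a : Spin m d) : (colW i a : Poly m N d) =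
    if h : i.1 = a.1 then MvPolynomial.X (.w ⟨(a, i), h⟩) else 0 := rfl

theorem graded_rowV : IsGraded spinVertex vertex 0 (rowV : Matrix _ _ (Poly m N d)) := by
  intro a j h
  rw [rowV_apply, dif_neg]
  simpa [vertex, spinVertex] using h

theorem graded_colW : IsGraded vertex spinVertex 0 (colW : Matrix _ _ (Poly m N d)) := by
  intro i a h
  rw [colW_apply, dif_neg]
  intro h'
  apply h
  simp [h', vertex, spinVertex]

theorem Xs_apply (s : ZMod m) (p q : Idx m N) : (Xs s : PolyMat m N d) p q =
    if p.1 = s then (X : PolyMat m N d) p q else 0 := by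
  rw [Xs_eq, proj_mul_apply]

theorem Ys_apply (s : ZMod m) (p q : Idx m N) : (Ys s : PolyMat m N d) p q =
    if q.1 = s then (Y : PolyMat m N d) p q else 0 := by
  rw [Ys_eq, mul_proj_apply]

theorem brXV_eq {i j : Idx m N} (h : j.1 = i.1 + 1) {a : Spin m d} {l : Idx m N} (h' : l.1 = a.1) :
    (brXV i.1 i j a l : Poly m N d) =
      (1 / 2 : ℂ) • (((rowV : Matrix _ _ (Poly m N d)) * (X : PolyMat m N d)) a j * proj (Poly m N d) vertex a.1 i l)
        - (1 / 2 : ℂ) • (rowV a j * (X * proj _ vertex a.1 : PolyMat m N d) i l) := by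
  rw [brXV, proj_apply, mul_proj_apply, Xs_apply]
  congr 2
  · by_cases hil : i = l
    · subst hil
      have : (V a ᵥ* Xs i.1) j = ((rowV : Matrix _ _ (Poly m N d)) * (X : PolyMat m N d)) a j := by
        rw [mul_apply]
        refine Finset.sum_congr rfl fun p _ => ?_
        change V a p * Xs i.1 p j = V a p * _
        rw [Xs_apply]
        by_cases hp : p.1 = a.1
        · rw [if_pos (hp.trans h'.symm)]
        · rw [V, dif_neg hp, zero_mul, zero_mul]
      rw [this]
      simp [δ, h', vertex]
    · simp [δ, hil]
  · change _ * V a j * _ = V a j * _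
    by_cases hj : j.1 = a.1
    · simp [δ, vertex, h', ← hj, h]
    · rw [V, dif_neg hj]
      simp

theorem brXW_eq {i j : Idx m N} (h : j.1 = i.1 + 1) {a : Spin m d} {k : Idx m N} (h' : k.1 = a.1) :
    (brXW i.1 i j a k : Poly m N d) =
      (1 / 2 : ℂ) • (proj (Poly m N d) vertex a.1 k j * ((X : PolyMat m N d) * (colW : Matrix _ _ (Poly m N d))) i a)
        - (1 / 2 : ℂ) • ((proj _ vertex a.1 * X : PolyMat m N d) k j * colW i a) := by
  rw [brXW, proj_apply, proj_mul_apply, Xs_apply]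
  congr 2
  · by_cases hkj : k = j
    · subst hkj
      have : (Xs i.1 *ᵥ W a) i = ((X : PolyMat m N d) * (colW : Matrix _ _ (Poly m N d))) i a := by
        rw [mul_apply]
        refine Finset.sum_congr rfl fun p _ => ?_
        change Xs i.1 i p * W a p = X i p * W a p
        rw [Xs_apply, if_pos rfl]
      rw [this]
      simp [δ, ← h', h, vertex]
    · simp [δ, hkj]
  · change _ * _ * W a i = _ * W a i
    by_cases hj : i.1 = a.1
    · simp [δ, vertex, h', hj]
    · rw [W, dif_neg hj]
      simp

theorem brYV_eq {i j : Idx m N} (h : i.1 = j.1 + 1) {a : Spin m d} {l : Idx m N} (h' : l.1 = a.1) :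
    (brYV j.1 i j a l : Poly m N d) =
      (1 / 2 : ℂ) • (((rowV : Matrix _ _ (Poly m N d)) * (Y : PolyMat m N d)) a j * proj (Poly m N d) vertex a.1 i l)
        - (1 / 2 : ℂ) • (rowV a j * (Y * proj _ vertex a.1 : PolyMat m N d) i l) := by
  rw [brYV, proj_apply, mul_proj_apply, Ys_apply]
  congr 2
  · by_cases hil : i = l
    · subst hil
      have : (V a ᵥ* Ys j.1) j = ((rowV : Matrix _ _ (Poly m N d)) * (Y : PolyMat m N d)) a j := by
        rw [mul_apply]
        refine Finset.sum_congr rfl fun p _ => ?_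
        change V a p * Ys j.1 p j = V a p * _
        rw [Ys_apply, if_pos rfl]
      rw [this]
      simp [δ, ← h', h, vertex]
    · simp [δ, hil]
  · change _ * V a j * _ = V a j * _
    by_cases hj : j.1 = a.1
    · simp [δ, vertex, h', hj]
    · rw [V, dif_neg hj]
      simp

theorem brYW_eq {i j : Idx m N} (h : i.1 = j.1 + 1) {a : Spin m d} {k : Idx m N} (h' : k.1 = a.1) :
    (brYW j.1 i j a k : Poly m N d) =
      (1 / 2 : ℂ) • (proj (Poly m N d) vertex a.1 k j * ((Y : PolyMat m N d) * (colW : Matrix _ _ (Poly m N d))) i a)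
        - (1 / 2 : ℂ) • ((proj _ vertex a.1 * Y : PolyMat m N d) k j * colW i a) := by
  rw [brYW, proj_apply, proj_mul_apply, Ys_apply]
  congr 2
  · by_cases hkj : k = j
    · subst hkj
      have : (Ys k.1 *ᵥ W a) i = ((Y : PolyMat m N d) * (colW : Matrix _ _ (Poly m N d))) i a := by
        rw [mul_apply]
        refine Finset.sum_congr rfl fun p _ => ?_
        change Ys k.1 i p * W a p = Y i p * W a p
        rw [Ys_apply]
        by_cases hp : p.1 = a.1
        · rw [if_pos (hp.trans h'.symm)]
        · rw [W, dif_neg hp, mul_zero, mul_zero]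
      rw [this]
      simp [δ, h', vertex]
    · simp [δ, hkj]
  · change _ * _ * W a i = _ * W a i
    by_cases hj : i.1 = a.1
    · simp [δ, vertex, h', ← hj, h]
    · rw [W, dif_neg hj]
      simp

/-- Pairs of different types are antisymmetric by definition; only the four types XX, YY, VV, WW
need an argument. -/
theorem entryBracket_antisymm (a b : Entry m N d) : entryBracket a b = -entryBracket b a := by
  have ho : ∀ s r : ZMod m, o s r = -o r s := by
    intro s r
    rw [o, o, ← Int.cast_neg, ← Int.sign_neg, neg_sub]
  have hos : ∀ a b : Spin m d, oSpin a b = -oSpin b a := by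
    intro a b
    rw [oSpin, oSpin]
    by_cases h : a.1 = b.1
    · rw [if_pos h, if_pos h.symm, ← Int.cast_neg, ← Int.sign_neg, neg_sub]
    · rw [if_neg h, if_neg fun h' => h h'.symm, neg_zero]
  rcases a with ⟨⟨i, j⟩, h⟩ | ⟨⟨i, j⟩, h⟩ | ⟨⟨a, j⟩, h⟩ | ⟨⟨a, j⟩, h⟩ <;>
    rcases b with ⟨⟨k, l⟩, h'⟩ | ⟨⟨k, l⟩, h'⟩ | ⟨⟨c, l⟩, h'⟩ | ⟨⟨c, l⟩, h'⟩ <;>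
    simp only [entryBracket, neg_neg]
  · rw [brXX_eq h h', brXX_eq h' h, neg_sub]
  · rw [brYY_eq h h', brYY_eq h' h, neg_sub]
  · rw [brVV, brVV, ho, hos, mul_comm (V c l), mul_comm (V a l)]
    simp only [mul_neg, neg_smul]
    module
  · rw [brWW, brWW, ho, hos, mul_comm (W a j) (W c l), mul_comm (W c j)]
    simp only [mul_neg, neg_smul]
    module

end EntryBracket

end CyclicQuiver

end

noncomputable section

namespace CyclicQuiver

open Matrix

/-! ### The brackets of matrix entries as regular functions -/

section RegBracket

variable {m : ℕ} [NeZero m] {N d : ZMod m → ℕ}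

/-- The lexicographic order on spin indices. -/
instance spinOrder : LinearOrder (Spin m d) :=
  LinearOrder.lift' (fun a => toLex (a.1.val, (a.2 : ℕ))) (by
    rintro ⟨s, α⟩ ⟨r, γ⟩ h
    have h1 : s.val = r.val := congrArg (fun z => (ofLex z).1) h
    have h2 : (α : ℕ) = γ := congrArg (fun z => (ofLex z).2) h
    obtain rfl := ZMod.val_injective m h1
    rw [Fin.ext h2])

theorem spin_lt_iff (a b : Spin m d) :
    spinOrder.lt a b ↔ a.1.val < b.1.val ∨ a.1.val = b.1.val ∧ (a.2 : ℕ) < b.2 :=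
  Prod.Lex.lt_iff (x := toLex (a.1.val, (a.2 : ℕ))) (y := toLex (b.1.val, (b.2 : ℕ)))

/-- For the lexicographic order on spin indices, the sign between vertices and the sign at a common
vertex merge into one sign function. This puts the brackets of V and W into the form required by
`IsLaxSystem`. -/
theorem osgn_spin (a b : Spin m d) : osgn a b = o a.1 b.1 + oSpin a b := by
  have key : ∀ {a b : Spin m d}, spinOrder.lt a b → o a.1 b.1 + oSpin a b = 1 := by
    intro a b h
    rw [o, oSpin]
    rcases (spin_lt_iff a b).1 h with h | ⟨h1, h2⟩
    · rw [if_neg fun h' => h.ne (congrArg _ h'), Int.sign_eq_one_of_pos (by omega)]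
      simp
    · rw [if_pos (ZMod.val_injective m h1), h1, sub_self, Int.sign_zero,
        Int.sign_eq_one_of_pos (by omega)]
      simp
  have hs : ∀ a b : Spin m d, o a.1 b.1 + oSpin a b = -(o b.1 a.1 + oSpin b a) := by
    intro a b
    rw [o, o, oSpin, oSpin, ← neg_sub ((a.1.val : ℤ)), Int.sign_neg]
    by_cases h : a.1 = b.1
    · rw [if_pos h, if_pos h.symm, ← neg_sub (((a.2 : ℕ) : ℤ)), Int.sign_neg]
      push_cast
      ring
    · rw [if_neg h, if_neg fun h' => h h'.symm]
      push_cast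
      ring
  rcases lt_trichotomy a b with h | rfl | h
  · rw [osgn_of_lt h, key h]
  · rw [osgn_self, o, oSpin]
    simp
  · rw [osgn_of_gt h, hs, key h]

theorem vertexSign_spin (a b : Spin m d) : vertexSign spinVertex a b = oSpin a b := by
  rw [vertexSign, osgn_spin, oSpin]
  by_cases h : a.1 = b.1
  · simp [h, spinVertex, o]
  · simp [h, spinVertex]

variable (g : Poly m N d)

local notation "ι" => algebraMap (Poly m N d) (Reg g)
local notation "𝐜" => algebraMap ℂ (Reg g)
local notation "𝐡" => algebraMap ℂ (Reg g) (1 / 2)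

/-- The Hamiltonian derivation `{F, -}`. -/
def bracketDer (F : Reg g) : Derivation ℂ (Reg g) (Reg g) :=
  ∑ a : Entry m N d, ∑ b : Entry m N d,
    (locDerivation g (MvPolynomial.pderiv a) F * ι (entryBracket a b)) •
      locDerivation g (MvPolynomial.pderiv b)

theorem bracketDer_apply (F G : Reg g) : bracketDer g F G = bracket g F G := by
  rw [bracketDer, bracket, ← Derivation.coeFnAddMonoidHom_apply, map_sum, Finset.sum_apply]
  refine Finset.sum_congr rfl fun a _ => ?_
  rw [map_sum, Finset.sum_apply]
  refine Finset.sum_congr rfl fun b _ => ?_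
  rw [Derivation.coeFnAddMonoidHom_apply, Derivation.smul_apply, smul_eq_mul]
  ring

theorem bracketDer_skew (F G : Reg g) : bracketDer g F G = -bracketDer g G F := by
  rw [bracketDer_apply, bracketDer_apply, bracket, bracket, Finset.sum_comm,
    ← Finset.sum_neg_distrib]
  refine Finset.sum_congr rfl fun a _ => ?_
  rw [← Finset.sum_neg_distrib]
  refine Finset.sum_congr rfl fun b _ => ?_
  rw [entryBracket_antisymm b a, map_neg]
  ring

theorem bracketDer_entry (a b : Entry m N d) :
    bracketDer g (ι (MvPolynomial.X a)) (ι (MvPolynomial.X b)) = ι (entryBracket a b) := by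
  rw [bracketDer_apply, bracket_entry]

/-- The matrix `X` of regular functions. -/
def regX : Matrix (Idx m N) (Idx m N) (Reg g) := (X : PolyMat m N d).map ι

/-- The matrix `Y` of regular functions. -/
def regY : Matrix (Idx m N) (Idx m N) (Reg g) := (Y : PolyMat m N d).map ι

/-- The matrix of regular functions with rows `V_a`. -/
def regV : Matrix (Spin m d) (Idx m N) (Reg g) := (rowV : Matrix _ _ (Poly m N d)).map ι

/-- The matrix of regular functions with columns `W_a`. -/
def regW : Matrix (Idx m N) (Spin m d) (Reg g) := (colW : Matrix _ _ (Poly m N d)).map ι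

theorem IsGraded.map {A B I J G : Type*} [CommRing A] [CommRing B] [AddCommGroup G] (φ : A →+* B)
    {f : I → G} {f' : J → G} {τ : G} {M : Matrix I J A} (hM : IsGraded f f' τ M) :
    IsGraded f f' τ (M.map φ) := by
  intro i j h
  rw [map_apply, hM i j h, map_zero]

theorem graded_regX : IsGraded vertex vertex 1 (regX g) := graded_X.map _

theorem graded_regY : IsGraded vertex vertex (-1) (regY g) := graded_Y.map _

theorem graded_regV : IsGraded spinVertex vertex 0 (regV g) := graded_rowV.map _

theorem graded_regW : IsGraded vertex spinVertex 0 (regW g) := graded_colW.map _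

theorem bracketDer_zero_left (F : Reg g) : bracketDer g 0 F = 0 := by
  rw [bracketDer_skew, map_zero, neg_zero]

theorem reg_smul (r : ℂ) (p : Poly m N d) : ι (r • p) = 𝐜 r * ι p := by
  rw [algebraMap_smul_away, Algebra.smul_def]

theorem reg_mul_apply {I J K : Type*} [Fintype J] (M : Matrix I J (Poly m N d))
    (M' : Matrix J K (Poly m N d)) (i : I) (k : K) :
    ι ((M * M') i k) = (M.map ι * M'.map ι) i k := by
  rw [← Matrix.map_mul, map_apply]

theorem reg_delta {J : Type*} [DecidableEq J] (i j : J) :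
    ι (δ i j) = if i = j then 1 else 0 := by
  rw [δ]
  split_ifs <;> simp

theorem reg_proj (r : ZMod m) :
    (proj (Poly m N d) (vertex (N := N)) r).map ι = proj (Reg g) vertex r := by
  ext i j
  rw [map_apply, proj_apply, proj_apply]
  split_ifs <;> simp

theorem reg_proj_apply (r : ZMod m) (i j : Idx m N) :
    ι (proj (Poly m N d) vertex r i j) = proj (Reg g) vertex r i j := by
  rw [← reg_proj, map_apply]

theorem graded_mul_apply {A I J K G : Type*} [CommRing A] [AddCommGroup G] [Fintype J] {f : I → G}
    {f' : J → G} {f'' : K → G} {τ τ' : G} {M : Matrix I J A} {M' : Matrix J K A}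
    (hM : IsGraded f f' τ M) (hM' : IsGraded f' f'' τ' M') {i : I} {k : K}
    (h : f'' k ≠ f i + (τ + τ')) : (M * M') i k = 0 :=
  hM.mul hM' i k h

/-- No degree condition is put on (i, j): if it has the wrong degree, both sides vanish. This uses
`h'`; with both degrees wrong, a term on the right could survive. -/
theorem bracketDer_XX (i j : Idx m N) {k l : Idx m N} (h' : l.1 = k.1 + 1) :
    bracketDer g (regX g i j) (regX g k l) =
      𝐡 * ((if i = l then 1 else 0) * (regX g * regX g) k j)
        - 𝐡 * ((if k = j then 1 else 0) * (regX g * regX g) i l) := by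
  by_cases h : j.1 = i.1 + 1
  · have e1 : regX g i j = ι (MvPolynomial.X (.x ⟨(i, j), h⟩)) := by
      rw [regX, map_apply, X_apply, dif_pos h]
    have e2 : regX g k l = ι (MvPolynomial.X (.x ⟨(k, l), h'⟩)) := by
      rw [regX, map_apply, X_apply, dif_pos h']
    rw [e1, e2, bracketDer_entry, entryBracket, brXX_eq h h', map_sub, reg_smul, reg_smul, map_mul,
      map_mul, reg_mul_apply, reg_mul_apply, reg_delta, reg_delta]
    rfl
  · rw [graded_regX g i j h, bracketDer_zero_left]
    have h1 : (if i = l then 1 else 0) * (regX g * regX g) k j = 0 := by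
      split_ifs with hil
      · subst hil
        rw [graded_mul_apply (graded_regX g) (graded_regX g), mul_zero]
        rw [← add_assoc, ← h']
        exact h
      · rw [zero_mul]
    have h2 : (if k = j then 1 else 0) * (regX g * regX g) i l = 0 := by
      split_ifs with hkj
      · subst hkj
        rw [graded_mul_apply (graded_regX g) (graded_regX g), mul_zero]
        change l.1 ≠ _
        rw [← add_assoc, h']
        exact fun h'' => h (add_right_cancel h'')
      · rw [zero_mul]
    rw [h1, h2, mul_zero, sub_zero]

theorem bracketDer_YY (i j : Idx m N) {k l : Idx m N} (h' : k.1 = l.1 + 1) :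
    bracketDer g (regY g i j) (regY g k l) =
      𝐡 * ((if k = j then 1 else 0) * (regY g * regY g) i l)
        - 𝐡 * ((if i = l then 1 else 0) * (regY g * regY g) k j) := by
  by_cases h : i.1 = j.1 + 1
  · have e1 : regY g i j = ι (MvPolynomial.X (.y ⟨(i, j), h⟩)) := by
      rw [regY, map_apply, Y_apply, dif_pos h]
    have e2 : regY g k l = ι (MvPolynomial.X (.y ⟨(k, l), h'⟩)) := by
      rw [regY, map_apply, Y_apply, dif_pos h']
    rw [e1, e2, bracketDer_entry, entryBracket, brYY_eq h h', map_sub, reg_smul, reg_smul, map_mul,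
      map_mul, reg_mul_apply, reg_mul_apply, reg_delta, reg_delta]
    rfl
  · have h0 : j.1 ≠ i.1 + -1 := by
      intro h''
      apply h
      rw [h'']
      abel
    rw [graded_regY g i j h0, bracketDer_zero_left]
    have h1 : (if i = l then 1 else 0) * (regY g * regY g) k j = 0 := by
      split_ifs with hil
      · subst hil
        rw [graded_mul_apply (graded_regY g) (graded_regY g), mul_zero]
        change j.1 ≠ k.1 + _
        rw [h']
        intro h''
        apply h
        rw [h'']
        abel
      · rw [zero_mul]
    have h2 : (if k = j then 1 else 0) * (regY g * regY g) i l = 0 := by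
      split_ifs with hkj
      · subst hkj
        rw [graded_mul_apply (graded_regY g) (graded_regY g), mul_zero]
        change l.1 ≠ i.1 + _
        intro h''
        apply h
        rw [h', h'']
        abel
      · rw [zero_mul]
    rw [h1, h2, mul_zero, sub_zero]

theorem bracketDer_XY_aux {i j k l : Idx m N} (h : j.1 = i.1 + 1) (h' : k.1 = l.1 + 1) :
    bracketDer g (regX g i j) (regY g k l) =
      (if k = j then 1 else 0) * (if i = l then 1 else 0)
        + 𝐡 * ((if i = l then 1 else 0) * (regY g * regX g) k j)
        + 𝐡 * ((if k = j then 1 else 0) * (regX g * regY g) i l)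
        - 𝐡 * (regX g k j * regY g i l) + 𝐡 * (regY g k j * regX g i l) := by
  have e1 : regX g i j = ι (MvPolynomial.X (.x ⟨(i, j), h⟩)) := by
    rw [regX, map_apply, X_apply, dif_pos h]
  have e2 : regY g k l = ι (MvPolynomial.X (.y ⟨(k, l), h'⟩)) := by
    rw [regY, map_apply, Y_apply, dif_pos h']
  rw [e1, e2, bracketDer_entry, entryBracket, brXY_eq h h']
  simp only [map_sub, map_add, map_mul, reg_smul, reg_mul_apply, reg_delta]
  rfl

theorem bracketDer_XY {i j k l : Idx m N} (h' : j.1 = i.1 + 1 ∨ k.1 = l.1 + 1) :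
    bracketDer g (regX g i j) (regY g k l) =
      (if k = j then 1 else 0) * (if i = l then 1 else 0)
        + 𝐡 * ((if i = l then 1 else 0) * (regY g * regX g) k j)
        + 𝐡 * ((if k = j then 1 else 0) * (regX g * regY g) i l)
        - 𝐡 * (regX g k j * regY g i l) + 𝐡 * (regY g k j * regX g i l) := by
  by_cases hb : j.1 = i.1 + 1 ∧ k.1 = l.1 + 1
  · exact bracketDer_XY_aux g hb.1 hb.2
  have hX : ∀ p q : Idx m N, q.1 ≠ p.1 + 1 → regX g p q = 0 := fun p q => graded_regX g p q
  have hY : ∀ p q : Idx m N, p.1 ≠ q.1 + 1 → regY g p q = 0 := by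
    intro p q hpq
    refine graded_regY g p q fun h'' => hpq ?_
    change q.1 = p.1 + _ at h''
    rw [h'']
    abel
  have hl : bracketDer g (regX g i j) (regY g k l) = 0 := by
    by_cases h1 : j.1 = i.1 + 1
    · rw [hY k l fun h2 => hb ⟨h1, h2⟩, map_zero]
    · rw [hX i j h1, bracketDer_zero_left]
  have h0 : ¬(i = l ∧ k.1 = j.1) := by
    rintro ⟨rfl, h2⟩
    rw [h2] at h' hb
    tauto
  have h0' : ¬(k = j ∧ i.1 = l.1) := by
    rintro ⟨rfl, h2⟩
    rw [h2] at h' hb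
    tauto
  have t1 : (if i = l then 1 else 0) * (regY g * regX g) k j = 0 := by
    split_ifs with hil
    · rw [graded_mul_apply (graded_regY g) (graded_regX g), mul_zero]
      change j.1 ≠ k.1 + _
      rw [neg_add_cancel, add_zero]
      exact fun h2 => h0 ⟨hil, h2.symm⟩
    · rw [zero_mul]
  have t2 : (if k = j then 1 else 0) * (regX g * regY g) i l = 0 := by
    split_ifs with hkj
    · rw [graded_mul_apply (graded_regX g) (graded_regY g), mul_zero]
      change l.1 ≠ i.1 + _
      rw [add_neg_cancel, add_zero]
      exact fun h2 => h0' ⟨hkj, h2.symm⟩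
    · rw [zero_mul]
  have t3 : ((if k = j then 1 else 0) * (if i = l then 1 else 0) : Reg g) = 0 := by
    split_ifs with hkj hil
    · exact absurd ⟨hil, by rw [hkj]⟩ h0
    all_goals simp
  have t4 : regX g k j * regY g i l = 0 := by
    by_cases h1 : j.1 = k.1 + 1
    · rw [hY i l, mul_zero]
      intro h2
      apply hb
      rcases h' with h' | h'
      · have : i.1 = k.1 := add_right_cancel (h'.symm.trans h1)
        exact ⟨h', by rw [← this, h2]⟩
      · exact ⟨by rw [h1, h', h2], h'⟩
    · rw [hX k j h1, zero_mul]
  have t5 : regY g k j * regX g i l = 0 := by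
    by_cases h1 : k.1 = j.1 + 1
    · rw [hX i l, mul_zero]
      intro h2
      apply hb
      rcases h' with h' | h'
      · exact ⟨h', by rw [h1, h', h2]⟩
      · have : j.1 = l.1 := add_right_cancel (h1.symm.trans h')
        exact ⟨by rw [this, h2], h'⟩
    · rw [hY k j h1, zero_mul]
  rw [hl, t1, t2, t3, t4, t5]
  simp

end RegBracket

end CyclicQuiver

end

noncomputable section

namespace CyclicQuiver

open Matrix

/-! ### The Lax systems -/

section Vanishing

variable {A : Type*} [CommRing A] {G I S : Type*} [AddCommGroup G] [Fintype I] [DecidableEq I]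
  [DecidableEq G] {f : I → G} {t : S → G} {L : Matrix I I A} {V : Matrix S I A} {W : Matrix I S A}
  {τ : G}

/-- With its three companions, this makes the formulas for brackets with V and W hold also at the
positions where L has no entry. -/
theorem row_mul_proj_eq_zero (hL : IsGraded f f τ L) (hV : IsGraded t f 0 V) {i j : I}
    (h : f j ≠ f i + τ) (a : S) (l : I) : (V * L) a j * proj A f (t a) i l = 0 := by
  rw [proj_apply]
  split_ifs with hil
  · rw [(hV.mul hL) a j, zero_mul]
    rwa [zero_add, ← hil.2]
  · rw [mul_zero]

theorem row_mul_mul_proj_eq_zero (hL : IsGraded f f τ L) (hV : IsGraded t f 0 V) {i j : I}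
    (h : f j ≠ f i + τ) (a : S) (l : I) : V a j * (L * proj A f (t a)) i l = 0 := by
  rw [mul_proj_apply]
  split_ifs with hl
  · by_cases hj : f j = t a + 0
    · rw [hL i l, mul_zero]
      rwa [hl, ← add_zero (t a), ← hj]
    · rw [hV a j hj, zero_mul]
  · rw [mul_zero]

theorem proj_mul_mul_col_eq_zero (hL : IsGraded f f τ L) (hW : IsGraded f t 0 W) {i j : I}
    (h : f j ≠ f i + τ) (a : S) (k : I) : proj A f (t a) k j * (L * W) i a = 0 := by
  rw [proj_apply]
  split_ifs with hkj
  · rw [(hL.mul hW) i a, mul_zero]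
    rw [add_zero, ← hkj.2, hkj.1]
    exact h
  · rw [zero_mul]

theorem proj_mul_mul_eq_zero (hL : IsGraded f f τ L) (hW : IsGraded f t 0 W) {i j : I}
    (h : f j ≠ f i + τ) (a : S) (k : I) : (proj A f (t a) * L) k j * W i a = 0 := by
  rw [proj_mul_apply]
  split_ifs with hk
  · by_cases hi : t a = f i + 0
    · rw [hL k j, zero_mul]
      rwa [hk, hi, add_zero]
    · rw [hW i a hi, mul_zero]
  · rw [zero_mul]

theorem proj_apply_eq_zero_of_ne {r : G} {i j : I} (h : f j ≠ r) : proj A f r i j = 0 := by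
  rw [proj_apply, if_neg]
  rintro ⟨rfl, h'⟩
  exact h h'

theorem proj_apply_eq_zero_of_ne' {r : G} {i j : I} (h : f i ≠ r) : proj A f r i j = 0 := by
  rw [proj_apply, if_neg]
  exact fun h' => h h'.2

end Vanishing

/-! ### Brackets of regular functions involving spin vectors. -/

section RegBracketSpin

variable {m : ℕ} [NeZero m] {N d : ZMod m → ℕ} (g : Poly m N d)

local notation "ι" => algebraMap (Poly m N d) (Reg g)
local notation "𝐜" => algebraMap ℂ (Reg g)
local notation "𝐡" => algebraMap ℂ (Reg g) (1 / 2)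

theorem regX_apply {i j : Idx m N} (h : j.1 = i.1 + 1) :
    regX g i j = ι (MvPolynomial.X (.x ⟨(i, j), h⟩)) := by
  rw [regX, map_apply, X_apply, dif_pos h]

theorem regY_apply {i j : Idx m N} (h : i.1 = j.1 + 1) :
    regY g i j = ι (MvPolynomial.X (.y ⟨(i, j), h⟩)) := by
  rw [regY, map_apply, Y_apply, dif_pos h]

theorem regV_apply {a : Spin m d} {j : Idx m N} (h : j.1 = a.1) :
    regV g a j = ι (MvPolynomial.X (.v ⟨(a, j), h⟩)) := by
  rw [regV, map_apply, rowV_apply, dif_pos h]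

theorem regW_apply {a : Spin m d} {j : Idx m N} (h : j.1 = a.1) :
    regW g j a = ι (MvPolynomial.X (.w ⟨(a, j), h⟩)) := by
  rw [regW, map_apply, colW_apply, dif_pos h]

theorem regV_eq_zero {a : Spin m d} {j : Idx m N} (h : j.1 ≠ a.1) : regV g a j = 0 :=
  graded_regV g a j (by simpa [vertex, spinVertex] using h)

theorem regW_eq_zero {a : Spin m d} {j : Idx m N} (h : j.1 ≠ a.1) : regW g j a = 0 :=
  graded_regW g j a (by simpa [vertex, spinVertex] using h.symm)

theorem vertex_ne {i j : Idx m N} (h : i.1 ≠ j.1 + 1) : vertex j ≠ vertex i + -1 := by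
  intro h'
  apply h
  change j.1 = i.1 + -1 at h'
  rw [h']
  abel

theorem bracketDer_XV (i j : Idx m N) (a : Spin m d) (l : Idx m N) :
    bracketDer g (regX g i j) (regV g a l) =
      𝐡 * ((regV g * regX g) a j * proj (Reg g) (vertex (N := N)) (spinVertex a) i l
        - regV g a j * (regX g * proj (Reg g) (vertex (N := N)) (spinVertex a)) i l) := by
  by_cases h : j.1 = i.1 + 1
  · by_cases h' : l.1 = a.1
    · rw [regX_apply g h, regV_apply g h', bracketDer_entry, entryBracket, brXV_eq h h', map_sub,
        reg_smul, reg_smul, map_mul, map_mul, reg_mul_apply, reg_mul_apply, reg_proj_apply,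
        reg_proj, mul_sub]
      rfl
    · rw [regV_eq_zero g h', map_zero, proj_apply_eq_zero_of_ne h', mul_proj_apply, if_neg h']
      simp
  · rw [graded_regX g i j h, bracketDer_zero_left,
      row_mul_proj_eq_zero (graded_regX g) (graded_regV g) h,
      row_mul_mul_proj_eq_zero (graded_regX g) (graded_regV g) h]
    simp

theorem bracketDer_YV (i j : Idx m N) (a : Spin m d) (l : Idx m N) :
    bracketDer g (regY g i j) (regV g a l) =
      𝐡 * ((regV g * regY g) a j * proj (Reg g) (vertex (N := N)) (spinVertex a) i l
        - regV g a j * (regY g * proj (Reg g) (vertex (N := N)) (spinVertex a)) i l) := by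
  by_cases h : i.1 = j.1 + 1
  · by_cases h' : l.1 = a.1
    · rw [regY_apply g h, regV_apply g h', bracketDer_entry, entryBracket, brYV_eq h h', map_sub,
        reg_smul, reg_smul, map_mul, map_mul, reg_mul_apply, reg_mul_apply, reg_proj_apply,
        reg_proj, mul_sub]
      rfl
    · rw [regV_eq_zero g h', map_zero, proj_apply_eq_zero_of_ne h', mul_proj_apply, if_neg h']
      simp
  · rw [graded_regY g i j (vertex_ne h), bracketDer_zero_left,
      row_mul_proj_eq_zero (graded_regY g) (graded_regV g) (vertex_ne h),
      row_mul_mul_proj_eq_zero (graded_regY g) (graded_regV g) (vertex_ne h)]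
    simp

theorem bracketDer_XW (i j k : Idx m N) (a : Spin m d) :
    bracketDer g (regX g i j) (regW g k a) =
      𝐡 * (proj (Reg g) (vertex (N := N)) (spinVertex a) k j * (regX g * regW g) i a
        - (proj (Reg g) (vertex (N := N)) (spinVertex a) * regX g) k j * regW g i a) := by
  by_cases h : j.1 = i.1 + 1
  · by_cases h' : k.1 = a.1
    · rw [regX_apply g h, regW_apply g h', bracketDer_entry, entryBracket, brXW_eq h h', map_sub,
        reg_smul, reg_smul, map_mul, map_mul, reg_mul_apply, reg_mul_apply, reg_proj_apply,
        reg_proj, mul_sub]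
      rfl
    · rw [regW_eq_zero g h', map_zero, proj_apply_eq_zero_of_ne' h', proj_mul_apply, if_neg h']
      simp
  · rw [graded_regX g i j h, bracketDer_zero_left,
      proj_mul_mul_col_eq_zero (graded_regX g) (graded_regW g) h,
      proj_mul_mul_eq_zero (graded_regX g) (graded_regW g) h]
    simp

theorem bracketDer_YW (i j k : Idx m N) (a : Spin m d) :
    bracketDer g (regY g i j) (regW g k a) =
      𝐡 * (proj (Reg g) (vertex (N := N)) (spinVertex a) k j * (regY g * regW g) i a
        - (proj (Reg g) (vertex (N := N)) (spinVertex a) * regY g) k j * regW g i a) := by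
  by_cases h : i.1 = j.1 + 1
  · by_cases h' : k.1 = a.1
    · rw [regY_apply g h, regW_apply g h', bracketDer_entry, entryBracket, brYW_eq h h', map_sub,
        reg_smul, reg_smul, map_mul, map_mul, reg_mul_apply, reg_mul_apply, reg_proj_apply,
        reg_proj, mul_sub]
      rfl
    · rw [regW_eq_zero g h', map_zero, proj_apply_eq_zero_of_ne' h', proj_mul_apply, if_neg h']
      simp
  · rw [graded_regY g i j (vertex_ne h), bracketDer_zero_left,
      proj_mul_mul_col_eq_zero (graded_regY g) (graded_regW g) (vertex_ne h),
      proj_mul_mul_eq_zero (graded_regY g) (graded_regW g) (vertex_ne h)]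
    simp

theorem bracketDer_VV (a : Spin m d) (j : Idx m N) (c : Spin m d) (l : Idx m N) :
    bracketDer g (regV g a j) (regV g c l) =
      -(𝐡 * 𝐜 (osgn a c) * (regV g a j * regV g c l))
        - 𝐡 * 𝐜 (vertexSign spinVertex a c) * (regV g c j * regV g a l) := by
  by_cases h : j.1 = a.1 ∧ l.1 = c.1
  · have e : ∀ b k, regV g b k = ι (V b k) := fun _ _ => rfl
    rw [regV_apply g h.1, regV_apply g h.2, bracketDer_entry, entryBracket, ← regV_apply g h.1,
      ← regV_apply g h.2, brVV, vertexSign_spin, osgn_spin, e, e, e, e]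
    simp only [map_sub, map_neg, map_add, map_mul, reg_smul]
    ring
  · have h0 : bracketDer g (regV g a j) (regV g c l) = 0 ∧ regV g a j * regV g c l = 0 := by
      by_cases h1 : j.1 = a.1
      · rw [regV_eq_zero g fun h2 => h ⟨h1, h2⟩, map_zero, mul_zero]
        exact ⟨rfl, rfl⟩
      · rw [regV_eq_zero g h1, bracketDer_zero_left, zero_mul]
        exact ⟨rfl, rfl⟩
    -- The exchange term is nonzero only at the vertices already excluded, because `vertexSign`
    -- requires a and c to share a vertex.
    have h1 : 𝐜 (vertexSign spinVertex a c) * (regV g c j * regV g a l) = 0 := by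
      rw [vertexSign]
      split_ifs with hac
      · by_cases h1 : j.1 = a.1
        · rw [regV_eq_zero g (a := a) (j := l) fun h2 => h ⟨h1, h2.trans hac⟩, mul_zero, mul_zero]
        · rw [regV_eq_zero g (a := c) (j := j) fun h2 => h1 (h2.trans hac.symm), zero_mul,
            mul_zero]
      · rw [map_zero, zero_mul]
    rw [h0.1, h0.2]
    linear_combination 𝐡 * h1

theorem bracketDer_WW (b : Spin m d) (i k : Idx m N) (a : Spin m d) :
    bracketDer g (regW g i b) (regW g k a) =
      -(𝐡 * 𝐜 (osgn b a) * (regW g k a * regW g i b))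
        - 𝐡 * 𝐜 (vertexSign spinVertex b a) * (regW g k b * regW g i a) := by
  by_cases h : i.1 = b.1 ∧ k.1 = a.1
  · have e : ∀ b k, regW g k b = ι (W b k) := fun _ _ => rfl
    rw [regW_apply g h.1, regW_apply g h.2, bracketDer_entry, entryBracket, ← regW_apply g h.1,
      ← regW_apply g h.2, brWW, vertexSign_spin, osgn_spin, e, e, e, e]
    simp only [map_sub, map_neg, map_add, map_mul, reg_smul]
    ring
  · have h0 : bracketDer g (regW g i b) (regW g k a) = 0 ∧ regW g k a * regW g i b = 0 := by
      by_cases h1 : i.1 = b.1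
      · rw [regW_eq_zero g fun h2 => h ⟨h1, h2⟩, map_zero, zero_mul]
        exact ⟨rfl, rfl⟩
      · rw [regW_eq_zero g h1, bracketDer_zero_left, mul_zero]
        exact ⟨rfl, rfl⟩
    have h1 : 𝐜 (vertexSign spinVertex b a) * (regW g k b * regW g i a) = 0 := by
      rw [vertexSign]
      split_ifs with hba
      · by_cases h1 : i.1 = b.1
        · rw [regW_eq_zero g (a := b) (j := k) fun h2 => h ⟨h1, h2.trans hba⟩, zero_mul, mul_zero]
        · rw [regW_eq_zero g (a := a) (j := i) fun h2 => h1 (h2.trans hba.symm), mul_zero,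
            mul_zero]
      · rw [map_zero, zero_mul]
    rw [h0.1, h0.2]
    linear_combination 𝐡 * h1

theorem bracketDer_VW (a : Spin m d) (j : Idx m N) (b : Spin m d) (k : Idx m N) :
    bracketDer g (regV g a j) (regW g k b) =
      𝐡 * 𝐜 (osgn a b) * (regW g k b * regV g a j)
      + 𝐜 (kd a b) * (proj (Reg g) (vertex (N := N)) (spinVertex a) k j + 𝐡 * (regW g k b * regV g a j)
        + 𝐡 * (proj (Reg g) (vertex (N := N)) (spinVertex a) k j * (regV g * regW g) a b))
      + 𝐡 * 𝐜 (vertexSign spinVertex a b) *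
        (proj (Reg g) (vertex (N := N)) (spinVertex a) k j * (regV g * regW g) a b) := by
  by_cases h : j.1 = a.1 ∧ k.1 = b.1
  · have eV : ∀ b k, regV g b k = ι (V b k) := fun _ _ => rfl
    have eW : ∀ b k, regW g k b = ι (W b k) := fun _ _ => rfl
    have eVW : (regV g * regW g) a b = ι (V a ⬝ᵥ W b) := by
      rw [regV, regW, ← reg_mul_apply]
      rfl
    have e1 : 𝐜 (kd a b) = if a = b then 1 else 0 := by
      rw [kd]
      split_ifs <;> simp
    have e2 : ∀ x : Reg g, (if a = b then (1 : Reg g) else 0) *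
        proj (Reg g) (vertex (N := N)) (spinVertex a) k j * x =
        (if a = b then (1 : Reg g) else 0) * (if k = j then 1 else 0) * x := by
      intro x
      by_cases hab : a = b
      · subst hab
        simp [proj_apply, h.2]
      · simp [hab]
    have e3 : ∀ x : Reg g, 𝐜 (oSpin a b) * proj (Reg g) (vertex (N := N)) (spinVertex a) k j * x =
        𝐜 (oSpin a b) * (if k = j then 1 else 0) * x := by
      intro x
      by_cases hab : a.1 = b.1
      · have : vertex k = spinVertex a := h.2.trans hab.symm
        simp [proj_apply, this]
      · simp [oSpin, hab]
    rw [regV_apply g h.1, regW_apply g h.2, bracketDer_entry, entryBracket, ← regV_apply g h.1,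
      ← regW_apply g h.2, brVW, vertexSign_spin, osgn_spin, eVW, eV, eW, e1]
    simp only [map_sub, map_neg, map_add, map_mul, reg_smul, reg_delta]
    have f1 := e2 1
    have f2 := e2 (ι (V a ⬝ᵥ W b))
    have f3 := e3 (ι (V a ⬝ᵥ W b))
    linear_combination -f1 - 𝐡 * f2 - 𝐡 * f3
  · have hp : 𝐜 (kd a b) * proj (Reg g) (vertex (N := N)) (spinVertex a) k j = 0 := by
      by_cases hab : a = b
      · subst hab
        rw [proj_apply, if_neg, mul_zero]
        rintro ⟨rfl, h2⟩
        exact h ⟨h2, h2⟩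
      · rw [kd_of_ne hab, map_zero, zero_mul]
    have hs : 𝐜 (vertexSign spinVertex a b) * proj (Reg g) (vertex (N := N)) (spinVertex a) k j = 0 := by
      rw [vertexSign]
      split_ifs with hab
      · rw [proj_apply, if_neg, mul_zero]
        rintro ⟨rfl, h2⟩
        exact h ⟨h2, h2.trans hab⟩
      · rw [map_zero, zero_mul]
    have h0 : bracketDer g (regV g a j) (regW g k b) = 0 ∧ regW g k b * regV g a j = 0 := by
      by_cases h1 : j.1 = a.1
      · rw [regW_eq_zero g fun h2 => h ⟨h1, h2⟩, map_zero, zero_mul]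
        exact ⟨rfl, rfl⟩
      · rw [regV_eq_zero g h1, bracketDer_zero_left, mul_zero]
        exact ⟨rfl, rfl⟩
    rw [h0.1, h0.2]
    linear_combination (-1 - 𝐡 * (regV g * regW g) a b) * hp - 𝐡 * (regV g * regW g) a b * hs

end RegBracketSpin

end CyclicQuiver

end

noncomputable section

namespace CyclicQuiver

open Matrix

/-! ### Contractions of brackets of matrices -/

section GradedPart

variable {A : Type*} [CommRing A] {G I : Type*} [AddCommGroup G] [DecidableEq G]

/-- The component of degree `τ` of a matrix. -/
def gradedPart (f : I → G) (τ : G) (M : Matrix I I A) : Matrix I I A :=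
  of fun k l => if f l = f k + τ then M k l else 0

theorem gradedPart_apply (f : I → G) (τ : G) (M : Matrix I I A) (k l : I) :
    gradedPart f τ M k l = if f l = f k + τ then M k l else 0 := rfl

theorem gradedPart_add (f : I → G) (τ : G) (M M' : Matrix I I A) :
    gradedPart f τ (M + M') = gradedPart f τ M + gradedPart f τ M' := by
  ext k l
  simp only [gradedPart_apply, Matrix.add_apply]
  split_ifs <;> simp

theorem gradedPart_neg (f : I → G) (τ : G) (M : Matrix I I A) :
    gradedPart f τ (-M) = -gradedPart f τ M := by
  ext k l
  simp only [gradedPart_apply, Matrix.neg_apply]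
  split_ifs <;> simp

variable [Fintype I] {f : I → G} {σ : G} {L : Matrix I I A}

theorem IsGraded.mul_gradedPart (hL : IsGraded f f σ L) (τ : G) (M : Matrix I I A) :
    L * gradedPart f τ M = gradedPart f (σ + τ) (L * M) := by
  ext k l
  rw [gradedPart_apply, mul_apply, mul_apply]
  split_ifs with h
  · refine Finset.sum_congr rfl fun p _ => ?_
    by_cases hp : f p = f k + σ
    · rw [gradedPart_apply, if_pos (by rw [h, hp, add_assoc])]
    · rw [hL k p hp, zero_mul, zero_mul]
  · refine Finset.sum_eq_zero fun p _ => ?_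
    by_cases hp : f p = f k + σ
    · rw [gradedPart_apply, if_neg (by rw [hp, add_assoc]; exact h), mul_zero]
    · rw [hL k p hp, zero_mul]

theorem IsGraded.gradedPart_mul (hL : IsGraded f f σ L) (τ : G) (M : Matrix I I A) :
    gradedPart f τ M * L = gradedPart f (τ + σ) (M * L) := by
  ext k l
  rw [gradedPart_apply, mul_apply, mul_apply]
  split_ifs with h
  · refine Finset.sum_congr rfl fun p _ => ?_
    by_cases hp : f l = f p + σ
    · rw [gradedPart_apply, if_pos]
      rw [hp, ← add_assoc] at h
      exact add_right_cancel h
    · rw [hL p l hp, mul_zero, mul_zero]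
  · refine Finset.sum_eq_zero fun p _ => ?_
    by_cases hp : f l = f p + σ
    · rw [gradedPart_apply, if_neg, zero_mul]
      intro h'
      apply h
      rw [hp, h', add_assoc]
    · rw [hL p l hp, mul_zero]

variable [DecidableEq I]

theorem sum_proj_mul_mul_proj_eq [Fintype G] (f : I → G) (M : Matrix I I A) :
    ∑ r, proj A f r * M * proj A f r = gradedPart f 0 M := by
  ext i j
  rw [Matrix.sum_apply, gradedPart_apply]
  simp only [mul_proj_apply, proj_mul_apply, add_zero]
  rw [Finset.sum_eq_single (f j)]
  · simp [eq_comm]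
  · intro r _ hr
    rw [if_neg hr.symm]
  · simp

/-- This turns the right side of `LL` into a graded part, so that it can be compared with the
brackets as a noncommutative polynomial in L and P. -/
theorem IsGraded.sum_proj [Fintype G] (hL : IsGraded f f σ L) (P : Matrix I I A) :
    ∑ r, (L * (proj A f r * (L * P) * proj A f r) - (proj A f r * (P * L) * proj A f r) * L) =
      gradedPart f σ (L * L * P - P * L * L) := by
  rw [Finset.sum_sub_distrib, ← Finset.mul_sum, ← Finset.sum_mul, sum_proj_mul_mul_proj_eq,
    sum_proj_mul_mul_proj_eq, hL.mul_gradedPart, hL.gradedPart_mul, add_zero, zero_add,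
    sub_eq_add_neg, sub_eq_add_neg, gradedPart_add, gradedPart_neg, Matrix.mul_assoc L L P]

/-- Homogeneity amounts to moving projections across L with a shift; multiplying by M on both sides
gives the opposite shift for M. -/
theorem IsGraded.inverse (hL : IsGraded f f σ L) {M : Matrix I I A} (h : L * M = 1)
    (h' : M * L = 1) : IsGraded f f (-σ) M := by
  have key : ∀ r, M * proj A f r = proj A f (r + σ) * M := by
    intro r
    calc M * proj A f r = M * (proj A f r * L) * M := by
          rw [Matrix.mul_assoc, Matrix.mul_assoc, h, Matrix.mul_one]
      _ = proj A f (r + σ) * M := by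
          rw [hL.proj_mul, ← Matrix.mul_assoc, h', Matrix.one_mul]
  intro k l hkl
  have := congrFun (congrFun (key (f l)) k) l
  rw [mul_proj_apply, if_pos rfl, proj_mul_apply, if_neg] at this
  · exact this
  · intro h''
    apply hkl
    rw [h'']
    abel

end GradedPart

/-! ### Contracted brackets of matrices. -/

section Contract

variable {A : Type*} [CommRing A] [Algebra ℂ A] {I : Type*} [Fintype I]

/-- The matrix with entries `∑ P_{ji} {M_{ij}, M'_{kl}}`. -/
def contract (β : A → Derivation ℂ A A) (P M M' : Matrix I I A) : Matrix I I A :=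
  ∑ i, ∑ j, P j i • M'.map (β (M i j))

theorem contract_apply (β : A → Derivation ℂ A A) (P M M' : Matrix I I A) (k l : I) :
    contract β P M M' k l = ∑ i, ∑ j, P j i * β (M i j) (M' k l) := by
  simp only [contract, Matrix.sum_apply, Matrix.smul_apply, map_apply, smul_eq_mul]

theorem contract_add_right (β : A → Derivation ℂ A A) (P M M' M'' : Matrix I I A) :
    contract β P M (M' + M'') = contract β P M M' + contract β P M M'' := by
  ext k l
  simp only [Matrix.add_apply, contract_apply, map_add, mul_add, Finset.sum_add_distrib]

theorem contract_add_left {β : A → Derivation ℂ A A} (skew : ∀ F G, β F G = -β G F)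
    (P M M' M'' : Matrix I I A) :
    contract β P (M + M') M'' = contract β P M M'' + contract β P M' M'' := by
  ext k l
  have h : ∀ F F' K, β (F + F') K = β F K + β F' K := fun F F' K => by
    rw [skew, map_add, skew K F, skew K F', neg_add, neg_neg, neg_neg]
  simp only [Matrix.add_apply, contract_apply, h, mul_add, Finset.sum_add_distrib]

variable [DecidableEq I]

theorem map_derivation_inverse (D : Derivation ℂ A A) {M U : Matrix I I A} (h : M * U = 1)
    (h' : U * M = 1) : U.map D = -(U * M.map D * U) := by
  have h1 : (M * U).map D = 0 := by
    rw [h]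
    ext i j
    simp [one_apply, apply_ite D]
  rw [map_derivation_mul] at h1
  have h2 : U * (M.map D * U + M * U.map D) = 0 := by rw [h1, Matrix.mul_zero]
  rw [Matrix.mul_add, ← Matrix.mul_assoc, ← Matrix.mul_assoc, h', Matrix.one_mul] at h2
  exact (neg_eq_of_add_eq_zero_right h2).symm

theorem contract_inverse_right (β : A → Derivation ℂ A A) (P N : Matrix I I A) {M U : Matrix I I A}
    (h : M * U = 1) (h' : U * M = 1) : contract β P N U = -(U * contract β P N M * U) := by
  simp only [contract, map_derivation_inverse _ h h', smul_neg, Finset.sum_neg_distrib,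
    Finset.mul_sum, Finset.sum_mul, Matrix.mul_smul, Matrix.smul_mul]

/-- A derivation sends U = M⁻¹ to minus U (dM) U, and cyclicity of the trace moves both factors U
onto P. -/
theorem contract_inverse_left {β : A → Derivation ℂ A A} (skew : ∀ F G, β F G = -β G F)
    (P N : Matrix I I A) {M U : Matrix I I A} (h : M * U = 1) (h' : U * M = 1) :
    contract β P U N = -contract β (U * P * U) M N := by
  have tr : ∀ Q R : Matrix I I A, ∑ i, ∑ j, Q j i * R i j = (Q * R).trace := by
    intro Q R
    rw [Finset.sum_comm]
    simp only [trace, diag_apply, mul_apply]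
  ext k l
  rw [Matrix.neg_apply, contract_apply, contract_apply]
  have e1 : ∀ i j, P j i * β (U i j) (N k l) = P j i * (U * M.map (β (N k l)) * U) i j := by
    intro i j
    have := congrFun (congrFun (map_derivation_inverse (β (N k l)) h h') i) j
    rw [map_apply, Matrix.neg_apply] at this
    rw [skew, this, neg_neg]
  have e2 : ∀ i j, (U * P * U) j i * β (M i j) (N k l) =
      -((U * P * U) j i * M.map (β (N k l)) i j) := by
    intro i j
    rw [skew, map_apply, mul_neg]
  simp only [e1, e2, Finset.sum_neg_distrib, tr, neg_neg]
  rw [← Matrix.mul_assoc, Matrix.trace_mul_comm, ← Matrix.mul_assoc, ← Matrix.mul_assoc]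

theorem sum_mul_delta_left (P M : Matrix I I A) (k l : I) :
    ∑ i, ∑ j, P j i * ((if i = l then 1 else 0) * M k j) = (M * P) k l := by
  rw [Finset.sum_comm, mul_apply]
  refine Finset.sum_congr rfl fun j _ => ?_
  simp [mul_comm]

theorem sum_mul_delta_right (P M : Matrix I I A) (k l : I) :
    ∑ i, ∑ j, P j i * ((if k = j then 1 else 0) * M i l) = (P * M) k l := by
  rw [mul_apply]
  refine Finset.sum_congr rfl fun j _ => ?_
  simp

theorem sum_mul_delta_delta (P : Matrix I I A) (k l : I) :
    ∑ i, ∑ j, P j i * ((if k = j then 1 else 0) * (if i = l then 1 else 0)) = P k l := by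
  simp

theorem sum_mul_mul (P M M' : Matrix I I A) (k l : I) :
    ∑ i, ∑ j, P j i * (M k j * M' i l) = (M * P * M') k l := by
  rw [mul_apply]
  refine Finset.sum_congr rfl fun i _ => ?_
  rw [mul_apply, Finset.sum_mul]
  refine Finset.sum_congr rfl fun j _ => ?_
  ring

end Contract

/-! ### The Lax systems of X, Y and Z. -/

section LaxSystems

variable {m : ℕ} [NeZero m] {N d : ZMod m → ℕ} (g : Poly m N d)

local notation "𝐡" => algebraMap ℂ (Reg g) (1 / 2)

theorem contract_XX (P : Matrix (Idx m N) (Idx m N) (Reg g)) :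
    contract (bracketDer g) P (regX g) (regX g) =
      gradedPart vertex 1 (𝐡 • (regX g * regX g * P - P * (regX g * regX g))) := by
  ext k l
  rw [contract_apply, gradedPart_apply]
  split_ifs with h
  · simp only [bracketDer_XX g _ _ h, mul_sub, mul_left_comm _ 𝐡, Finset.sum_sub_distrib,
      ← Finset.mul_sum, sum_mul_delta_left, sum_mul_delta_right, Matrix.smul_apply,
      Matrix.sub_apply, smul_eq_mul]
  · simp only [graded_regX g k l h, map_zero, mul_zero, Finset.sum_const_zero]

theorem eq_add_one_of_vertex {k l : Idx m N} (h : vertex l = vertex k + -1) : k.1 = l.1 + 1 := by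
  change l.1 = k.1 + -1 at h
  rw [h]
  abel

theorem contract_YY (P : Matrix (Idx m N) (Idx m N) (Reg g)) :
    contract (bracketDer g) P (regY g) (regY g) =
      gradedPart vertex (-1) (𝐡 • (P * (regY g * regY g) - regY g * regY g * P)) := by
  ext k l
  rw [contract_apply, gradedPart_apply]
  split_ifs with h
  · simp only [bracketDer_YY g _ _ (eq_add_one_of_vertex h), mul_sub, mul_left_comm _ 𝐡,
      Finset.sum_sub_distrib, ← Finset.mul_sum, sum_mul_delta_left, sum_mul_delta_right,
      Matrix.smul_apply, Matrix.sub_apply, smul_eq_mul]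
  · simp only [graded_regY g k l h, map_zero, mul_zero, Finset.sum_const_zero]

theorem contract_XY (P : Matrix (Idx m N) (Idx m N) (Reg g)) :
    contract (bracketDer g) P (regX g) (regY g) =
      gradedPart vertex (-1) (P + 𝐡 • (regY g * regX g * P + P * (regX g * regY g)
        - regX g * P * regY g + regY g * P * regX g)) := by
  ext k l
  rw [contract_apply, gradedPart_apply]
  split_ifs with h
  · simp only [bracketDer_XY g (Or.inr (eq_add_one_of_vertex h)), mul_sub, mul_add,
      mul_left_comm _ 𝐡, Finset.sum_sub_distrib, Finset.sum_add_distrib, ← Finset.mul_sum,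
      sum_mul_delta_left, sum_mul_delta_right, sum_mul_delta_delta, sum_mul_mul, Matrix.smul_apply,
      Matrix.sub_apply, Matrix.add_apply, smul_eq_mul]
    ring
  · simp only [graded_regY g k l h, map_zero, mul_zero, Finset.sum_const_zero]

theorem contract_YX (P : Matrix (Idx m N) (Idx m N) (Reg g)) :
    contract (bracketDer g) P (regY g) (regX g) =
      gradedPart vertex 1 (-(P + 𝐡 • (P * (regY g * regX g) + regX g * regY g * P
        - regY g * P * regX g + regX g * P * regY g))) := by
  ext k l
  rw [contract_apply, gradedPart_apply]
  split_ifs with h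
  · have e : ∀ i j, P j i * bracketDer g (regY g i j) (regX g k l) =
        -(P j i * ((if k = j then 1 else 0) * (if i = l then 1 else 0))
          + 𝐡 * (P j i * ((if k = j then 1 else 0) * (regY g * regX g) i l))
          + 𝐡 * (P j i * ((if i = l then 1 else 0) * (regX g * regY g) k j))
          - 𝐡 * (P j i * (regY g k j * regX g i l)) + 𝐡 * (P j i * (regX g k j * regY g i l))) := by
      intro i j
      rw [bracketDer_skew, bracketDer_XY g (Or.inl h)]
      ring
    simp only [e, Finset.sum_neg_distrib, Finset.sum_sub_distrib, Finset.sum_add_distrib,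
      ← Finset.mul_sum, sum_mul_delta_left, sum_mul_delta_right, sum_mul_delta_delta, sum_mul_mul,
      Matrix.smul_apply, Matrix.sub_apply, Matrix.add_apply, Matrix.neg_apply, smul_eq_mul]
    ring
  · simp only [graded_regX g k l h, map_zero, mul_zero, Finset.sum_const_zero]

theorem isLaxSystem_X :
    IsLaxSystem vertex spinVertex (bracketDer g) (regX g) (regV g) (regW g) 1 1 where
  skew := bracketDer_skew g
  gradedL := graded_regX g
  gradedV := graded_regV g
  gradedW := graded_regW g
  LL P k l := by
    rw [← contract_apply, contract_XX, (graded_regX g).sum_proj, gradedPart_apply, gradedPart_apply,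
      Matrix.mul_assoc P]
    split_ifs <;> simp
  LV := bracketDer_XV g
  LW := bracketDer_XW g
  VV := bracketDer_VV g
  WW b i a k := bracketDer_WW g b i k a
  VW := bracketDer_VW g

theorem isLaxSystem_Y :
    IsLaxSystem vertex spinVertex (bracketDer g) (regY g) (regV g) (regW g) (-1) (-1) where
  skew := bracketDer_skew g
  gradedL := graded_regY g
  gradedV := graded_regV g
  gradedW := graded_regW g
  LL P k l := by
    rw [← contract_apply, contract_YY, (graded_regY g).sum_proj, gradedPart_apply, gradedPart_apply,
      Matrix.mul_assoc P]
    split_ifs <;> simp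
    ring
  LV := bracketDer_YV g
  LW := bracketDer_YW g
  VV := bracketDer_VV g
  WW b i a k := bracketDer_WW g b i k a
  VW := bracketDer_VW g

variable {g}

/-- The bracket of X with V is a difference of two rank one terms. Sandwiching it between inverses
exchanges their roles and the rule for the inverse adds a sign, so X⁻¹ obeys the same formula as X.
-/
theorem bracketDer_inverse_V {U : Matrix (Idx m N) (Idx m N) (Reg g)} (h : regX g * U = 1)
    (h' : U * regX g = 1) (i j : Idx m N) (a : Spin m d) (l : Idx m N) :
    bracketDer g (U i j) (regV g a l) =
      𝐡 * ((regV g * U) a j * proj (Reg g) (vertex (N := N)) (spinVertex a) i l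
        - regV g a j * (U * proj (Reg g) (vertex (N := N)) (spinVertex a)) i l) := by
  have e : (regX g).map (bracketDer g (regV g a l)) =
      of (fun p q => (regX g * proj (Reg g) (vertex (N := N)) (spinVertex a)) p l
        * (𝐡 * regV g a q))
      - of (fun p q => proj (Reg g) (vertex (N := N)) (spinVertex a) p l
        * (𝐡 * (regV g * regX g) a q)) := by
    ext p q
    rw [map_apply, bracketDer_skew, bracketDer_XV, Matrix.sub_apply, of_apply, of_apply]
    ring
  have e1 := congrFun (congrFun (map_derivation_inverse (bracketDer g (regV g a l)) h h') i) j
  rw [map_apply] at e1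
  rw [bracketDer_skew, e1, Matrix.neg_apply, neg_neg, e, Matrix.mul_sub, Matrix.sub_mul,
    Matrix.sub_apply, mul_rank_one_mul, mul_rank_one_mul]
  simp only [mul_assoc 𝐡, ← Finset.mul_sum]
  simp only [← mul_apply]
  rw [← Matrix.mul_assoc, h', Matrix.one_mul, Matrix.mul_assoc, h, Matrix.mul_one]
  ring

theorem bracketDer_inverse_W {U : Matrix (Idx m N) (Idx m N) (Reg g)} (h : regX g * U = 1)
    (h' : U * regX g = 1) (i j k : Idx m N) (a : Spin m d) :
    bracketDer g (U i j) (regW g k a) =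
      𝐡 * (proj (Reg g) (vertex (N := N)) (spinVertex a) k j * (U * regW g) i a
        - (proj (Reg g) (vertex (N := N)) (spinVertex a) * U) k j * regW g i a) := by
  have e : (regX g).map (bracketDer g (regW g k a)) =
      of (fun p q => regW g p a
        * (𝐡 * (proj (Reg g) (vertex (N := N)) (spinVertex a) * regX g) k q))
      - of (fun p q => (regX g * regW g) p a
        * (𝐡 * proj (Reg g) (vertex (N := N)) (spinVertex a) k q)) := by
    ext p q
    rw [map_apply, bracketDer_skew, bracketDer_XW, Matrix.sub_apply, of_apply, of_apply]
    ring
  have e1 := congrFun (congrFun (map_derivation_inverse (bracketDer g (regW g k a)) h h') i) j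
  rw [map_apply] at e1
  rw [bracketDer_skew, e1, Matrix.neg_apply, neg_neg, e, Matrix.mul_sub, Matrix.sub_mul,
    Matrix.sub_apply, mul_rank_one_mul, mul_rank_one_mul]
  simp only [mul_assoc 𝐡, ← Finset.mul_sum]
  simp only [← mul_apply]
  rw [← Matrix.mul_assoc, h', Matrix.one_mul, Matrix.mul_assoc, h, Matrix.mul_one]
  ring

/-- The constant part of {X, Y} contributes -UPU through {U, Y} and +UPU through {Y, U}. The
remaining terms recombine into the formula of `contract_YY` with Y + U in place of Y. -/
theorem contract_add_inverse {U : Matrix (Idx m N) (Idx m N) (Reg g)} (h : regX g * U = 1)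
    (h' : U * regX g = 1) (P : Matrix (Idx m N) (Idx m N) (Reg g)) :
    contract (bracketDer g) P (regY g + U) (regY g + U) =
      gradedPart vertex (-1)
        (𝐡 • (P * (regY g + U) * (regY g + U) - (regY g + U) * (regY g + U) * P)) := by
  have hU : IsGraded vertex vertex (-1) U := (graded_regX g).inverse h h'
  have one : ((-1 : ZMod m) + 1 + -1) = -1 := by abel
  rw [contract_add_right, contract_add_left (bracketDer_skew g),
    contract_add_left (bracketDer_skew g), contract_inverse_left (bracketDer_skew g) _ _ h h',
    contract_inverse_right _ _ (regY g) h h', contract_inverse_right _ _ U h h',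
    contract_inverse_left (bracketDer_skew g) _ _ h h', contract_XX, contract_YY, contract_XY,
    contract_YX, Matrix.mul_neg, Matrix.neg_mul, neg_neg, hU.mul_gradedPart, hU.mul_gradedPart,
    hU.gradedPart_mul, hU.gradedPart_mul, one, ← gradedPart_neg, ← gradedPart_neg,
    ← gradedPart_add, ← gradedPart_add, ← gradedPart_add]
  -- All terms are now graded parts of the same degree, so it suffices to compare the matrices
  -- before truncation, using U X = X U = 1.
  congr 1
  have c1 : ∀ M, regX g * (U * M) = M := fun M => by rw [← Matrix.mul_assoc, h, Matrix.one_mul]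
  have c2 : ∀ M, U * (regX g * M) = M := fun M => by rw [← Matrix.mul_assoc, h', Matrix.one_mul]
  simp only [Matrix.mul_add, Matrix.add_mul, Matrix.mul_sub, Matrix.sub_mul, Matrix.mul_smul,
    Matrix.smul_mul, Matrix.mul_neg, Matrix.neg_mul, Matrix.mul_assoc, c1, c2, h, h',
    Matrix.mul_one]
  simp only [smul_add, smul_sub, smul_neg]
  abel

theorem isLaxSystem_Z {U : Matrix (Idx m N) (Idx m N) (Reg g)} (h : regX g * U = 1)
    (h' : U * regX g = 1) :
    IsLaxSystem vertex spinVertex (bracketDer g) (regY g + U) (regV g) (regW g) (-1) (-1) where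
  skew := bracketDer_skew g
  gradedL := by
    intro i j hij
    rw [Matrix.add_apply, graded_regY g i j hij, (graded_regX g).inverse h h' i j hij, add_zero]
  gradedV := graded_regV g
  gradedW := graded_regW g
  LL P k l := by
    have hZ : IsGraded vertex vertex (-1) (regY g + U) := by
      intro i j hij
      rw [Matrix.add_apply, graded_regY g i j hij, (graded_regX g).inverse h h' i j hij, add_zero]
    rw [← contract_apply, contract_add_inverse h h', hZ.sum_proj, gradedPart_apply,
      gradedPart_apply]
    split_ifs
    · rw [Matrix.smul_apply, Matrix.sub_apply, Matrix.sub_apply, smul_eq_mul, map_neg, map_one]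
      ring
    · simp
  LV i j a l := by
    rw [Matrix.add_apply, bracketDer_skew, map_add, bracketDer_skew g _ (regY g i j),
      bracketDer_skew g _ (U i j), bracketDer_YV, bracketDer_inverse_V h h', Matrix.mul_add,
      Matrix.add_mul, Matrix.add_apply, Matrix.add_apply]
    ring
  LW i j k a := by
    rw [Matrix.add_apply, bracketDer_skew, map_add, bracketDer_skew g _ (regY g i j),
      bracketDer_skew g _ (U i j), bracketDer_YW, bracketDer_inverse_W h h', Matrix.mul_add,
      Matrix.add_mul, Matrix.add_apply, Matrix.add_apply]
    ring
  VV := bracketDer_VV g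
  WW b i a k := bracketDer_WW g b i k a
  VW := bracketDer_VW g

end LaxSystems

end CyclicQuiver

end

noncomputable section

namespace CyclicQuiver

open Matrix

/-! ### Application to the three choices of L. -/

section Final

variable {m : ℕ} [NeZero m] {N d : ZMod m → ℕ}

theorem exists_isLaxSystem (c : Choice) : ∃ (σ : ZMod m) (ε : ℂ), (ε = 1 ∨ ε = -1) ∧
    IsLaxSystem vertex spinVertex (bracketDer (domainPoly c : Poly m N d)) (lax c) (regV _)
      (regW _) σ ε := by
  rcases c with _ | _ | _
  · exact ⟨1, 1, Or.inl rfl, isLaxSystem_X _⟩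
  · exact ⟨-1, -1, Or.inr rfl, isLaxSystem_Y _⟩
  · exact ⟨-1, -1, Or.inr rfl, isLaxSystem_Z (mul_nonsing_inv _ isUnit_det_X)
      (nonsing_inv_mul _ isUnit_det_X)⟩

theorem trSpin_eq_moment (c : Choice) (a b : Spin m d) (k : ℕ) :
    (trSpin c a b k : Reg (domainPoly c : Poly m N d)) =
      moment (lax c) (regV _) (regW _) k b a := by
  have e : (vecMulVec (W a) (V b) : PolyMat m N d).map
      (algebraMap (Poly m N d) (Reg (domainPoly c))) =
      of fun i j => regW _ i a * regV _ b j := by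
    ext i j
    rw [map_apply, vecMulVec_apply, map_mul]
    rfl
  rw [trSpin, e, trace, moment, mul_apply]
  refine Finset.sum_congr rfl fun i _ => ?_
  rw [diag_apply, mul_apply, mul_apply, Finset.sum_mul]
  refine Finset.sum_congr rfl fun j _ => ?_
  rw [of_apply]
  ring

end Final

end CyclicQuiver

end

open CyclicQuiver in
theorem proposition3p1 (m : ℕ) [NeZero m] (hm : 2 ≤ m) (N d : ZMod m → ℕ) (c : Choice) :
    (IsPoissonSubalgebra (bracket (domainPoly c)) (HAlg m N d c) ∧
      ∀ F ∈ HAlg m N d c, ∀ G ∈ HAlg m N d c, bracket (domainPoly c) F G = 0) ∧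
    (∀ (k l : ℕ) (a b : Spin m d),
      bracket (domainPoly c : Poly m N d) (trPow c k) (trSpin c a b l) = 0) ∧
    IsPoissonSubalgebra (bracket (domainPoly c)) (IAlg m N d c) ∧
    (HAlg m N d c : Set (Reg (domainPoly c : Poly m N d))) ⊆
      poissonCentre (bracket (domainPoly c)) (IAlg m N d c) := by
  obtain ⟨σ, ε, hε, H⟩ := exists_isLaxSystem (N := N) (d := d) c
  have hb : (fun F G => bracketDer (domainPoly c : Poly m N d) F G) = bracket (domainPoly c) :=
    funext fun F => funext fun G => bracketDer_apply _ F G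
  have hI : IAlg m N d c = Algebra.adjoin ℂ ({F | ∃ k, F = (lax c ^ k).trace} ∪
      {F | ∃ a b k, F = moment (lax c) (regV _) (regW _) k b a}) := by
    simp only [IAlg, trSpin_eq_moment, trPow]
  have hHI : HAlg m N d c ≤ IAlg m N d c := Algebra.adjoin_mono Set.subset_union_left
  -- Commutation with the larger algebra contains the commutativity of `HAlg`, by `hHI`.
  have hz : ∀ F ∈ HAlg m N d c, ∀ G ∈ IAlg m N d c, bracket (domainPoly c) F G = 0 := by
    intro F hF G hG
    rw [← bracketDer_apply]
    exact H.bracket_trace_pow_adjoin hF (hI ▸ hG)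
  refine ⟨⟨?_, fun F hF G hG => hz F hF G (hHI hG)⟩, fun k l a b => ?_, ?_,
    fun F hF => ⟨hHI hF, hz F hF⟩⟩
  · rw [← hb]
    exact H.isPoissonSubalgebra_trace_pow
  · rw [← bracketDer_apply, trSpin_eq_moment]
    exact H.bracket_trace_pow_moment _ _ _ _
  · rw [← hb, hI]
    exact H.isPoissonSubalgebra_moment hε
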